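/- Let $Q$ be a smooth manifold with a free and proper smooth action of a Lie group $G$ with Lie algebra $\mathfrak g$, let $\kappa$ be a $G$-invariant Riemannian metric on $Q$ (the kinetic energy metric) and $D\subseteq TQ$ a $G$-invariant regular distribution (the constraints). Write $V\subseteq TQ$ for the tangent spaces to the orbits, and let $W\subseteq V$ be a $G$-invariant regular distribution with $TQ=D\oplus W$ (a vertical complement of $D$). For a $G$-manifold $N$ let $\xi_N$ denote the infinitesimal generator of $\xi\in\mathfrak g$. *The nonholonomic bivector.* Let $\mathcal M=\kappa^\sharp(D)\subseteq T^*Q$, where $\kappa^\sharp:TQ\to T^*Q$, $v\mapsto\kappa(v,\cdot)$; it is a $G$-invariant embedded submanifold for the cotangent lifted action. Let $\tau:\mathcal M\to Q$ be the projection, $\iota:\mathcal M\to T^*Q$ the inclusion, $\Theta_{\mathcal M}=\iota^*\Theta_Q$ and $\Omega_{\mathcal M}=\iota^*\Omega_Q$, where $\Theta_Q$ is the Liouville form and $\Omega_Q=-d\Theta_Q$. Put $\mathcal C=\{v\in T\mathcal M: T\tau(v)\in D\}$, let $\mathcal V$ be the tangent spaces to the $G$-orbits in $\mathcal M$, $\mathcal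 S=\mathcal C\cap\mathcal V$ and $\mathcal W=(T\tau|_{\mathcal V})^{-1}(W)$; then $T\mathcal M=\mathcal C\oplus\mathcal W$, with projections $P_{\mathcal C},P_{\mathcal W}$. The restriction of $\Omega_{\mathcal M}$ to $\mathcal C$ is nondegenerate, and $\pi_{nh}$ is the bivector on $\mathcal M$ with $\pi_{nh}^\sharp(\alpha)=-X$ iff $X\in\mathcal C$ and $\mathbf i_X\Omega_{\mathcal M}|_{\mathcal C}=\alpha|_{\mathcal C}$. *The bivector $\pi_{\mathcal J\mathcal K}$.* Let $\mathcal J:\mathcal M\to\mathfrak g^*$, $\langle\mathcal J(m),\eta\rangle=\Theta_{\mathcal M}(\eta_{\mathcal M}(m))$, let $\mathcal A_{\mathcal W}$ be the $\mathfrak g$-valued one-form on $\mathcal M$ with $(\mathcal A_{\mathcal W}(v))_{\mathcal M}(m)=P_{\mathcal W}(v)$ for $v\in T_m\mathcal M$, and $\mathcal K_{\mathcal W}(X,Y)=d\mathcal A_{\mathcal W}(P_{\mathcal C}X,P_{\mathcal C}Y)$. Let $B=-\langle\mathcal J,\mathcal K_{\mathcal W}\rangle$ and $B^\flat(X)=\mathbf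 i_XB$; then $\mathrm{Id}+B^\flat\circ\pi_{nh}^\sharp$ is invertible, and $\pi_{\mathcal J\mathcal K}$ is the gauge transformation of $\pi_{nh}$ by $B$: $\pi_{\mathcal J\mathcal K}^\sharp=\pi_{nh}^\sharp\circ(\mathrm{Id}+B^\flat\circ\pi_{nh}^\sharp)^{-1}$. *Momentum maps.* Let $\mathfrak g_{\mathcal S}|_m=\{\xi\in\mathfrak g:\xi_{\mathcal M}(m)\in\mathcal S_m\}$ and $\mathfrak g_{\mathcal W}|_m=\{\xi\in\mathfrak g:\xi_{\mathcal M}(m)\in\mathcal W_m\}$; then $\mathfrak g=\mathfrak g_{\mathcal S}|_m\oplus\mathfrak g_{\mathcal W}|_m$ for all $m\in\mathcal M$, and $P_{\mathfrak g_{\mathcal S}}$ denotes the projection onto $\mathfrak g_{\mathcal S}$ along $\mathfrak g_{\mathcal W}$. The nonholonomic momentum map $\mathcal J^{nh}:\mathcal M\to\mathfrak g_{\mathcal S}^*$ is $\langle\mathcal J^{nh}(m),\xi\rangle=\Theta_{\mathcal M}(\xi_{\mathcal M}(m))$ for $\xi\in\mathfrak g_{\mathcal S}|_m$. Let $\mathcal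 J_0:W^\circ\to\mathfrak g^*$ be the restriction of the canonical momentum map of $T^*Q$ to the annihilator $W^\circ$ of $W$. Let $P_D,P_W$ be the projections of $TQ=D\oplus W$, $\kappa_0(X,Y)=\kappa(P_DX,P_DY)+\kappa(P_WX,P_WY)$, and let $\Psi:\mathcal M\to W^\circ$ be the map $\kappa^\sharp(v)\mapsto\kappa_0^\sharp(v)$, $v\in D$. Then: (i) $\mathcal J_0\circ\Psi=P_{\mathfrak g_{\mathcal S}}^*\circ\mathcal J^{nh}$, i.e. $\langle\mathcal J_0(\Psi(m)),\eta\rangle=\langle\mathcal J^{nh}(m),P_{\mathfrak g_{\mathcal S}}(\eta)\rangle$ for all $m\in\mathcal M$, $\eta\in\mathfrak g$. (ii) If $\mathcal W$ satisfies the vertical-symmetry condition, i.e. there is a Lie subalgebra $\mathfrak h\subseteq\mathfrak g$ with $\mathcal W_m=\{\xi_{\mathcal M}(m):\xi\in\mathfrak h\}$ for all $m\in\mathcal M$, then for every $\eta\in\mathfrak g$ the function $\langle\mathcal J^{nh},P_{\mathfrak g_{\mathcal S}}(\eta)\rangle$ is smooth on $\mathcal M$ and $$\pi_{\mathcal J\mathcal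 K}^\sharp\big(d\langle\mathcal J^{nh},P_{\mathfrak g_{\mathcal S}}(\eta)\rangle\big)=-\big(P_{\mathfrak g_{\mathcal S}}(\eta)\big)_{\mathcal M}.$$ -/

import Mathlib

open scoped Manifold ContDiff Topology

noncomputable section

namespace Nonholonomic

section LinearAlgebra

variable {T : Type*} [AddCommGroup T] [Module ℝ T]

open scoped Classical in
/-- The projection onto `p` along `q`, for `T = p ⊕ q` (and `0` if this is not a direct sum). -/
def projOnto (p q : Submodule ℝ T) : T →ₗ[ℝ] p :=
  if h : IsCompl p q then p.projectionOnto q h else 0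

open scoped Classical in
/-- The map `π♯ : T* → T` of the bivector defined by a subspace `F` and a two-form `Ω` whose
restriction to `F` is nondegenerate: `π♯ α = -X`, where `X ∈ F` is the unique vector with
`Ω(X, Y) = α(Y)` for all `Y ∈ F`. -/
def bivectorSharp [FiniteDimensional ℝ T] (F : Submodule ℝ T) (Ω : LinearMap.BilinForm ℝ T) :
    Module.Dual ℝ T →ₗ[ℝ] T :=
  if h : (Ω.restrict F).Nondegenerate then
    -(F.subtype ∘ₗ ((Ω.restrict F).toDual h).symm.toLinearMap ∘ₗ F.subtype.dualMap)
  else 0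

/-- The endomorphism `Id + B♭ ∘ π♯` of `T*`, where `B♭ X = B(X, ·)`. -/
def gaugeEndo (π : Module.Dual ℝ T →ₗ[ℝ] T) (B : LinearMap.BilinForm ℝ T) :
    Module.End ℝ (Module.Dual ℝ T) :=
  1 + (B : T →ₗ[ℝ] Module.Dual ℝ T) ∘ₗ π

/-- The gauge transformation `π♯ ∘ (Id + B♭ ∘ π♯)⁻¹` of a bivector by a two-form `B`
(meaningful when `Id + B♭ ∘ π♯` is invertible). -/
def gaugeTransform (π : Module.Dual ℝ T →ₗ[ℝ] T) (B : LinearMap.BilinForm ℝ T) :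
    Module.Dual ℝ T →ₗ[ℝ] T :=
  π ∘ₗ Ring.inverse (gaugeEndo π B)

end LinearAlgebra

section Manifolds

variable {E : Type*} [NormedAddCommGroup E] [NormedSpace ℝ E]
  {H : Type*} [TopologicalSpace H] (I : ModelWithCorners ℝ E H)
  {N : Type*} [TopologicalSpace N] [ChartedSpace H N]
  {F : Type*} [NormedAddCommGroup F] [NormedSpace ℝ F]

instance instFiniteDimensionalTangentSpace [FiniteDimensional ℝ E] (x : N) :
    FiniteDimensional ℝ (TangentSpace I x) :=
  inferInstanceAs (FiniteDimensional ℝ E)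

instance instT2SpaceTangentSpace (x : N) : T2Space (TangentSpace I x) :=
  inferInstanceAs (T2Space E)

/-- The identification of the tangent space at `x` with the model space by the preferred chart at
`x`; with Mathlib's definition of the tangent space it is the identity. -/
def tangentEquiv (x : N) : TangentSpace I x ≃ₗ[ℝ] E where
  toFun v := v
  invFun v := v
  map_add' _ _ := rfl
  map_smul' _ _ := rfl

/-- The expression of an `F`-valued one-form in the preferred chart at `x₀`, i.e. its pullback
under the inverse chart. -/
def oneFormInChart [FiniteDimensional ℝ E] (α : ∀ x : N, TangentSpace I x →ₗ[ℝ] F)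
    (x₀ : N) (y : E) : E →L[ℝ] F :=
  LinearMap.toContinuousLinearMap
    (α ((extChartAt I x₀).symm y) ∘ₗ
      (mfderiv 𝓘(ℝ, E) I (extChartAt I x₀).symm y).toLinearMap ∘ₗ
      (tangentEquiv 𝓘(ℝ, E) y).symm.toLinearMap)

/-- The exterior derivative of an `F`-valued one-form on a manifold without boundary, computed in
the preferred chart at `x`: `dα(X, Y) = (D_X α)(Y) - (D_Y α)(X)`. -/
def extDerivOne [FiniteDimensional ℝ E] (α : ∀ x : N, TangentSpace I x →ₗ[ℝ] F) (x : N) :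
    TangentSpace I x →ₗ[ℝ] TangentSpace I x →ₗ[ℝ] F :=
  let L : E →L[ℝ] E →L[ℝ] F := fderiv ℝ (oneFormInChart I α x) (extChartAt I x x)
  (LinearMap.mk₂ ℝ (fun X Y : E => L X Y - L Y X)
    (by intro a b c; simp only [map_add, add_apply]; abel)
    (by intro r a b; simp [smul_sub])
    (by intro a b c; simp only [map_add, add_apply]; abel)
    (by intro r a b; simp [smul_sub])).compl₁₂
      (tangentEquiv I x).toLinearMap (tangentEquiv I x).toLinearMap

variable {EG : Type*} [NormedAddCommGroup EG] [NormedSpace ℝ EG]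
  {G : Type*} [Group G] [TopologicalSpace G] [ChartedSpace EG G]

/-- The infinitesimal generators of an action `act` of `G` on `N`: the linear map
`ξ ↦ ξ_N(x) = d/dt|₀ act (exp tξ) x`, that is, the derivative at `1` of the orbit map. (The middle
map only replaces the base point `act 1 x` by `x`.) -/
def infGen (act : G → N → N) (x : N) : GroupLieAlgebra 𝓘(ℝ, EG) G →ₗ[ℝ] TangentSpace I x :=
  (tangentEquiv I x).symm.toLinearMap ∘ₗ (tangentEquiv I (act 1 x)).toLinearMap ∘ₗ
    (mfderiv 𝓘(ℝ, EG) I (fun g => act g x) 1).toLinearMap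

end Manifolds

section Configuration

variable {E : Type*} [NormedAddCommGroup E] [NormedSpace ℝ E]
  {Q : Type*} [TopologicalSpace Q] [ChartedSpace E Q] [IsManifold 𝓘(ℝ, E) ∞ Q]

/-- `D` is a smooth regular distribution, i.e. locally spanned by pointwise linearly independent
smooth vector fields. -/
def IsRegularDistribution (D : ∀ q : Q, Submodule ℝ (TangentSpace 𝓘(ℝ, E) q)) : Prop :=
  ∀ q₀ : Q, ∃ (k : ℕ) (X : Fin k → ∀ q : Q, TangentSpace 𝓘(ℝ, E) q), ∃ U ∈ 𝓝 q₀,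
    (∀ i, ContMDiffOn 𝓘(ℝ, E) 𝓘(ℝ, E).tangent ∞
      (fun q => (⟨q, X i q⟩ : TangentBundle 𝓘(ℝ, E) Q)) U) ∧
    ∀ q ∈ U, LinearIndependent ℝ (fun i => X i q) ∧
      Submodule.span ℝ (Set.range fun i => X i q) = D q

/-- The distribution `D` is invariant under the (lifted) action of `G`. -/
def IsInvariantDistribution (G : Type*) [Group G] [MulAction G Q]
    (D : ∀ q : Q, Submodule ℝ (TangentSpace 𝓘(ℝ, E) q)) : Prop :=
  ∀ (g : G) (q : Q), ∀ v ∈ D q, mfderiv 𝓘(ℝ, E) 𝓘(ℝ, E) (fun x : Q => g • x) q v ∈ D (g • q)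

variable (E Q) in
/-- Smooth Riemannian metrics on `Q`. -/
abbrev Metric :=
  Bundle.ContMDiffRiemannianMetric 𝓘(ℝ, E) ∞ E (fun q : Q => TangentSpace 𝓘(ℝ, E) q)

variable (E Q) in
/-- The cotangent bundle `T*Q`. -/
abbrev Cotangent :=
  Bundle.TotalSpace (E →L[ℝ] ℝ) (fun q : Q => TangentSpace 𝓘(ℝ, E) q →L[ℝ] ℝ)

variable (E) in
/-- The model with corners of the cotangent bundle. -/
abbrev cotModel := 𝓘(ℝ, E).prod 𝓘(ℝ, E →L[ℝ] ℝ)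

variable [FiniteDimensional ℝ E]

/-- The metric `κ` is invariant under the (lifted) action of `G`. -/
def IsInvariantMetric (G : Type*) [Group G] [MulAction G Q] (κ : Metric E Q) : Prop :=
  ∀ (g : G) (q : Q) (v w : TangentSpace 𝓘(ℝ, E) q),
    κ.inner (g • q) (mfderiv 𝓘(ℝ, E) 𝓘(ℝ, E) (fun x : Q => g • x) q v)
      (mfderiv 𝓘(ℝ, E) 𝓘(ℝ, E) (fun x : Q => g • x) q w) = κ.inner q v w

/-- The cotangent lift of the action: `g` maps `α ∈ T*_q Q` to `α ∘ (T_q g)⁻¹ ∈ T*_{g q} Q`. -/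
def cotangentLift {G : Type*} [Group G] [MulAction G Q] (g : G) (p : Cotangent E Q) :
    Cotangent E Q :=
  ⟨g • p.proj, p.2.comp (mfderiv 𝓘(ℝ, E) 𝓘(ℝ, E) (fun x : Q => g • x) p.proj).inverse⟩

/-- The Liouville one-form `Θ_Q` on `T*Q`: `Θ_Q(v) = p(Tτ_Q v)` for `v ∈ T_p(T*Q)`. -/
def liouville (p : Cotangent E Q) : TangentSpace (cotModel E) p →ₗ[ℝ] ℝ :=
  p.2.toLinearMap ∘ₗ
    (mfderiv (cotModel E) 𝓘(ℝ, E) (fun x : Cotangent E Q => x.proj) p).toLinearMap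

/-- The canonical two-form `Ω_Q = -dΘ_Q` on `T*Q`. -/
def canonicalForm (p : Cotangent E Q) : LinearMap.BilinForm ℝ (TangentSpace (cotModel E) p) :=
  -extDerivOne (cotModel E) liouville p

/-- The canonical momentum map `J : T*Q → 𝔤*` of the lifted action,
`⟨J(p), η⟩ = Θ_Q(η_{T*Q}(p))`. -/
def canonicalMomentum {EG : Type*} [NormedAddCommGroup EG] [NormedSpace ℝ EG]
    (G : Type*) [Group G] [TopologicalSpace G] [ChartedSpace EG G] [MulAction G Q]
    (p : Cotangent E Q) : Module.Dual ℝ (GroupLieAlgebra 𝓘(ℝ, EG) G) :=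
  liouville p ∘ₗ infGen (cotModel E) (cotangentLift : G → Cotangent E Q → Cotangent E Q) p

/-- The constraint submanifold `𝓜 = κ♯(D) ⊆ T*Q`, image of `D` under the Legendre transform. -/
def constraintSet (κ : Metric E Q) (D : ∀ q : Q, Submodule ℝ (TangentSpace 𝓘(ℝ, E) q)) :
    Set (Cotangent E Q) :=
  {p | ∃ v ∈ D p.proj, p.2 = κ.inner p.proj v}

/-- The annihilator `W° ⊆ T*Q` of a distribution `W` on `Q`. -/
def annihilator (W : ∀ q : Q, Submodule ℝ (TangentSpace 𝓘(ℝ, E) q)) : Set (Cotangent E Q) :=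
  {p | ∀ w ∈ W p.proj, p.2 w = 0}

/-- The metric `κ₀(X, Y) = κ(P_D X, P_D Y) + κ(P_W X, P_W Y)` of the splitting `TQ = D ⊕ W`, as the
map `κ₀♯ : TQ → T*Q`. -/
def splitMetric (κ : Metric E Q) (D W : ∀ q : Q, Submodule ℝ (TangentSpace 𝓘(ℝ, E) q)) (q : Q)
    (X : TangentSpace 𝓘(ℝ, E) q) : TangentSpace 𝓘(ℝ, E) q →L[ℝ] ℝ :=
  let PD := LinearMap.toContinuousLinearMap ((D q).subtype ∘ₗ projOnto (D q) (W q))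
  let PW := LinearMap.toContinuousLinearMap ((W q).subtype ∘ₗ projOnto (W q) (D q))
  (κ.inner q (PD X)).comp PD + (κ.inner q (PW X)).comp PW

/-- The map `Ψ = κ₀♯ ∘ (κ♯)⁻¹`, to be considered on `𝓜 = κ♯(D)`, where it takes values in `W°`.
(The map `κ♯` is bijective from `T_q Q` to `T*_q Q`.) -/
def Psi (κ : Metric E Q) (D W : ∀ q : Q, Submodule ℝ (TangentSpace 𝓘(ℝ, E) q))
    (p : Cotangent E Q) : Cotangent E Q :=
  ⟨p.proj, splitMetric κ D W p.proj (Function.invFun (fun v => κ.inner p.proj v) p.2)⟩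

end Configuration

/-! In this section `S` is a submanifold of `T*Q`, with tangent spaces modelled on `ES`; it will be
the constraint submanifold. -/

section Submanifold

variable {E : Type*} [NormedAddCommGroup E] [NormedSpace ℝ E] [FiniteDimensional ℝ E]
  {Q : Type*} [TopologicalSpace Q] [ChartedSpace E Q] [IsManifold 𝓘(ℝ, E) ∞ Q]
  {ES : Type*} [NormedAddCommGroup ES] [NormedSpace ℝ ES] [FiniteDimensional ℝ ES]
  {S : Set (Cotangent E Q)} [ChartedSpace ES S]

/-- The derivative `Tι` of the inclusion `ι : S → T*Q`. -/
def inclDeriv (m : S) : TangentSpace 𝓘(ℝ, ES) m →ₗ[ℝ] TangentSpace (cotModel E) (m : Cotangent E Q) :=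
  (mfderiv 𝓘(ℝ, ES) (cotModel E) (Subtype.val : S → Cotangent E Q) m).toLinearMap

/-- `Θ_𝓜 = ι* Θ_Q`. -/
def thetaS (m : S) : TangentSpace 𝓘(ℝ, ES) m →ₗ[ℝ] ℝ :=
  liouville (m : Cotangent E Q) ∘ₗ inclDeriv m

/-- `Ω_𝓜 = ι* Ω_Q`. -/
def omegaS (m : S) : LinearMap.BilinForm ℝ (TangentSpace 𝓘(ℝ, ES) m) :=
  (canonicalForm (m : Cotangent E Q)).compl₁₂ (inclDeriv m) (inclDeriv m)

/-- The projection `τ : 𝓜 → Q`. -/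
def tau (m : S) : Q := (m : Cotangent E Q).proj

/-- The derivative `Tτ : T𝓜 → TQ`. -/
def tauDeriv (m : S) : TangentSpace 𝓘(ℝ, ES) m →ₗ[ℝ] TangentSpace 𝓘(ℝ, E) (tau m) :=
  (mfderiv 𝓘(ℝ, ES) 𝓘(ℝ, E) (tau : S → Q) m).toLinearMap

/-- The distribution `𝒞 = {v ∈ T𝓜 | Tτ v ∈ D}`. -/
def distC (D : ∀ q : Q, Submodule ℝ (TangentSpace 𝓘(ℝ, E) q)) (m : S) :
    Submodule ℝ (TangentSpace 𝓘(ℝ, ES) m) :=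
  (D (tau m)).comap (tauDeriv m)

section Action

variable {EG : Type*} [NormedAddCommGroup EG] [NormedSpace ℝ EG]
  (G : Type*) [Group G] [TopologicalSpace G] [ChartedSpace EG G] [MulAction G Q]

variable {G} in
open scoped Classical in
/-- The restriction to an invariant submanifold `S` of the lifted action of `G` on `T*Q`. -/
def restrictedAction (g : G) (m : S) : S :=
  if h : cotangentLift g (m : Cotangent E Q) ∈ S then ⟨cotangentLift g m, h⟩ else m

/-- The infinitesimal generators `ξ ↦ ξ_𝓜(m)` of the action of `G` on `𝓜`. -/
def genS (m : S) : GroupLieAlgebra 𝓘(ℝ, EG) G →ₗ[ℝ] TangentSpace 𝓘(ℝ, ES) m :=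
  infGen 𝓘(ℝ, ES) (restrictedAction : G → S → S) m

/-- The momentum map `𝒥 : 𝓜 → 𝔤*`, `⟨𝒥(m), η⟩ = Θ_𝓜(η_𝓜(m))`. -/
def momentumS (m : S) : Module.Dual ℝ (GroupLieAlgebra 𝓘(ℝ, EG) G) :=
  thetaS m ∘ₗ genS (ES := ES) G m

/-- The tangent spaces `𝒱` to the `G`-orbits in `𝓜`. -/
def distV (m : S) : Submodule ℝ (TangentSpace 𝓘(ℝ, ES) m) :=
  LinearMap.range (genS (EG := EG) G m)

variable (EG) (D W : ∀ q : Q, Submodule ℝ (TangentSpace 𝓘(ℝ, E) q))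

/-- `𝒮 = 𝒱 ∩ 𝒞`. -/
def distS (m : S) : Submodule ℝ (TangentSpace 𝓘(ℝ, ES) m) :=
  distV (EG := EG) G m ⊓ distC D m

/-- `𝒲 = (Tτ|_𝒱)⁻¹(W)`. -/
def distW (m : S) : Submodule ℝ (TangentSpace 𝓘(ℝ, ES) m) :=
  distV (EG := EG) G m ⊓ (W (tau m)).comap (tauDeriv m)

/-- The projection `P_𝒞 : T𝓜 → 𝒞` along `𝒲`. -/
def projC (m : S) : TangentSpace 𝓘(ℝ, ES) m →ₗ[ℝ] TangentSpace 𝓘(ℝ, ES) m :=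
  (distC D m).subtype ∘ₗ projOnto (distC D m) (distW EG G W m)

/-- The projection `P_𝒲 : T𝓜 → 𝒲` along `𝒞`. -/
def projW (m : S) : TangentSpace 𝓘(ℝ, ES) m →ₗ[ℝ] TangentSpace 𝓘(ℝ, ES) m :=
  (distW EG G W m).subtype ∘ₗ projOnto (distW EG G W m) (distC D m)

/-- The `𝔤`-valued one-form `𝒜_𝒲` on `𝓜`: `𝒜_𝒲(v) = ξ` iff `P_𝒲(v) = ξ_𝓜(m)`. (For a free action
`ξ ↦ ξ_𝓜(m)` is injective, and its image contains `𝒲`. The Lie algebra `𝔤` is identified with the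
model space of `G`, which carries a norm.) -/
def formA (m : S) : TangentSpace 𝓘(ℝ, ES) m →ₗ[ℝ] EG :=
  (tangentEquiv 𝓘(ℝ, EG) (1 : G)).toLinearMap ∘ₗ
    (genS (EG := EG) G m).leftInverse ∘ₗ projW EG G D W m

/-- The two-form `⟨𝒥, 𝒦_𝒲⟩` on `𝓜`, where `𝒦_𝒲(X, Y) = d𝒜_𝒲(P_𝒞 X, P_𝒞 Y)` is the
`𝒲`-curvature. -/
def formJK (m : S) : LinearMap.BilinForm ℝ (TangentSpace 𝓘(ℝ, ES) m) :=
  ((extDerivOne 𝓘(ℝ, ES) (fun x : S => formA EG G D W x) m).compl₁₂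
    (projC EG G D W m) (projC EG G D W m)).compr₂
      (momentumS (EG := EG) (ES := ES) G m ∘ₗ (tangentEquiv 𝓘(ℝ, EG) (1 : G)).symm.toLinearMap)

/-- The map `π_nh♯` of the nonholonomic bivector, defined by `𝒞` and `Ω_𝓜`. -/
def sharpNh (m : S) :
    Module.Dual ℝ (TangentSpace 𝓘(ℝ, ES) m) →ₗ[ℝ] TangentSpace 𝓘(ℝ, ES) m :=
  bivectorSharp (distC D m) (omegaS m)

/-- The map `π_JK♯` of the gauge transformation `π_JK` of `π_nh` by the two-form `-⟨𝒥, 𝒦_𝒲⟩`. -/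
def sharpJK (m : S) :
    Module.Dual ℝ (TangentSpace 𝓘(ℝ, ES) m) →ₗ[ℝ] TangentSpace 𝓘(ℝ, ES) m :=
  gaugeTransform (sharpNh D m) (-formJK EG G D W m)

/-- The fibre at `m` of `𝔤_𝒮 = {ξ | ξ_𝓜(m) ∈ 𝒮}`. -/
def algS (m : S) : Submodule ℝ (GroupLieAlgebra 𝓘(ℝ, EG) G) :=
  (distS (ES := ES) EG G D m).comap (genS G m)

/-- The fibre at `m` of `𝔤_𝒲 = {ξ | ξ_𝓜(m) ∈ 𝒲}`. -/
def algW (m : S) : Submodule ℝ (GroupLieAlgebra 𝓘(ℝ, EG) G) :=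
  (distW (ES := ES) EG G W m).comap (genS G m)

variable (ES) in
/-- The projection `P_{𝔤_𝒮} : 𝔤 → 𝔤_𝒮|_m` along `𝔤_𝒲|_m`. -/
def projAlgS (m : S) : GroupLieAlgebra 𝓘(ℝ, EG) G →ₗ[ℝ] algS (ES := ES) EG G D m :=
  projOnto (algS (ES := ES) EG G D m) (algW (ES := ES) EG G W m)

variable (ES) in
/-- The nonholonomic momentum map `𝒥ⁿʰ(m) ∈ (𝔤_𝒮|_m)*`, `𝒥ⁿʰ(m)(ξ) = Θ_𝓜(ξ_𝓜(m))`. -/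
def momentumNh (m : S) : Module.Dual ℝ (algS (ES := ES) EG G D m) :=
  thetaS (ES := ES) m ∘ₗ genS G m ∘ₗ (algS (ES := ES) EG G D m).subtype

variable (ES) in
/-- The function `m ↦ ⟨𝒥ⁿʰ(m), P_{𝔤_𝒮}(η)⟩` on `𝓜`. -/
def momentumNhFun (η : GroupLieAlgebra 𝓘(ℝ, EG) G) (m : S) : ℝ :=
  momentumNh ES EG G D m (projAlgS ES EG G D W m η)

variable (ES) (S) in
/-- The vertical-symmetry condition: there is a Lie subalgebra `𝔤_𝒲` of `𝔤` such that
`𝒲_m = {ξ_𝓜(m) | ξ ∈ 𝔤_𝒲}` for all `m`. -/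
def VerticalSymmetry : Prop :=
  ∃ h : Submodule ℝ (GroupLieAlgebra 𝓘(ℝ, EG) G), (∀ ξ ∈ h, ∀ η ∈ h, ⁅ξ, η⁆ ∈ h) ∧
    ∀ m : S, distW (ES := ES) EG G W m = h.map (genS (ES := ES) G m)

end Action

end Submanifold

end Nonholonomic

end

/-! Everything on `𝓜` is reduced to `Q` through `τ`. Since `Tτ(ξ_𝓜) = ξ_Q`, membership of a
generator in `𝒞`, `𝒲`, `𝒮` is decided by `D` and `W`. The form `𝒜_𝒲` is `τ*A`, where `A` (`connQ`)
is the `𝔤`-valued form on `Q` that kills `D` and sends `ξ_Q ∈ W` to `ξ`; the momentum is `⟨𝒥(m), ξ⟩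
= m(ξ_Q)`.

Well-definedness. The basic identity is `Ω_Q(X, β^v) = β(Tτ X)` for the vertical lift `β^v` of a
covector (`canonicalForm_vertLift`). Testing `X ∈ 𝒞` against the vertical lift of `κ(Tτ X, ·)` gives
`κ(Tτ X, Tτ X) = 0`, so an `X` orthogonal to all vertical vectors is vertical. A vertical tangent
vector of `𝓜` is the lift of some `κ(u, ·)` with `u ∈ D`, and pairing it with a vector over `u`
gives `κ(u, u) = 0`. Hence `Ω_𝓜` is nondegenerate on `𝒞`. The form `⟨𝒥, 𝒦_𝒲⟩` vanishes on vertical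
vectors, so the first half of the argument also shows that the gauge endomorphism is injective.

(i) For `v ∈ D` one has `κ₀(v, x) = κ(v, P_D x)`, so `Ψ(m) = m ∘ P_D`; moreover `P_D(η_Q) = (P_{𝔤_𝒮}
η)_Q`.

(ii) Fix `m`, write `η = ζ + ν` in `𝔤_𝒮 ⊕ 𝔤_𝒲` at `m`, and let `f = ⟨𝒥ⁿʰ, P_{𝔤_𝒮} η⟩ = ⟨𝒥, η -
A(η_Q)⟩ = ⟨𝒥, ζ⟩ + ⟨𝒥, ν - A(η_Q)⟩`. The last factor vanishes at `m`, so `df(Y) = d⟨𝒥, ζ⟩(Y) -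
⟨𝒥(m), d(A(η_Q))(Y)⟩`. The first term is `Ω_𝓜(ζ_𝓜, Y)` by invariance of `Θ_Q`. For `Y` over `D`,
invariance of `D` gives `dA(ξ_Q, Y) = -d(A(ξ_Q))(Y)`. Vertical symmetry makes `A(ν_Q)` the constant
`ν`, so `dA(ν_Q, Y) = 0` and the second term is `⟨𝒥, dA(ζ_Q, Y)⟩`. Altogether `df = (Ω_𝓜 + ⟨𝒥,
𝒦_𝒲⟩)(ζ_𝓜, ·)` on `𝒞`, which is what `π_JK♯(df) = -ζ_𝓜` means (`gaugeTransform_bivectorSharp`). -/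

noncomputable section
set_option linter.unusedSectionVars false
namespace Nonholonomic

/-! ### Exterior derivatives of one-forms computed along two-parameter maps. -/

section TwoParameter

/-- The tangent vector `v` at the point `z` of a normed space. -/
def vecAt {P : Type*} [NormedAddCommGroup P] [NormedSpace ℝ P] (z v : P) :
    TangentBundle 𝓘(ℝ, P) P := ⟨z, v⟩

variable {E : Type*} [NormedAddCommGroup E] [NormedSpace ℝ E]
  {H : Type*} [TopologicalSpace H] {I : ModelWithCorners ℝ E H}
  {N : Type*} [TopologicalSpace N] [ChartedSpace H N]
  {F : Type*} [NormedAddCommGroup F] [NormedSpace ℝ F]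

theorem tangentMap_vecAt {P : Type*} [NormedAddCommGroup P] [NormedSpace ℝ P] (f : P → N)
    (z v : P) :
    tangentMap 𝓘(ℝ, P) I f (vecAt z v) = ⟨f z, mfderiv 𝓘(ℝ, P) I f z v⟩ := rfl

/-- Derivatives are compared as points of the tangent bundle throughout: base points such as `f x`
and `g x` are often only propositionally equal, and equality in the total space needs no transport.
-/
theorem tangentMap_congr {E' : Type*} [NormedAddCommGroup E'] [NormedSpace ℝ E']
    {H' : Type*} [TopologicalSpace H'] {I' : ModelWithCorners ℝ E' H'}
    {N' : Type*} [TopologicalSpace N'] [ChartedSpace H' N'] {f g : N → N'}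
    {v : TangentBundle I N} (h : f =ᶠ[𝓝 v.1] g) : tangentMap I I' f v = tangentMap I I' g v := by
  simp only [tangentMap]
  rw [h.mfderiv_eq]
  ext
  · exact h.self_of_nhds
  · rfl

/-- A map from a normed space into a manifold with prescribed derivative at `0`. -/
theorem exists_contMDiffAt_tangentMap [I.Boundaryless] [IsManifold I ∞ N]
    {P : Type*} [NormedAddCommGroup P] [NormedSpace ℝ P]
    (x : N) (A : P →L[ℝ] E) :
    ∃ f : P → N, ContMDiffAt 𝓘(ℝ, P) I ∞ f 0 ∧
      (∀ a : P, tangentMap 𝓘(ℝ, P) I f (vecAt 0 a) = ⟨x, (tangentEquiv I x).symm (A a)⟩) ∧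
      ∀ z, f z = (extChartAt I x).symm (extChartAt I x x + A z) := by
  set φ := extChartAt I x with hφ
  have hl : ContDiff ℝ ∞ (fun z : P => φ x + A z) := by fun_prop
  have hmem : φ.target ∈ 𝓝 (φ x) := extChartAt_target_mem_nhds x
  have hf : ContMDiffAt 𝓘(ℝ, P) I ∞ (fun z : P => φ.symm (φ x + A z)) 0 := by
    have h1 : ContMDiffAt 𝓘(ℝ, E) I ∞ φ.symm (φ x + A 0) := by
      rw [map_zero, add_zero]
      exact (contMDiffOn_extChartAt_symm (n := ∞) x).contMDiffAt hmem
    exact h1.comp (0 : P) hl.contMDiff.contMDiffAt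
  have h0 : φ.symm (φ x + A 0) = x := by simp [hφ]
  refine ⟨fun z => φ.symm (φ x + A z), hf, fun a => ?_, fun _ => rfl⟩
  have hd : HasMFDerivAt 𝓘(ℝ, P) I (fun z : P => φ.symm (φ x + A z)) 0 A := by
    refine ⟨hf.continuousAt, ?_⟩
    have hw : writtenInExtChartAt 𝓘(ℝ, P) I 0 (fun z : P => φ.symm (φ x + A z)) =ᶠ[𝓝 0]
        fun z => φ x + A z := by
      have : ∀ᶠ z in 𝓝 (0 : P), φ x + A z ∈ φ.target := by
        apply hl.continuous.continuousAt.eventually_mem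
        simpa using hmem
      filter_upwards [this] with z hz
      simp only [writtenInExtChartAt, h0, extChartAt_model_space_eq_id, Function.comp_apply,
        PartialEquiv.refl_symm, PartialEquiv.refl_coe, id]
      exact φ.right_inv hz
    have h2 : HasFDerivAt (fun z : P => φ x + A z) A 0 := A.hasFDerivAt.const_add _
    exact (h2.congr_of_eventuallyEq hw).hasFDerivWithinAt
  rw [tangentMap_vecAt, hd.mfderiv]
  ext
  · exact h0
  · simp [tangentEquiv]
    rfl

/-- A one-form on `N` as a function on the tangent bundle. -/
def oneFormMap (α : ∀ x : N, TangentSpace I x →ₗ[ℝ] F) (v : TangentBundle I N) : F := α v.1 v.2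

/-- The chart expression of a smooth one-form is differentiable. -/
theorem differentiableAt_oneFormInChart [I.Boundaryless] [IsManifold I ∞ N] [FiniteDimensional ℝ E]
    (α : ∀ x : N, TangentSpace I x →ₗ[ℝ] F)
    (hα : ContMDiff I.tangent 𝓘(ℝ, F) ∞ (oneFormMap α)) (x : N) :
    DifferentiableAt ℝ (oneFormInChart I α x) (extChartAt I x x) := by
  set φ := extChartAt I x with hφ
  have hmem : φ.target ∈ 𝓝 (φ x) := extChartAt_target_mem_nhds x
  suffices h : ContDiffAt ℝ ∞ (oneFormInChart I α x) (φ x) from h.differentiableAt (by simp)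
  have hopen : IsOpen φ.target := isOpen_extChartAt_target x
  suffices h : ContDiffOn ℝ ∞ (oneFormInChart I α x) φ.target from h.contDiffAt hmem
  -- In finite dimension it suffices to evaluate on a constant vector `v`; that value is `α`
  -- composed with the tangent map of the inverse chart and the constant vector field `v`.
  rw [contDiffOn_clm_apply]
  intro v
  have h1 : ContMDiffOn 𝓘(ℝ, E) I ∞ φ.symm φ.target := contMDiffOn_extChartAt_symm x
  have : IsManifold I 1 N := .of_le (n := ∞) (by simp)
  have h2 := h1.contMDiffOn_tangentMapWithin (m := ∞) (by simp) hopen.uniqueMDiffOn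
  have h3 : ContMDiff 𝓘(ℝ, E) 𝓘(ℝ, E).tangent ∞ (fun y => (⟨y, v⟩ : TangentBundle 𝓘(ℝ, E) E)) := by
    exact contMDiff_vectorSpace_iff_contDiff (V := fun _ => v).2 contDiff_const
  have h4 := hα.comp_contMDiffOn (h2.comp h3.contMDiffOn (fun y hy => hy))
  refine (contMDiffOn_iff_contDiffOn.1 h4).congr fun y hy => ?_
  simp only [oneFormInChart, Function.comp_def, tangentMapWithin]
  rw [mfderivWithin_of_isOpen hopen hy]
  rfl

theorem extDerivOne_apply [FiniteDimensional ℝ E] (α : ∀ x : N, TangentSpace I x →ₗ[ℝ] F) (x : N)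
    (X Y : TangentSpace I x) :
    extDerivOne I α x X Y =
      fderiv ℝ (oneFormInChart I α x) (extChartAt I x x) (tangentEquiv I x X) (tangentEquiv I x Y) -
      fderiv ℝ (oneFormInChart I α x) (extChartAt I x x) (tangentEquiv I x Y)
        (tangentEquiv I x X) := rfl

/-- The exterior derivative of a one-form in terms of a map of two parameters. -/
theorem extDerivOne_eq_deriv_sub_deriv [I.Boundaryless] [IsManifold I ∞ N] [FiniteDimensional ℝ E]
    (α : ∀ x : N, TangentSpace I x →ₗ[ℝ] F) (hα : ContMDiff I.tangent 𝓘(ℝ, F) ∞ (oneFormMap α))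
    {f : ℝ × ℝ → N} (hf : ContMDiffAt 𝓘(ℝ, ℝ × ℝ) I ∞ f 0) {x : N} {X Y : TangentSpace I x}
    (hX : tangentMap 𝓘(ℝ, ℝ × ℝ) I f (vecAt 0 (1, 0)) = ⟨x, X⟩)
    (hY : tangentMap 𝓘(ℝ, ℝ × ℝ) I f (vecAt 0 (0, 1)) = ⟨x, Y⟩) :
    extDerivOne I α x X Y =
      deriv (fun t : ℝ => oneFormMap α (tangentMap 𝓘(ℝ, ℝ × ℝ) I f (vecAt (t, 0) (0, 1)))) 0 -
      deriv (fun s : ℝ => oneFormMap α (tangentMap 𝓘(ℝ, ℝ × ℝ) I f (vecAt (0, s) (1, 0)))) 0 := by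
  have hM1 : IsManifold I 1 N := .of_le (n := ∞) (by simp)
  obtain rfl : f 0 = x := congrArg Bundle.TotalSpace.proj hX
  have hX' := Bundle.TotalSpace.mk_injective (f 0) hX
  have hY' := Bundle.TotalSpace.mk_injective (f 0) hY
  set φ := extChartAt I (f 0) with hφ
  set u : ℝ × ℝ → E := fun z => φ (f z) with hu
  have hu2 : ContDiffAt ℝ 2 u 0 := by
    have h := (contMDiffAt_extChartAt (I := I) (n := ∞) (x := f 0)).comp (0 : ℝ × ℝ) hf
    exact (contMDiffAt_iff_contDiffAt.1 h).of_le ENat.LEInfty.out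
  have hω := differentiableAt_oneFormInChart α hα (f 0)
  have hev : ∀ᶠ z in 𝓝 (0 : ℝ × ℝ), ∀ v : ℝ × ℝ,
      oneFormMap α (tangentMap 𝓘(ℝ, ℝ × ℝ) I f (vecAt z v)) =
        oneFormInChart I α (f 0) (u z) (fderiv ℝ u z v) := by
    have hsrc : ∀ᶠ z in 𝓝 (0 : ℝ × ℝ), f z ∈ φ.source :=
      hf.continuousAt.eventually_mem (extChartAt_source_mem_nhds (f 0))
    filter_upwards [hsrc.eventually_nhds, hu2.eventually (by decide)] with z hz huz v
    have h1 : f =ᶠ[𝓝 z] φ.symm ∘ u := by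
      filter_upwards [hz] with w hw
      exact (φ.left_inv hw).symm
    have hut : u z ∈ φ.target := φ.map_source hz.self_of_nhds
    have h2 : MDifferentiableAt 𝓘(ℝ, E) I φ.symm (u z) :=
      ((contMDiffOn_extChartAt_symm (n := ∞) (f 0)).contMDiffAt
        ((isOpen_extChartAt_target (f 0)).mem_nhds hut)).mdifferentiableAt (by simp)
    have h3 : MDifferentiableAt 𝓘(ℝ, ℝ × ℝ) 𝓘(ℝ, E) u z :=
      (huz.differentiableAt (by simp)).mdifferentiableAt
    have h4 : tangentMap 𝓘(ℝ, ℝ × ℝ) I f (vecAt z v) =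
        tangentMap 𝓘(ℝ, E) I φ.symm (vecAt (u z) (fderiv ℝ u z v)) := by
      have h5 : tangentMap 𝓘(ℝ, ℝ × ℝ) I f (vecAt z v) =
          tangentMap 𝓘(ℝ, ℝ × ℝ) I (φ.symm ∘ u) (vecAt z v) := tangentMap_congr h1
      rw [h5, tangentMap_comp_at _ h2 h3]
      simp only [tangentMap, vecAt, mfderiv_eq_fderiv]
      rfl
    rw [h4]
    rfl
  -- Product rule for `ω(u)(Du · v)` in the direction `w`. In the difference of the two mixed
  -- derivatives the terms `ω(D²u(w, v))` cancel by symmetry of `D²u`, leaving the chart formula for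
  -- `dα`.
  have hd : ∀ (v w : ℝ × ℝ), HasDerivAt
      (fun t : ℝ => oneFormMap α (tangentMap 𝓘(ℝ, ℝ × ℝ) I f (vecAt (t • w) v)))
      (fderiv ℝ (oneFormInChart I α (f 0)) (φ (f 0)) (fderiv ℝ u 0 w) (fderiv ℝ u 0 v) +
        oneFormInChart I α (f 0) (φ (f 0)) (fderiv ℝ (fderiv ℝ u) 0 w v)) 0 := by
    intro v w
    have hl : HasDerivAt (fun t : ℝ => t • w) w 0 := by
      simpa using (hasDerivAt_id (0 : ℝ)).smul_const w
    have hl0 : (0 : ℝ) • w = 0 := zero_smul _ _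
    have hu1 : HasFDerivAt u (fderiv ℝ u 0) ((0 : ℝ) • w) := by
      rw [hl0]; exact (hu2.differentiableAt (by simp)).hasFDerivAt
    have hu' : HasFDerivAt (fderiv ℝ u) (fderiv ℝ (fderiv ℝ u) 0) ((0 : ℝ) • w) := by
      rw [hl0]
      exact ((hu2.fderiv_right (m := 1) (by norm_num)).differentiableAt (by simp)).hasFDerivAt
    have hc1 := hu1.comp_hasDerivAt (0 : ℝ) hl
    have hω' : HasFDerivAt (oneFormInChart I α (f 0))
        (fderiv ℝ (oneFormInChart I α (f 0)) (φ (f 0))) ((u ∘ fun t : ℝ => t • w) 0) := by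
      simp only [Function.comp_apply, hl0]
      exact hω.hasFDerivAt
    have hc2 := hω'.comp_hasDerivAt (0 : ℝ) hc1
    have hc3 := hu'.comp_hasDerivAt (0 : ℝ) hl
    have hc4 := hc2.clm_apply (hc3.clm_apply (hasDerivAt_const (0 : ℝ) v))
    have hev' : ∀ᶠ t in 𝓝 (0 : ℝ), oneFormMap α (tangentMap 𝓘(ℝ, ℝ × ℝ) I f (vecAt (t • w) v)) =
        oneFormInChart I α (f 0) (u (t • w)) (fderiv ℝ u (t • w) v) := by
      have hlt : Filter.Tendsto (fun t : ℝ => t • w) (𝓝 0) (𝓝 0) := by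
        simpa using hl.continuousAt.tendsto
      filter_upwards [hlt.eventually hev] with t ht using ht v
    refine (hc4.congr_of_eventuallyEq hev').congr_deriv ?_
    simp [hl0, hu]
  have hmf : ∀ v : ℝ × ℝ, tangentEquiv I (f 0) (mfderiv 𝓘(ℝ, ℝ × ℝ) I f 0 v) = fderiv ℝ u 0 v := by
    intro v
    rw [(hf.mdifferentiableAt (by simp)).mfderiv]
    simp only [modelWithCornersSelf_coe, Set.range_id, fderivWithin_univ]
    rfl
  have h1 := (hd (0, 1) (1, 0)).deriv
  have h2 := (hd (1, 0) (0, 1)).deriv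
  have hsymm : IsSymmSndFDerivAt ℝ u 0 := hu2.isSymmSndFDerivAt (by simp)
  have e1 : (fun t : ℝ => oneFormMap α (tangentMap 𝓘(ℝ, ℝ × ℝ) I f (vecAt (t, 0) (0, 1)))) =
      fun t => oneFormMap α (tangentMap 𝓘(ℝ, ℝ × ℝ) I f (vecAt (t • (1, 0)) (0, 1))) := by
    simp
  have e2 : (fun t : ℝ => oneFormMap α (tangentMap 𝓘(ℝ, ℝ × ℝ) I f (vecAt (0, t) (1, 0)))) =
      fun t => oneFormMap α (tangentMap 𝓘(ℝ, ℝ × ℝ) I f (vecAt (t • (0, 1)) (1, 0))) := by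
    simp
  rw [e1, e2, h1, h2, hsymm.eq (1, 0) (0, 1)]
  have m1 := (congrArg (tangentEquiv I (f 0)) hX').symm.trans (hmf (1, 0))
  have m2 := (congrArg (tangentEquiv I (f 0)) hY').symm.trans (hmf (0, 1))
  rw [extDerivOne_apply, m1, m2]
  abel

theorem exists_contMDiffAt_tangentMap_pair [I.Boundaryless] [IsManifold I ∞ N] (x : N)
    (X Y : TangentSpace I x) :
    ∃ f : ℝ × ℝ → N, ContMDiffAt 𝓘(ℝ, ℝ × ℝ) I ∞ f 0 ∧
      tangentMap 𝓘(ℝ, ℝ × ℝ) I f (vecAt 0 (1, 0)) = ⟨x, X⟩ ∧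
      tangentMap 𝓘(ℝ, ℝ × ℝ) I f (vecAt 0 (0, 1)) = ⟨x, Y⟩ := by
  obtain ⟨f, hf, h, -⟩ := exists_contMDiffAt_tangentMap (I := I) x
    ((ContinuousLinearMap.fst ℝ ℝ ℝ).smulRight (tangentEquiv I x X) +
      (ContinuousLinearMap.snd ℝ ℝ ℝ).smulRight (tangentEquiv I x Y))
  exact ⟨f, hf, by simp [h], by simp [h]⟩

theorem exists_curve [I.Boundaryless] [IsManifold I ∞ N] (v : TangentBundle I N) :
    ∃ c : ℝ → N, ContMDiffAt 𝓘(ℝ, ℝ) I ∞ c 0 ∧ tangentMap 𝓘(ℝ, ℝ) I c (vecAt 0 1) = v := by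
  obtain ⟨f, hf, h, -⟩ := exists_contMDiffAt_tangentMap (I := I) v.1
    ((1 : ℝ →L[ℝ] ℝ).smulRight (tangentEquiv I v.1 v.2))
  exact ⟨f, hf, by simp [h]⟩

/-- The exterior derivative of one-forms commutes with pullbacks. -/
theorem extDerivOne_pullback [I.Boundaryless] [IsManifold I ∞ N] [FiniteDimensional ℝ E]
    {E' : Type*} [NormedAddCommGroup E'] [NormedSpace ℝ E'] [FiniteDimensional ℝ E']
    {H' : Type*} [TopologicalSpace H'] {I' : ModelWithCorners ℝ E' H'} [I'.Boundaryless]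
    {N' : Type*} [TopologicalSpace N'] [ChartedSpace H' N'] [IsManifold I' ∞ N']
    (α : ∀ x : N, TangentSpace I x →ₗ[ℝ] F) (hα : ContMDiff I.tangent 𝓘(ℝ, F) ∞ (oneFormMap α))
    (β : ∀ x : N', TangentSpace I' x →ₗ[ℝ] F) {g : N' → N} (hg : ContMDiff I' I ∞ g)
    (hβ : ∀ v, oneFormMap β v = oneFormMap α (tangentMap I' I g v))
    (x : N') (X Y : TangentSpace I' x) :
    extDerivOne I' β x X Y = extDerivOne I α (g x) (mfderiv I' I g x X) (mfderiv I' I g x Y) := by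
  have hN : IsManifold I 1 N := .of_le (n := ∞) (by simp)
  have hN' : IsManifold I' 1 N' := .of_le (n := ∞) (by simp)
  -- Both sides are read off from the two-parameter formula, for `β` along `f` and for `α` along `g
  -- ∘ f`; the functions being differentiated agree near `0`.
  obtain ⟨f, hf, hX, hY⟩ := exists_contMDiffAt_tangentMap_pair x X Y
  have hβs : ContMDiff I'.tangent 𝓘(ℝ, F) ∞ (oneFormMap β) := by
    rw [funext hβ]
    exact hα.comp (hg.contMDiff_tangentMap (by simp))
  have hgf := hg.contMDiffAt.comp (0 : ℝ × ℝ) hf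
  have hf1 : ∀ᶠ z in 𝓝 (0 : ℝ × ℝ), MDifferentiableAt 𝓘(ℝ, ℝ × ℝ) I' f z := by
    have : ∀ᶠ z in 𝓝 (0 : ℝ × ℝ), ContMDiffAt 𝓘(ℝ, ℝ × ℝ) I' 1 f z :=
      (contMDiffAt_iff_contMDiffAt_nhds (by decide)).1 (hf.of_le ENat.LEInfty.out)
    filter_upwards [this] with z hz using hz.mdifferentiableAt (by simp)
  have hcomp : ∀ᶠ z in 𝓝 (0 : ℝ × ℝ), ∀ v : ℝ × ℝ,
      oneFormMap β (tangentMap 𝓘(ℝ, ℝ × ℝ) I' f (vecAt z v)) =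
        oneFormMap α (tangentMap 𝓘(ℝ, ℝ × ℝ) I (g ∘ f) (vecAt z v)) := by
    filter_upwards [hf1] with z hz v
    rw [hβ, tangentMap_comp_at _ (hg.mdifferentiable (by simp) _) hz]
  have hX' : tangentMap 𝓘(ℝ, ℝ × ℝ) I (g ∘ f) (vecAt 0 (1, 0)) = ⟨g x, mfderiv I' I g x X⟩ := by
    rw [tangentMap_comp_at _ (hg.mdifferentiable (by simp) _) hf1.self_of_nhds, hX]
    rfl
  have hY' : tangentMap 𝓘(ℝ, ℝ × ℝ) I (g ∘ f) (vecAt 0 (0, 1)) = ⟨g x, mfderiv I' I g x Y⟩ := by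
    rw [tangentMap_comp_at _ (hg.mdifferentiable (by simp) _) hf1.self_of_nhds, hY]
    rfl
  rw [extDerivOne_eq_deriv_sub_deriv β hβs hf hX hY,
    extDerivOne_eq_deriv_sub_deriv α hα hgf hX' hY']
  have t1 : Filter.Tendsto (fun t : ℝ => ((t, 0) : ℝ × ℝ)) (𝓝 0) (𝓝 0) :=
    (Continuous.prodMk continuous_id continuous_const).tendsto' _ _ rfl
  have t2 : Filter.Tendsto (fun t : ℝ => ((0, t) : ℝ × ℝ)) (𝓝 0) (𝓝 0) :=
    (Continuous.prodMk continuous_const continuous_id).tendsto' _ _ rfl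
  congr 1
  · exact Filter.EventuallyEq.deriv_eq ((t1.eventually hcomp).mono fun t ht => ht _)
  · exact Filter.EventuallyEq.deriv_eq ((t2.eventually hcomp).mono fun t ht => ht _)

end TwoParameter

/-! ### Smooth structure of the cotangent bundle, the Liouville form and the lifted action. -/

section CotangentBundle
variable {E : Type*} [NormedAddCommGroup E] [NormedSpace ℝ E]
  {Q : Type*} [TopologicalSpace Q] [ChartedSpace E Q] [IsManifold 𝓘(ℝ, E) ∞ Q]
variable {EM : Type*} [NormedAddCommGroup EM] [NormedSpace ℝ EM]
  {HM : Type*} [TopologicalSpace HM] {J : ModelWithCorners ℝ EM HM}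
  {M : Type*} [TopologicalSpace M] [ChartedSpace HM M]

theorem contMDiff_cotangent_proj :
    ContMDiff (cotModel E) 𝓘(ℝ, E) ∞ (fun x : Cotangent E Q => x.proj) :=
  Bundle.contMDiff_proj (fun q : Q => TangentSpace 𝓘(ℝ, E) q →L[ℝ] ℝ)

/-- `T*Q` is the bundle of homomorphisms from `TQ` to the trivial line bundle, so this is smoothness
of evaluation in a hom bundle, read in the fibre of the trivial bundle. -/
theorem contMDiffAt_pairing {p : M → Cotangent E Q} {x : M} (hp : ContMDiffAt J (cotModel E) ∞ p x)
    {v : ∀ m, TangentSpace 𝓘(ℝ, E) (p m).proj}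
    (hv : ContMDiffAt J 𝓘(ℝ, E).tangent ∞
      (fun m => (⟨(p m).proj, v m⟩ : TangentBundle 𝓘(ℝ, E) Q)) x) :
    ContMDiffAt J 𝓘(ℝ, ℝ) ∞ (fun m => (p m).2 (v m)) x := by
  have h := ContMDiffAt.clm_bundle_apply (F₁ := E) (E₁ := fun q : Q => TangentSpace 𝓘(ℝ, E) q)
    (E₂ := Bundle.Trivial Q ℝ) (F₂ := ℝ) (b := fun m => (p m).proj) (ϕ := fun m => (p m).2)
    (v := v) hp hv
  exact (Bundle.contMDiffAt_totalSpace.1 h).2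

theorem contMDiffAt_metric (κ : Metric E Q) {b : M → Q} {x : M}
    {v : ∀ m, TangentSpace 𝓘(ℝ, E) (b m)}
    (hv : ContMDiffAt J 𝓘(ℝ, E).tangent ∞ (fun m => (⟨b m, v m⟩ : TangentBundle 𝓘(ℝ, E) Q)) x) :
    ContMDiffAt J (cotModel E) ∞ (fun m => (⟨b m, κ.inner (b m) (v m)⟩ : Cotangent E Q)) x := by
  have hb : ContMDiffAt J 𝓘(ℝ, E) ∞ b x := (Bundle.contMDiffAt_totalSpace.1 hv).1
  exact ContMDiffAt.clm_bundle_apply (F₁ := E) (E₁ := fun q : Q => TangentSpace 𝓘(ℝ, E) q)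
    (E₂ := fun q : Q => TangentSpace 𝓘(ℝ, E) q →L[ℝ] ℝ) (F₂ := E →L[ℝ] ℝ) (b := b)
    (ϕ := fun m => κ.inner (b m)) (v := v) (κ.contMDiff.contMDiffAt.comp x hb) hv

variable [FiniteDimensional ℝ E]

theorem contMDiff_liouville :
    ContMDiff (cotModel E).tangent 𝓘(ℝ, ℝ) ∞ (oneFormMap (liouville (E := E) (Q := Q))) := by
  intro v
  have h1 : ContMDiff (cotModel E).tangent (cotModel E) ∞
      (fun v : TangentBundle (cotModel E) (Cotangent E Q) => v.proj) :=
    Bundle.contMDiff_proj _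
  exact contMDiffAt_pairing h1.contMDiffAt
    (contMDiff_cotangent_proj.contMDiff_tangentMap (m := ∞) (by simp)).contMDiffAt

section SmoothTranslations

variable {G : Type*} [Group G] [MulAction G Q]

/-- Replaces a pointwise inverse by the derivative of the action of `g⁻¹`, whose joint smoothness in
`g` and the point is available. -/
theorem inverse_mfderiv_smul
    (hG : ∀ g : G, ContMDiff 𝓘(ℝ, E) 𝓘(ℝ, E) ∞ (fun x : Q => g • x)) (g : G) (q : Q) :
    (mfderiv 𝓘(ℝ, E) 𝓘(ℝ, E) (fun x : Q => g • x) q).inverse =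
      mfderiv 𝓘(ℝ, E) 𝓘(ℝ, E) (fun x : Q => g⁻¹ • x) (g • q) := by
  have hd : ∀ (h : G) (x : Q), MDifferentiableAt 𝓘(ℝ, E) 𝓘(ℝ, E) (fun x : Q => h • x) x :=
    fun h x => (hG h).mdifferentiable (by simp) x
  have A : mfderiv 𝓘(ℝ, E) 𝓘(ℝ, E) ((fun x : Q => g⁻¹ • x) ∘ (fun x : Q => g • x)) q =
      ContinuousLinearMap.id _ _ := by
    have : (fun x : Q => g⁻¹ • x) ∘ (fun x : Q => g • x) = id := by ext x; simp
    rw [this, id_eq, mfderiv_id]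
  rw [mfderiv_comp (I' := 𝓘(ℝ, E)) _ (hd _ _) (hd _ _)] at A
  have B : mfderiv 𝓘(ℝ, E) 𝓘(ℝ, E) ((fun x : Q => g • x) ∘ (fun x : Q => g⁻¹ • x)) (g • q) =
      ContinuousLinearMap.id _ _ := by
    have : (fun x : Q => g • x) ∘ (fun x : Q => g⁻¹ • x) = id := by ext x; simp
    rw [this, id_eq, mfderiv_id]
  rw [mfderiv_comp (I' := 𝓘(ℝ, E)) _ (hd _ _) (hd _ _), inv_smul_smul g q] at B
  exact ContinuousLinearMap.inverse_eq B A

theorem inverse_mfderiv_smul_apply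
    (hG : ∀ g : G, ContMDiff 𝓘(ℝ, E) 𝓘(ℝ, E) ∞ (fun x : Q => g • x)) (g : G) (q : Q)
    (v : TangentSpace 𝓘(ℝ, E) q) :
    (mfderiv 𝓘(ℝ, E) 𝓘(ℝ, E) (fun x : Q => g • x) q).inverse
      (mfderiv 𝓘(ℝ, E) 𝓘(ℝ, E) (fun x : Q => g • x) q v) = v := by
  have hd : ∀ (h : G) (x : Q), MDifferentiableAt 𝓘(ℝ, E) 𝓘(ℝ, E) (fun x : Q => h • x) x :=
    fun h x => (hG h).mdifferentiable (by simp) x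
  have A : mfderiv 𝓘(ℝ, E) 𝓘(ℝ, E) ((fun x : Q => g⁻¹ • x) ∘ (fun x : Q => g • x)) q =
      ContinuousLinearMap.id _ _ := by
    have : (fun x : Q => g⁻¹ • x) ∘ (fun x : Q => g • x) = id := by ext x; simp
    rw [this, id_eq, mfderiv_id]
  rw [mfderiv_comp (I' := 𝓘(ℝ, E)) _ (hd _ _) (hd _ _), ← inverse_mfderiv_smul hG] at A
  exact DFunLike.congr_fun A v

/-- The cotangent lift of `p` takes the value `p v` on the tangent lift of `v`. -/
theorem cotangentLift_apply
    (hG : ∀ g : G, ContMDiff 𝓘(ℝ, E) 𝓘(ℝ, E) ∞ (fun x : Q => g • x)) (g : G) (p : Cotangent E Q)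
    (v : TangentSpace 𝓘(ℝ, E) p.proj) :
    (cotangentLift g p).2 (mfderiv 𝓘(ℝ, E) 𝓘(ℝ, E) (fun x : Q => g • x) p.proj v) = p.2 v :=
  congrArg p.2 (inverse_mfderiv_smul_apply hG g p.proj v)

theorem cotangentLift_one (p : Cotangent E Q) : cotangentLift (1 : G) p = p := by
  obtain ⟨q, p⟩ := p
  have h1 : (fun x : Q => (1 : G) • x) = id := by ext x; simp
  have h2 : mfderiv 𝓘(ℝ, E) 𝓘(ℝ, E) (fun x : Q => (1 : G) • x) q =
      ContinuousLinearMap.id ℝ E := by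
    rw [h1]; exact mfderiv_id
  ext
  · exact one_smul G q
  · have h3 := (congrArg ContinuousLinearMap.inverse h2).trans ContinuousLinearMap.inverse_id
    exact heq_of_eq ((congrArg (fun A : E →L[ℝ] E => ContinuousLinearMap.comp (p : E →L[ℝ] ℝ) A)
      h3).trans (ContinuousLinearMap.comp_id _))

/-- The bundle projection intertwines the lift with the action of `g` on `Q`, and the lifted
covector composed with `Tg` is the original one. -/
theorem liouville_cotangentLift
    (hG : ∀ g : G, ContMDiff 𝓘(ℝ, E) 𝓘(ℝ, E) ∞ (fun x : Q => g • x)) (g : G)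
    (hg : MDifferentiable (cotModel E) (cotModel E)
      (cotangentLift g : Cotangent E Q → Cotangent E Q))
    (v : TangentBundle (cotModel E) (Cotangent E Q)) :
    oneFormMap liouville (tangentMap (cotModel E) (cotModel E) (cotangentLift g) v) =
      oneFormMap liouville v := by
  have h1 := tangentMap_comp_at v
    (contMDiff_cotangent_proj (E := E) (Q := Q) |>.mdifferentiable (by simp) _) (hg v.1)
  have h2 := tangentMap_comp_at (f := fun x : Cotangent E Q => x.proj) v
    ((hG g).mdifferentiable (by simp) _)
    (contMDiff_cotangent_proj (E := E) (Q := Q) |>.mdifferentiable (by simp) v.1)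
  have h3 := h1.symm.trans h2
  have h4 := Bundle.TotalSpace.mk_injective _ h3
  exact (congrArg (cotangentLift g v.1).2 h4).trans (cotangentLift_apply hG g v.1 _)

end SmoothTranslations

section Action
variable {EG : Type*} [NormedAddCommGroup EG] [NormedSpace ℝ EG]
  {G : Type*} [Group G] [TopologicalSpace G]
  [ChartedSpace EG G] [LieGroup 𝓘(ℝ, EG) ∞ G]
  [MulAction G Q] [ContMDiffSMul 𝓘(ℝ, EG) 𝓘(ℝ, E) ∞ G Q]

theorem contMDiff_smul_left (EG : Type*) [NormedAddCommGroup EG] [NormedSpace ℝ EG]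
    [ChartedSpace EG G] [ContMDiffSMul 𝓘(ℝ, EG) 𝓘(ℝ, E) ∞ G Q] (g : G) :
    ContMDiff 𝓘(ℝ, E) 𝓘(ℝ, E) ∞ (fun x : Q => g • x) :=
  (contMDiff_smul (I := 𝓘(ℝ, EG)) (G := G)).comp (contMDiff_const.prodMk contMDiff_id)

variable (E Q EG G) in
theorem contMDiff_cotangentLift :
    ContMDiff (𝓘(ℝ, EG).prod (cotModel E)) (cotModel E) ∞
      (fun z : G × Cotangent E Q => cotangentLift z.1 z.2) := by
  intro z₀
  have hproj : ContMDiff (𝓘(ℝ, EG).prod (cotModel E)) 𝓘(ℝ, E) ∞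
      (fun z : G × Cotangent E Q => z.2.proj) := contMDiff_cotangent_proj.comp contMDiff_snd
  have hbase : ContMDiff (𝓘(ℝ, EG).prod (cotModel E)) 𝓘(ℝ, E) ∞
      (fun z : G × Cotangent E Q => z.1 • z.2.proj) :=
    (contMDiff_smul (I := 𝓘(ℝ, EG)) (G := G)).comp (contMDiff_fst.prodMk hproj)
  have h0 : ContMDiffAt (𝓘(ℝ, EG).prod (cotModel E)) (cotModel E) ∞
      (fun z : G × Cotangent E Q => z.2) z₀ := contMDiffAt_snd
  have h1 := (contMDiffAt_hom_bundle (E₁ := fun q : Q => TangentSpace 𝓘(ℝ, E) q)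
    (E₂ := Bundle.Trivial Q ℝ) (fun z : G × Cotangent E Q => z.2)).1 h0
  -- In bundle coordinates the lift of `p` is `p` composed with the derivative of `q ↦ g⁻¹ • q` at
  -- `g • p.proj`; this parametric derivative is smooth in `(g, p)`.
  have h2 := ContMDiffAt.mfderiv (x₀ := z₀) (J := 𝓘(ℝ, EG).prod (cotModel E)) (I := 𝓘(ℝ, E))
    (I' := 𝓘(ℝ, E)) (n := ∞) (m := ∞)
    (fun (z : G × Cotangent E Q) (q : Q) => z.1⁻¹ • q)
    (fun z => z.1 • z.2.proj) ?_ hbase.contMDiffAt (by simp)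
  · refine (contMDiffAt_hom_bundle (E₁ := fun q : Q => TangentSpace 𝓘(ℝ, E) q)
      (E₂ := Bundle.Trivial Q ℝ) _).2 ⟨hbase.contMDiffAt, ?_⟩
    refine (h1.2.clm_comp h2).congr_of_eventuallyEq ?_
    have hU : ∀ᶠ z in 𝓝 z₀, z.2.proj ∈
        (trivializationAt E (fun q : Q => TangentSpace 𝓘(ℝ, E) q) z₀.2.proj).baseSet :=
      hproj.continuous.continuousAt.eventually_mem
        ((trivializationAt E (fun q : Q => TangentSpace 𝓘(ℝ, E) q) z₀.2.proj).open_baseSet.mem_nhds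
          (FiberBundle.mem_baseSet_trivializationAt' _))
    filter_upwards [hU] with z hz
    ext v
    simp only [inTangentCoordinates, ContinuousLinearMap.inCoordinates, cotangentLift,
      ContinuousLinearMap.comp_apply, Bundle.Trivial.fiberBundle_trivializationAt',
      Bundle.Trivial.continuousLinearMapAt_trivialization]
    -- A trivialization cancels its inverse. The base points `g⁻¹ • g • q` and `q` are kept as
    -- separate variables since their equality cannot be rewritten inside the dependent fibres.
    have key : ∀ (q₀ q' : Q) (_ : q₀ = z₀.2.proj) (_ : q' = z.2.proj) (x : E),
        (trivializationAt E (fun q : Q => TangentSpace 𝓘(ℝ, E) q) z₀.2.proj).symmL ℝ z.2.proj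
          ((trivializationAt E (fun q : Q => TangentSpace 𝓘(ℝ, E) q)
            q₀).continuousLinearMapAt ℝ q' x) = x := by
      rintro _ _ rfl rfl x
      exact Bundle.Trivialization.symmL_continuousLinearMapAt _ hz _
    exact congrArg z.2.2 ((DFunLike.congr_fun (inverse_mfderiv_smul (contMDiff_smul_left EG)
      z.1 z.2.proj) _).trans (key _ _ (inv_smul_smul _ _) (inv_smul_smul _ _) _).symm)
  · have h3 : ContMDiff ((𝓘(ℝ, EG).prod (cotModel E)).prod 𝓘(ℝ, E)) 𝓘(ℝ, E) ∞
        (fun y : (G × Cotangent E Q) × Q => y.1.1⁻¹ • y.2) :=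
      (contMDiff_smul (I := 𝓘(ℝ, EG)) (G := G)).comp
        (((contMDiff_inv 𝓘(ℝ, EG) ∞).comp (contMDiff_fst.comp contMDiff_fst)).prodMk contMDiff_snd)
    exact h3.contMDiffAt

end Action
end CotangentBundle

/-! ### Infinitesimal generators and equivariant maps. -/

section Generators
variable {E : Type*} [NormedAddCommGroup E] [NormedSpace ℝ E]
  {H : Type*} [TopologicalSpace H] {I : ModelWithCorners ℝ E H}
  {N : Type*} [TopologicalSpace N] [ChartedSpace H N]
  {E' : Type*} [NormedAddCommGroup E'] [NormedSpace ℝ E']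
  {H' : Type*} [TopologicalSpace H'] {I' : ModelWithCorners ℝ E' H'}
  {N' : Type*} [TopologicalSpace N'] [ChartedSpace H' N']
  {EG : Type*} [NormedAddCommGroup EG] [NormedSpace ℝ EG]
  {G : Type*} [Group G] [TopologicalSpace G] [ChartedSpace EG G]

/-- The orbit map has its derivative over `act 1 x`, the generator lies over `x`. In the total space
they coincide, which makes the chain rule for `tangentMap` applicable. -/
theorem mk_infGen {act : G → N → N} {x : N} (h1 : act 1 x = x)
    (ξ : GroupLieAlgebra 𝓘(ℝ, EG) G) :
    (⟨x, infGen I act x ξ⟩ : TangentBundle I N) =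
      tangentMap 𝓘(ℝ, EG) I (fun g => act g x) ⟨1, ξ⟩ := by
  ext
  · exact h1.symm
  · rfl

/-- Infinitesimal generators are natural under equivariant maps. -/
theorem tangentMap_infGen {act : G → N → N} {act' : G → N' → N'} {f : N → N'} {x : N}
    (h1 : act 1 x = x) (hf : MDifferentiableAt I I' f x)
    (hact : MDifferentiableAt 𝓘(ℝ, EG) I (fun g => act g x) 1)
    (hcomp : ∀ g, f (act g x) = act' g (f x)) (ξ : GroupLieAlgebra 𝓘(ℝ, EG) G) :
    tangentMap I I' f ⟨x, infGen I act x ξ⟩ = ⟨f x, infGen I' act' (f x) ξ⟩ := by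
  have h1' : act' 1 (f x) = f x := by rw [← hcomp, h1]
  rw [mk_infGen h1, mk_infGen h1', ← tangentMap_comp_at (p := ⟨1, ξ⟩) (by rwa [h1]) hact]
  congr 1
  exact funext hcomp

theorem mfderiv_infGen {act : G → N → N} {act' : G → N' → N'} {f : N → N'} {x : N}
    (h1 : act 1 x = x) (hf : MDifferentiableAt I I' f x)
    (hact : MDifferentiableAt 𝓘(ℝ, EG) I (fun g => act g x) 1)
    (hcomp : ∀ g, f (act g x) = act' g (f x)) (ξ : GroupLieAlgebra 𝓘(ℝ, EG) G) :
    mfderiv I I' f x (infGen I act x ξ) = infGen I' act' (f x) ξ :=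
  Bundle.TotalSpace.mk_injective _ (tangentMap_infGen h1 hf hact hcomp ξ)

end Generators

/-! ### Generators on `Q`: smoothness, and injectivity for a free action. -/

section Free

variable {E : Type*} [NormedAddCommGroup E] [NormedSpace ℝ E]
  {Q : Type*} [TopologicalSpace Q] [ChartedSpace E Q] [IsManifold 𝓘(ℝ, E) ∞ Q]
  {EG : Type*} [NormedAddCommGroup EG] [NormedSpace ℝ EG]
  {G : Type*} [Group G] [TopologicalSpace G] [ChartedSpace EG G] [LieGroup 𝓘(ℝ, EG) ∞ G]
  [MulAction G Q] [ContMDiffSMul 𝓘(ℝ, EG) 𝓘(ℝ, E) ∞ G Q]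

/-- The infinitesimal generators of an action on `Q`. -/
abbrev genQ (G : Type*) {EG : Type*} [NormedAddCommGroup EG] [NormedSpace ℝ EG]
    [Group G] [TopologicalSpace G] [ChartedSpace EG G] [MulAction G Q] (q : Q) :
    GroupLieAlgebra 𝓘(ℝ, EG) G →ₗ[ℝ] TangentSpace 𝓘(ℝ, E) q :=
  infGen 𝓘(ℝ, E) (fun (g : G) (x : Q) => g • x) q

theorem contMDiff_orbit (q : Q) : ContMDiff 𝓘(ℝ, EG) 𝓘(ℝ, E) ∞ (fun g : G => g • q) :=
  (contMDiff_smul (I := 𝓘(ℝ, EG)) (G := G)).comp (contMDiff_id.prodMk contMDiff_const)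

/-- `ξ_Q(q)` is the tangent map of the action `G × Q → Q` applied to `(ξ, 0_q)`. -/
theorem contMDiff_genQ (ξ : GroupLieAlgebra 𝓘(ℝ, EG) G) :
    ContMDiff 𝓘(ℝ, E) 𝓘(ℝ, E).tangent ∞
      (fun q : Q => (⟨q, genQ G q ξ⟩ : TangentBundle 𝓘(ℝ, E) Q)) := by
  have : IsManifold 𝓘(ℝ, EG) ∞ G := LieGroup.toContMDiffMul.toIsManifold
  have : IsManifold 𝓘(ℝ, EG) 1 G := .of_le (n := ∞) (by simp)
  have s0 : ContMDiff 𝓘(ℝ, E) 𝓘(ℝ, E).tangent ∞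
      (fun q : Q => (⟨q, 0⟩ : TangentBundle 𝓘(ℝ, E) Q)) := Bundle.contMDiff_zeroSection _ _
  have s1 : ContMDiff 𝓘(ℝ, E) 𝓘(ℝ, EG).tangent ∞
      (fun _ : Q => (⟨1, ξ⟩ : TangentBundle 𝓘(ℝ, EG) G)) := contMDiff_const
  have s2 : ContMDiff (𝓘(ℝ, EG).tangent.prod 𝓘(ℝ, E).tangent) (𝓘(ℝ, EG).prod 𝓘(ℝ, E)).tangent ∞
    (equivTangentBundleProd 𝓘(ℝ, EG) G 𝓘(ℝ, E) Q).symm := contMDiff_equivTangentBundleProd_symm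
  have hs := contMDiff_smul (I := 𝓘(ℝ, EG)) (I' := 𝓘(ℝ, E)) (n := ∞) (G := G) (M := Q)
  have s3 := hs.contMDiff_tangentMap (m := ∞) (by simp)
  refine (s3.comp (s2.comp (s1.prodMk s0))).congr fun q => ?_
  rw [mk_infGen (one_smul G q)]
  have hpair : MDifferentiableAt 𝓘(ℝ, EG) (𝓘(ℝ, EG).prod 𝓘(ℝ, E)) (fun g : G => (g, q)) 1 :=
    (contMDiff_id.prodMk contMDiff_const).mdifferentiable (n := ∞) (by simp) _
  have h := tangentMap_comp_at (p := ⟨1, ξ⟩) (g := fun p : G × Q => p.1 • p.2)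
    (f := fun g : G => (g, q)) (hs.mdifferentiable (by simp) _) hpair
  refine h.trans ?_
  simp only [tangentMap, Function.comp_apply, mfderiv_prod_left]
  rfl

/-- The infinitesimal generators of a free action are injective. -/
theorem genQ_injective [T2Space Q] [FiniteDimensional ℝ EG] [FiniteDimensional ℝ E]
    (hfree : ∀ (g : G) (q : Q), g • q = q → g = 1) (q : Q) :
    Function.Injective (genQ (EG := EG) (E := E) G q) := by
  rw [← LinearMap.ker_eq_bot, LinearMap.ker_eq_bot']
  intro ξ hξ
  have : IsManifold 𝓘(ℝ, EG) ∞ G := LieGroup.toContMDiffMul.toIsManifold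
  have : IsManifold 𝓘(ℝ, EG) 1 G := .of_le (n := ∞) (by simp)
  have : LieGroup 𝓘(ℝ, EG) (minSmoothness ℝ 3) G := .of_le (n := ∞)
    (by simpa using ENat.LEInfty.out)
  -- Let `γ` be an integral curve through `1` of the left-invariant field of `ξ`. If `ξ_Q(q) = 0`,
  -- then `γ(t) • q` is constant, so `γ` is constant by freeness and `ξ = γ'(0) = 0`.
  set X : ∀ g : G, TangentSpace 𝓘(ℝ, EG) g := mulInvariantVectorField ξ with hX
  have hXs : ContMDiff 𝓘(ℝ, EG) 𝓘(ℝ, EG).tangent 1 (fun g => (⟨g, X g⟩ : TangentBundle 𝓘(ℝ, EG) G)) :=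
    (contMDiff_mulInvariantVectorField ξ).of_le (by simp)
  obtain ⟨γ, hγ0, hγ⟩ := exists_isMIntegralCurveAt_of_contMDiffAt_boundaryless
    (t₀ := 0) (hXs.contMDiffAt (x := (1 : G)))
  -- The orbit map turns left translation by `g` into the action of `g`, so it sends `X g` to
  -- `Tg(ξ_Q(q)) = 0`.
  have hzero : ∀ g : G, mfderiv 𝓘(ℝ, EG) 𝓘(ℝ, E) (fun g : G => g • q) g (X g) = 0 := by
    intro g
    have hl : MDifferentiable 𝓘(ℝ, EG) 𝓘(ℝ, EG) (fun h : G => g * h) :=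
      (contMDiff_mul_left (n := ∞)).mdifferentiable (by simp)
    have ho := (contMDiff_orbit (EG := EG) (E := E) (G := G) q).mdifferentiable (by simp)
    have hg := (contMDiff_smul_left EG (E := E) (Q := Q) g).mdifferentiable (by simp)
    have e1 := tangentMap_comp_at (p := ⟨1, ξ⟩) (g := fun h : G => h • q)
      (f := fun h : G => g * h) (ho _) (hl 1)
    have e2 := tangentMap_comp_at (p := ⟨1, ξ⟩) (g := fun x : Q => g • x)
      (f := fun h : G => h • q) (hg _) (ho 1)
    rw [← mk_infGen (one_smul G q)] at e2
    have e3 : (fun h : G => h • q) ∘ (fun h : G => g * h) =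
        (fun x : Q => g • x) ∘ (fun h : G => h • q) := by
      ext h; exact mul_smul g h q
    have e4 : (⟨g, X g⟩ : TangentBundle 𝓘(ℝ, EG) G) =
        tangentMap 𝓘(ℝ, EG) 𝓘(ℝ, EG) (fun h : G => g * h) ⟨1, ξ⟩ := by
      ext
      · exact (mul_one g).symm
      · rfl
    rw [e3, e2, ← e4] at e1
    have e5 : (⟨g • q, 0⟩ : TangentBundle 𝓘(ℝ, E) Q) =
        ⟨g • q, mfderiv 𝓘(ℝ, EG) 𝓘(ℝ, E) (fun g : G => g • q) g (X g)⟩ := by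
      refine Eq.trans ?_ e1
      simp only [tangentMap]
      rw [hξ]
      simp
    exact (Bundle.TotalSpace.mk_injective _ e5).symm
  -- Both `γ(t) • q` and the constant curve `q` are integral curves of the zero field; uniqueness
  -- identifies them near `0`.
  have hcurve : IsMIntegralCurveAt (fun t => γ t • q)
      (fun x : Q => (0 : TangentSpace 𝓘(ℝ, E) x)) 0 := by
    filter_upwards [hγ] with t ht
    have h := ((contMDiff_orbit (EG := EG) (E := E) q).mdifferentiable
      (by simp) (γ t)).hasMFDerivAt.comp t ht
    refine h.congr_mfderiv ?_
    ext
    exact (congrArg _ (one_smul ℝ (X (γ t)))).trans ((hzero (γ t)).trans (smul_zero _).symm)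
  have hconst : IsMIntegralCurveAt (fun _ : ℝ => q)
      (fun x : Q => (0 : TangentSpace 𝓘(ℝ, E) x)) 0 := by
    refine Filter.Eventually.of_forall fun t => ?_
    refine (hasMFDerivAt_const q t).congr_mfderiv ?_
    ext
    exact (smul_zero _).symm
  have heq := isMIntegralCurveAt_eventuallyEq_of_contMDiffAt_boundaryless (t₀ := 0)
    (v := fun x : Q => (0 : TangentSpace 𝓘(ℝ, E) x))
    ((Bundle.contMDiff_zeroSection ℝ (TangentSpace 𝓘(ℝ, E) : Q → Type _)).contMDiffAt)
    hcurve hconst (by simp [hγ0])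
  have hγ1 : γ =ᶠ[𝓝 0] fun _ => 1 := heq.mono fun t ht => hfree _ _ ht
  have h2 := hγ.self_of_nhds.mfderiv
  have h3 : tangentMap 𝓘(ℝ, ℝ) 𝓘(ℝ, EG) γ (vecAt 0 1) =
      tangentMap 𝓘(ℝ, ℝ) 𝓘(ℝ, EG) (fun _ => 1) (vecAt 0 1) := tangentMap_congr hγ1
  rw [tangentMap_vecAt, tangentMap_vecAt, h2, mfderiv_const] at h3
  have h4 : (⟨γ 0, X (γ 0)⟩ : TangentBundle 𝓘(ℝ, EG) G) = ⟨1, 0⟩ := by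
    refine Eq.trans ?_ h3
    ext
    · rfl
    · exact heq_of_eq (one_smul ℝ (X (γ 0))).symm
  have h5 : X 1 = ξ := by
    have : (fun h : G => 1 * h) = id := by ext h; exact one_mul h
    have h6 : tangentMap 𝓘(ℝ, EG) 𝓘(ℝ, EG) (fun h : G => 1 * h) ⟨1, ξ⟩ = ⟨1, ξ⟩ := by
      rw [this, tangentMap_id, id]
    refine Bundle.TotalSpace.mk_injective (1 : G) (Eq.trans ?_ h6)
    ext
    · exact (mul_one _).symm
    · rfl
  rw [hγ0, h5] at h4
  exact Bundle.TotalSpace.mk_injective (1 : G) h4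

end Free

/-! ### Vertical lifts and their pairing with the canonical form. -/

section Vertical
variable {E : Type*} [NormedAddCommGroup E] [NormedSpace ℝ E]
  {Q : Type*} [TopologicalSpace Q] [ChartedSpace E Q] [IsManifold 𝓘(ℝ, E) ∞ Q]

/-- Over the centre of the chart the tangent coordinate change is the identity, so the fibre
coordinate of a covector is the covector itself. -/
theorem extChartAt_cotangent_fibre (p : Cotangent E Q) (a : TangentSpace 𝓘(ℝ, E) p.proj →L[ℝ] ℝ) :
    extChartAt (cotModel E) p ⟨p.proj, a⟩ = (extChartAt 𝓘(ℝ, E) p.proj p.proj, a) := by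
  have h := hom_chart (E₁ := fun q : Q => TangentSpace 𝓘(ℝ, E) q) (E₂ := Bundle.Trivial Q ℝ)
    (𝕜 := ℝ) (F₁ := E) (F₂ := ℝ) (HB := E) p ⟨p.proj, a⟩
  refine Eq.trans (b := chartAt (ModelProd E (E →L[ℝ] ℝ)) p ⟨p.proj, a⟩) rfl (h.trans ?_)
  refine Prod.ext rfl ?_
  ext v
  simp only [ContinuousLinearMap.inCoordinates, ContinuousLinearMap.comp_apply,
    Bundle.Trivial.fiberBundle_trivializationAt', Bundle.Trivial.continuousLinearMapAt_trivialization]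
  have h1 : (trivializationAt E (fun q : Q => TangentSpace 𝓘(ℝ, E) q) p.proj).symmL ℝ p.proj v =
      v := by
    have h2 := TangentBundle.symmL_trivializationAt_eq_core (I := 𝓘(ℝ, E)) (b₀ := p.proj)
      (mem_chart_source E p.proj)
    refine (DFunLike.congr_fun h2 v).trans ?_
    exact (tangentBundleCore 𝓘(ℝ, E) Q).coordChange_self _ _ (mem_chart_source E p.proj) v
  exact congrArg a h1

theorem extChartAt_cotangent_symm_proj (p : Cotangent E Q) {y : E × (E →L[ℝ] ℝ)}
    (hy : y ∈ (extChartAt (cotModel E) p).target) :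
    ((extChartAt (cotModel E) p).symm y).proj = (extChartAt 𝓘(ℝ, E) p.proj).symm y.1 := by
  rw [FiberBundle.extChartAt] at hy ⊢
  simp only [mfld_simps] at hy ⊢
  exact Bundle.Trivialization.proj_symm_apply' _ hy.2

theorem extChartAt_cotangent_symm_fibre (p : Cotangent E Q)
    (a : TangentSpace 𝓘(ℝ, E) p.proj →L[ℝ] ℝ) :
    (extChartAt (cotModel E) p).symm (extChartAt 𝓘(ℝ, E) p.proj p.proj, a) = ⟨p.proj, a⟩ := by
  refine (congrArg (extChartAt (cotModel E) p).symm (extChartAt_cotangent_fibre p a)).symm.trans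
    ((extChartAt (cotModel E) p).left_inv ?_)
  rw [extChartAt_source]
  simp [FiberBundle.chartedSpace_chartAt]

/-- The value of a covector on a tangent vector at the same point. -/
def cotEval (p : Cotangent E Q) (v : TangentBundle 𝓘(ℝ, E) Q) : ℝ :=
  p.2 ((tangentEquiv 𝓘(ℝ, E) p.proj).symm (tangentEquiv 𝓘(ℝ, E) v.proj v.2))

/-- `cotEval` accepts any point of the tangent bundle, so the projected tangent vector may be
replaced by an equal point of `TQ` without matching base points definitionally. -/
theorem oneFormMap_liouville_eq_cotEval (v : TangentBundle (cotModel E) (Cotangent E Q)) :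
    oneFormMap liouville v =
      cotEval v.1 (tangentMap (cotModel E) 𝓘(ℝ, E) (fun x : Cotangent E Q => x.proj) v) := rfl

/-- The vertical lift at `p` of a covector. -/
def vertLift (p : Cotangent E Q) (β : TangentSpace 𝓘(ℝ, E) p.proj →L[ℝ] ℝ) :
    TangentSpace (cotModel E) p :=
  (tangentEquiv (cotModel E) p).symm (0, β)

/-- In the chart at `p` the curve `p + sβ` is affine with velocity `(0, β)`. Vertical lifts thus
come from curves inside one fibre. -/
theorem vertLift_curve (p : Cotangent E Q) (β : TangentSpace 𝓘(ℝ, E) p.proj →L[ℝ] ℝ) :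
    ContMDiffAt 𝓘(ℝ, ℝ) (cotModel E) ∞
      (fun s : ℝ => (⟨p.proj, p.2 + s • β⟩ : Cotangent E Q)) 0 ∧
    tangentMap 𝓘(ℝ, ℝ) (cotModel E) (fun s : ℝ => (⟨p.proj, p.2 + s • β⟩ : Cotangent E Q))
      (vecAt 0 1) = ⟨p, vertLift p β⟩ := by
  obtain ⟨f, hf, h, hfe⟩ := exists_contMDiffAt_tangentMap (I := cotModel E) p
    ((1 : ℝ →L[ℝ] ℝ).smulRight ((0, β) : E × (E →L[ℝ] ℝ)))
  have he : f = fun s : ℝ => (⟨p.proj, p.2 + s • β⟩ : Cotangent E Q) := by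
    funext s
    rw [hfe, ← extChartAt_cotangent_symm_fibre]
    congr 1
    exact (congrArg (· + s • ((0, β) : E × (E →L[ℝ] ℝ))) (extChartAt_cotangent_fibre p p.2)).trans
      (Prod.ext (by show _ + s • (0 : E) = _; simp) rfl)
  rw [← he]
  refine ⟨hf, (h 1).trans ?_⟩
  simp [vertLift]

theorem eventually_proj_extChartAt_symm {P : Type*} [NormedAddCommGroup P] [NormedSpace ℝ P]
    (p : Cotangent E Q) (A : P →L[ℝ] E × (E →L[ℝ] ℝ)) :
    ∀ᶠ z in 𝓝 (0 : P),
      ((extChartAt (cotModel E) p).symm (extChartAt (cotModel E) p p + A z)).proj =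
        (extChartAt 𝓘(ℝ, E) p.proj).symm (extChartAt 𝓘(ℝ, E) p.proj p.proj + (A z).1) := by
  have hc : Filter.Tendsto (fun z : P => extChartAt (cotModel E) p p + A z) (𝓝 0)
      (𝓝 (extChartAt (cotModel E) p p)) :=
    (continuous_const.add A.continuous).tendsto' _ _ (by simp)
  filter_upwards [hc.eventually_mem (extChartAt_target_mem_nhds (I := cotModel E) p)] with z hz
  rw [extChartAt_cotangent_symm_proj p hz]
  congr 2

/-- In the preferred charts at `p` and `p.proj` the projection is the first factor; comparing the
chart lines upstairs and downstairs gives its derivative. -/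
theorem tangentMap_cotangent_proj (p : Cotangent E Q) (X : TangentSpace (cotModel E) p) :
    tangentMap (cotModel E) 𝓘(ℝ, E) (fun x : Cotangent E Q => x.proj) ⟨p, X⟩ =
      ⟨p.proj, (tangentEquiv 𝓘(ℝ, E) p.proj).symm (tangentEquiv (cotModel E) p X).1⟩ := by
  obtain ⟨f, hf, h, hfe⟩ := exists_contMDiffAt_tangentMap (I := cotModel E) p
    ((1 : ℝ →L[ℝ] ℝ).smulRight (tangentEquiv (cotModel E) p X))
  obtain ⟨b, hb, hb', hbe⟩ := exists_contMDiffAt_tangentMap (I := 𝓘(ℝ, E)) p.proj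
    ((1 : ℝ →L[ℝ] ℝ).smulRight (tangentEquiv (cotModel E) p X).1)
  have he : (fun x : Cotangent E Q => x.proj) ∘ f =ᶠ[𝓝 (vecAt (0 : ℝ) (1 : ℝ)).1] b := by
    filter_upwards [eventually_proj_extChartAt_symm p
      ((1 : ℝ →L[ℝ] ℝ).smulRight (tangentEquiv (cotModel E) p X))] with t ht
    simp only [Function.comp_apply, hfe, hbe]
    exact ht
  have h1 := tangentMap_comp_at (vecAt (0 : ℝ) (1 : ℝ))
    (contMDiff_cotangent_proj.mdifferentiable (by simp) _) (hf.mdifferentiableAt (by simp))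
  rw [tangentMap_congr he, h, hb'] at h1
  simpa using h1.symm

variable [FiniteDimensional ℝ E]

theorem cotEval_zero (p : Cotangent E Q) (q : Q) : cotEval p (⟨q, 0⟩ : TangentBundle 𝓘(ℝ, E) Q) = 0 := by
  simp [cotEval]

/-- Take `f(t, s)` affine in the chart with velocities `X` and `β^v`. Its projection to `Q` depends
on `t` only. Hence `Θ(∂_s f)` vanishes along `s = 0`, while `Θ(∂_t f) = (p + sβ)(Tτ X)` along `t =
0`; so `dΘ(X, β^v) = -β(Tτ X)`. -/
theorem canonicalForm_vertLift (p : Cotangent E Q) (X : TangentSpace (cotModel E) p)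
    (β : TangentSpace 𝓘(ℝ, E) p.proj →L[ℝ] ℝ) :
    canonicalForm p X (vertLift p β) =
      β (mfderiv (cotModel E) 𝓘(ℝ, E) (fun x : Cotangent E Q => x.proj) p X) := by
  set A := ((ContinuousLinearMap.fst ℝ ℝ ℝ).smulRight (tangentEquiv (cotModel E) p X) +
      (ContinuousLinearMap.snd ℝ ℝ ℝ).smulRight ((0, β) : E × (E →L[ℝ] ℝ))) with hA
  obtain ⟨f, hf, h, hfe⟩ := exists_contMDiffAt_tangentMap (I := cotModel E) p A
  obtain ⟨b, hb, hb', hbe⟩ := exists_contMDiffAt_tangentMap (I := 𝓘(ℝ, E)) p.proj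
    ((1 : ℝ →L[ℝ] ℝ).smulRight (tangentEquiv (cotModel E) p X).1)
  have hA1 : ∀ z : ℝ × ℝ, (A z).1 = z.1 • (tangentEquiv (cotModel E) p X).1 := by
    intro z
    show z.1 • (tangentEquiv (cotModel E) p X).1 + z.2 • (0 : E) = _
    simp
  have he : (fun x : Cotangent E Q => x.proj) ∘ f =ᶠ[𝓝 0] b ∘ Prod.fst := by
    filter_upwards [eventually_proj_extChartAt_symm p A] with z hz
    simp only [Function.comp_apply, hfe, hbe]
    rw [hz, hA1]
    rfl
  have hfm : ∀ᶠ z in 𝓝 (0 : ℝ × ℝ), MDifferentiableAt 𝓘(ℝ, ℝ × ℝ) (cotModel E) f z := by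
    filter_upwards [(contMDiffAt_iff_contMDiffAt_nhds (by decide)).1
      (hf.of_le (m := 1) ENat.LEInfty.out)] with z hz using hz.mdifferentiableAt (by simp)
  have hbm : ∀ᶠ t in 𝓝 (0 : ℝ), MDifferentiableAt 𝓘(ℝ, ℝ) 𝓘(ℝ, E) b t := by
    filter_upwards [(contMDiffAt_iff_contMDiffAt_nhds (by decide)).1
      (hb.of_le (m := 1) ENat.LEInfty.out)] with z hz using hz.mdifferentiableAt (by simp)
  have hbm' : ∀ᶠ z in 𝓝 (0 : ℝ × ℝ), MDifferentiableAt 𝓘(ℝ, ℝ) 𝓘(ℝ, E) b z.1 :=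
    (continuous_fst.tendsto' (0 : ℝ × ℝ) 0 rfl).eventually hbm
  have hproj : ∀ᶠ z in 𝓝 (0 : ℝ × ℝ), ∀ v : ℝ × ℝ,
      oneFormMap liouville (tangentMap 𝓘(ℝ, ℝ × ℝ) (cotModel E) f (vecAt z v)) =
        cotEval (f z) (tangentMap 𝓘(ℝ, ℝ) 𝓘(ℝ, E) b (vecAt z.1 v.1)) := by
    filter_upwards [he.eventually_nhds, hfm, hbm'] with z hz hzf hzb v
    rw [oneFormMap_liouville_eq_cotEval]
    have h1 := tangentMap_comp_at (vecAt z v)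
      (contMDiff_cotangent_proj.mdifferentiable (by simp) _) hzf
    have h2 := tangentMap_comp_at (I' := 𝓘(ℝ, ℝ)) (vecAt z v) (f := Prod.fst) hzb
      (differentiableAt_fst.mdifferentiableAt)
    have h3 : tangentMap 𝓘(ℝ, ℝ × ℝ) 𝓘(ℝ, ℝ) Prod.fst (vecAt z v) = vecAt z.1 v.1 := by
      rw [tangentMap_vecAt, mfderiv_eq_fderiv, fderiv_fst]
      rfl
    rw [← h1, tangentMap_congr (v := vecAt z v) hz, h2, h3]
    rfl
  have hX : tangentMap 𝓘(ℝ, ℝ × ℝ) (cotModel E) f (vecAt 0 (1, 0)) = ⟨p, X⟩ := by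
    rw [h]; simp [hA]
  have hY : tangentMap 𝓘(ℝ, ℝ × ℝ) (cotModel E) f (vecAt 0 (0, 1)) = ⟨p, vertLift p β⟩ := by
    rw [h]; simp [hA, vertLift]
  have t1 : Filter.Tendsto (fun t : ℝ => ((t, 0) : ℝ × ℝ)) (𝓝 0) (𝓝 0) :=
    (Continuous.prodMk continuous_id continuous_const).tendsto' _ _ rfl
  have t2 : Filter.Tendsto (fun t : ℝ => ((0, t) : ℝ × ℝ)) (𝓝 0) (𝓝 0) :=
    (Continuous.prodMk continuous_const continuous_id).tendsto' _ _ rfl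
  have hd := extDerivOne_eq_deriv_sub_deriv liouville contMDiff_liouville hf hX hY
  have hd1 : (fun t : ℝ => oneFormMap liouville
      (tangentMap 𝓘(ℝ, ℝ × ℝ) (cotModel E) f (vecAt (t, 0) (0, 1)))) =ᶠ[𝓝 0] fun _ => 0 := by
    filter_upwards [t1.eventually hproj] with t ht
    rw [ht, tangentMap_vecAt]
    have : mfderiv 𝓘(ℝ, ℝ) 𝓘(ℝ, E) b t (0 : ℝ) = 0 := map_zero _
    exact (congrArg (fun v => cotEval _ ⟨b t, v⟩) this).trans (cotEval_zero _ _)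
  have hzero : ∀ (x y c : E →L[ℝ] ℝ), y + ((0 : ℝ) • x + c) = y + c := fun x y c => by simp
  have hf0 : ∀ s : ℝ, f (0, s) = ⟨p.proj, p.2 + s • β⟩ := by
    intro s
    rw [hfe, ← extChartAt_cotangent_symm_fibre]
    congr 1
    refine (congrArg (· + A (0, s)) (extChartAt_cotangent_fibre p p.2)).trans ?_
    refine Prod.ext ?_ ?_
    · show _ + (A (0, s)).1 = _
      rw [hA1]; simp
    · exact hzero _ _ _
  have hV : tangentMap 𝓘(ℝ, ℝ) 𝓘(ℝ, E) b (vecAt 0 1) = ⟨p.proj,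
      mfderiv (cotModel E) 𝓘(ℝ, E) (fun x : Cotangent E Q => x.proj) p X⟩ := by
    rw [hb']
    refine Eq.trans ?_ (tangentMap_cotangent_proj p X).symm
    simp
  have hd2 : (fun s : ℝ => oneFormMap liouville
      (tangentMap 𝓘(ℝ, ℝ × ℝ) (cotModel E) f (vecAt (0, s) (1, 0)))) =ᶠ[𝓝 0] fun s =>
        p.2 (mfderiv (cotModel E) 𝓘(ℝ, E) (fun x : Cotangent E Q => x.proj) p X) +
        s * β (mfderiv (cotModel E) 𝓘(ℝ, E) (fun x : Cotangent E Q => x.proj) p X) := by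
    filter_upwards [t2.eventually hproj] with t ht
    rw [ht, hV, hf0]
    rfl
  have hd3 : ∀ a c : ℝ, deriv (fun s : ℝ => a + s * c) 0 = c := by
    intro a c
    simp
  rw [hd1.deriv_eq, hd2.deriv_eq, hd3, deriv_const, zero_sub] at hd
  exact (congrArg (fun r : ℝ => -r) hd).trans (neg_neg _)

end Vertical

/-! ### Smooth coefficients with respect to local frames. -/

section Frames

/-- The linear map `ℝ^ι → E` defined by a family of vectors. -/
def familyMap {E : Type*} [NormedAddCommGroup E] [NormedSpace ℝ E] {ι : Type*} [Fintype ι]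
    (c : ι → E) : (ι → ℝ) →L[ℝ] E :=
  ∑ i, (ContinuousLinearMap.proj (R := ℝ) (φ := fun _ : ι => ℝ) i).smulRight (c i)

theorem familyMap_apply {E : Type*} [NormedAddCommGroup E] [NormedSpace ℝ E] {ι : Type*} [Fintype ι]
    (c : ι → E) (a : ι → ℝ) : familyMap c a = ∑ i, a i • c i := by
  simp [familyMap]

theorem contDiff_familyMap {E : Type*} [NormedAddCommGroup E] [NormedSpace ℝ E] {ι : Type*}
    [Fintype ι] : ContDiff ℝ ∞ (familyMap (E := E) (ι := ι)) := by
  unfold familyMap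
  fun_prop

variable {EM : Type*} [NormedAddCommGroup EM] [NormedSpace ℝ EM]
  {HM : Type*} [TopologicalSpace HM] {J : ModelWithCorners ℝ EM HM}
  {M : Type*} [TopologicalSpace M] [ChartedSpace HM M]

/-- A smooth family of linear maps which is injective at a point has a smooth family of left
inverses near this point. -/
theorem exists_contMDiffAt_leftInverse {V E : Type*} [NormedAddCommGroup V] [NormedSpace ℝ V]
    [FiniteDimensional ℝ V] [NormedAddCommGroup E] [NormedSpace ℝ E] [FiniteDimensional ℝ E]
    {L : M → V →L[ℝ] E} {x₀ : M} (hL : ContMDiffAt J 𝓘(ℝ, V →L[ℝ] E) ∞ L x₀)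
    (hinj : Function.Injective (L x₀)) :
    ∃ l : M → E →L[ℝ] V, ContMDiffAt J 𝓘(ℝ, E →L[ℝ] V) ∞ l x₀ ∧
      ∀ᶠ x in 𝓝 x₀, ∀ v, l x (L x v) = v := by
  have : CompleteSpace V := FiniteDimensional.complete ℝ V
  obtain ⟨l₀, hl₀⟩ := (L x₀).toLinearMap.exists_leftInverse_of_injective
    (LinearMap.ker_eq_bot.2 hinj)
  set l₁ : E →L[ℝ] V := LinearMap.toContinuousLinearMap l₀ with hl₁
  -- With `l₁` a left inverse of `L x₀`, the endomorphism `l₁ ∘ L x` is the identity at `x₀`, hence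
  -- invertible nearby with smooth inverse; `(l₁ ∘ L x)⁻¹ ∘ l₁` is the desired family.
  have hB : ContMDiffAt J 𝓘(ℝ, V →L[ℝ] V) ∞ (fun x => l₁.comp (L x)) x₀ :=
    contMDiffAt_const.clm_comp hL
  have hB0 : l₁.comp (L x₀) = (ContinuousLinearEquiv.refl ℝ V : V →L[ℝ] V) := by
    ext v
    exact LinearMap.congr_fun hl₀ v
  have hinv : ContDiffAt ℝ ∞ ContinuousLinearMap.inverse (l₁.comp (L x₀)) := by
    rw [hB0]; exact contDiffAt_map_inverse _
  refine ⟨fun x => (l₁.comp (L x)).inverse.comp l₁,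
    (hinv.comp_contMDiffAt (f := fun x => l₁.comp (L x)) hB).clm_comp contMDiffAt_const, ?_⟩
  have hev := hB.continuousAt.eventually_mem (hB0 ▸ ContinuousLinearEquiv.nhds
    (ContinuousLinearEquiv.refl ℝ V))
  filter_upwards [hev] with x hx v
  obtain ⟨u, hu⟩ := hx
  have h1 : (l₁.comp (L x)).inverse ((l₁.comp (L x)) v) = v := by
    rw [← hu]; simp
  exact h1

variable {E : Type*} [NormedAddCommGroup E] [NormedSpace ℝ E] [FiniteDimensional ℝ E]
  {Q : Type*} [TopologicalSpace Q] [ChartedSpace E Q] [IsManifold 𝓘(ℝ, E) ∞ Q]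

/-- The coefficients with respect to linearly independent vector fields extend to smooth functions
on the tangent bundle. -/
theorem exists_contMDiffAt_coeff {ι : Type*} [Fintype ι] {q₀ : Q}
    {X : ι → ∀ q : Q, TangentSpace 𝓘(ℝ, E) q}
    (hX : ∀ i, ContMDiffAt 𝓘(ℝ, E) 𝓘(ℝ, E).tangent ∞
      (fun q => (⟨q, X i q⟩ : TangentBundle 𝓘(ℝ, E) Q)) q₀)
    (hli : LinearIndependent ℝ (fun i => X i q₀)) :
    ∃ c : TangentBundle 𝓘(ℝ, E) Q → ι → ℝ,
      (∀ v, v.proj = q₀ → ContMDiffAt 𝓘(ℝ, E).tangent 𝓘(ℝ, ι → ℝ) ∞ c v) ∧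
      ∀ᶠ q in 𝓝 q₀, ∀ a : ι → ℝ, c ⟨q, ∑ i, a i • X i q⟩ = a := by
  set e := trivializationAt E (TangentSpace 𝓘(ℝ, E) : Q → Type _) q₀ with he
  have hq₀ : q₀ ∈ e.baseSet := FiberBundle.mem_baseSet_trivializationAt' q₀
  have hlin : ∀ q ∈ e.baseSet, ∀ a : ι → ℝ, (e ⟨q, ∑ i, a i • X i q⟩).2 =
      familyMap (fun i => (e ⟨q, X i q⟩).2) a := by
    intro q hq a
    have h1 : ∀ v : TangentSpace 𝓘(ℝ, E) q, (e ⟨q, v⟩).2 = e.linearMapAt ℝ q v := fun v => by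
      rw [Bundle.Trivialization.coe_linearMapAt_of_mem e hq]
    simp only [h1, familyMap_apply, map_sum, map_smul]
  have hc : ContMDiffAt 𝓘(ℝ, E) 𝓘(ℝ, ι → E) ∞ (fun q i => (e ⟨q, X i q⟩).2) q₀ :=
    contMDiffAt_pi_space.2 fun i => (Bundle.contMDiffAt_totalSpace.1 (hX i)).2
  have hL : ContMDiffAt 𝓘(ℝ, E) 𝓘(ℝ, (ι → ℝ) →L[ℝ] E) ∞
      (fun q => familyMap fun i => (e ⟨q, X i q⟩).2) q₀ :=
    (contDiff_familyMap (E := E) (ι := ι)).contDiffAt.comp_contMDiffAt hc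
  have hinj : Function.Injective (familyMap fun i => (e ⟨q₀, X i q₀⟩).2) := by
    intro a a' haa
    rw [← hlin q₀ hq₀, ← hlin q₀ hq₀] at haa
    have h2 : (∑ i, a i • X i q₀) = ∑ i, a' i • X i q₀ := by
      have h3 : e ⟨q₀, ∑ i, a i • X i q₀⟩ = e ⟨q₀, ∑ i, a' i • X i q₀⟩ :=
        Prod.ext ((e.coe_fst' hq₀).trans (e.coe_fst' hq₀).symm) haa
      exact Bundle.TotalSpace.mk_injective q₀
        (e.injOn (e.mem_source.2 hq₀) (e.mem_source.2 hq₀) h3)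
    have h4 := Fintype.linearIndependent_iff.1 hli (fun i => a i - a' i)
      (by simp only [sub_smul, Finset.sum_sub_distrib, h2, sub_self])
    exact funext fun i => sub_eq_zero.1 (h4 i)
  obtain ⟨l, hl, hlev⟩ := exists_contMDiffAt_leftInverse hL hinj
  refine ⟨fun v => l v.proj (e v).2, fun v hv => ?_, ?_⟩
  · subst hv
    have hp : ContMDiffAt 𝓘(ℝ, E).tangent 𝓘(ℝ, E) ∞
      (fun v : TangentBundle 𝓘(ℝ, E) Q => v.proj) v := (Bundle.contMDiff_proj _).contMDiffAt
    have h2 : ContMDiffAt 𝓘(ℝ, E).tangent 𝓘(ℝ, E) ∞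
      (fun v : TangentBundle 𝓘(ℝ, E) Q => (e v).2) v :=
      (Bundle.contMDiffAt_totalSpace.1 (contMDiffAt_id (x := v))).2
    exact (hl.comp v hp).clm_apply h2
  · filter_upwards [hlev, e.open_baseSet.mem_nhds hq₀] with q hq hqe a
    show l q (e ⟨q, ∑ i, a i • X i q⟩).2 = a
    rw [hlin q hqe]
    exact hq a

end Frames

/-! ### Projections of a direct sum. -/

section Projections

variable {T : Type*} [AddCommGroup T] [Module ℝ T] {p q : Submodule ℝ T}

theorem projOnto_add (h : IsCompl p q) {x y : T} (hx : x ∈ p) (hy : y ∈ q) :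
    projOnto p q (x + y) = ⟨x, hx⟩ := by
  rw [projOnto, dif_pos h, map_add, Submodule.projectionOnto_apply_of_mem_left h hx,
    (Submodule.projectionOnto_apply_eq_zero_iff h).2 hy, add_zero]

theorem projOnto_of_mem_left (h : IsCompl p q) {x : T} (hx : x ∈ p) :
    projOnto p q x = ⟨x, hx⟩ := by
  simpa using projOnto_add h hx (zero_mem q)

theorem projOnto_of_mem_right (h : IsCompl p q) {y : T} (hy : y ∈ q) : projOnto p q y = 0 := by
  rw [← zero_add y, projOnto_add h (zero_mem p) hy]; rfl

theorem exists_add_of_isCompl (h : IsCompl p q) (v : T) : ∃ x ∈ p, ∃ y ∈ q, x + y = v :=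
  Submodule.mem_sup.1 (h.sup_eq_top ▸ Submodule.mem_top)

/-- The value of `L⁻¹ ∘ P_q` on `x + L ξ` with `x ∈ p` and `L ξ ∈ q`. -/
theorem leftInverse_projOnto {V : Type*} [AddCommGroup V] [Module ℝ V] {L : V →ₗ[ℝ] T}
    (hL : Function.Injective L) (h : IsCompl p q) {x : T} (hx : x ∈ p) {ξ : V} (hξ : L ξ ∈ q) :
    L.leftInverse (projOnto q p (x + L ξ) : T) = ξ := by
  rw [add_comm, projOnto_add h.symm hξ hx]
  exact LinearMap.leftInverse_apply_of_inj (LinearMap.ker_eq_bot.2 hL) ξ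

end Projections

/-! ### The `𝔤`-valued connection form on `Q` and its smoothness. -/

section Connection

variable {E : Type*} [NormedAddCommGroup E] [NormedSpace ℝ E] [FiniteDimensional ℝ E]
  {Q : Type*} [TopologicalSpace Q] [ChartedSpace E Q] [IsManifold 𝓘(ℝ, E) ∞ Q]
  {EG : Type*} [NormedAddCommGroup EG] [NormedSpace ℝ EG] [FiniteDimensional ℝ EG]
  {G : Type*} [Group G] [TopologicalSpace G] [ChartedSpace EG G] [LieGroup 𝓘(ℝ, EG) ∞ G]
  [MulAction G Q] [ContMDiffSMul 𝓘(ℝ, EG) 𝓘(ℝ, E) ∞ G Q]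
  {D W : ∀ q : Q, Submodule ℝ (TangentSpace 𝓘(ℝ, E) q)}

variable (EG G D W) in
/-- The `𝔤`-valued one-form on `Q` which vanishes on `D` and maps `ξ_Q(q) ∈ W` to `ξ`. -/
def connQ (q : Q) : TangentSpace 𝓘(ℝ, E) q →ₗ[ℝ] EG :=
  (tangentEquiv 𝓘(ℝ, EG) (1 : G)).toLinearMap ∘ₗ (genQ (EG := EG) G q).leftInverse ∘ₗ
    (W q).subtype ∘ₗ projOnto (W q) (D q)

theorem connQ_add [T2Space Q] (hfree : ∀ (g : G) (q : Q), g • q = q → g = 1)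
    {q : Q} (hDW : IsCompl (D q) (W q)) {x : TangentSpace 𝓘(ℝ, E) q} (hx : x ∈ D q)
    {ξ : GroupLieAlgebra 𝓘(ℝ, EG) G} (hξ : genQ G q ξ ∈ W q) :
    connQ EG G D W q (x + genQ G q ξ) = tangentEquiv 𝓘(ℝ, EG) (1 : G) ξ :=
  congrArg (tangentEquiv 𝓘(ℝ, EG) (1 : G))
    (leftInverse_projOnto (genQ_injective hfree q) hDW hx hξ)

theorem connQ_of_mem (hDW : ∀ q, IsCompl (D q) (W q)) {q : Q}
    {x : TangentSpace 𝓘(ℝ, E) q} (hx : x ∈ D q) : connQ EG G D W q x = 0 := by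
  show tangentEquiv 𝓘(ℝ, EG) (1 : G) ((genQ (EG := EG) G q).leftInverse
    (projOnto (W q) (D q) x : TangentSpace 𝓘(ℝ, E) q)) = 0
  rw [projOnto_of_mem_right (hDW q).symm hx]
  simp

theorem exists_frame (hD : IsRegularDistribution D) (q₀ : Q) :
    ∃ (k : ℕ) (X : Fin k → ∀ q : Q, TangentSpace 𝓘(ℝ, E) q),
      (∀ i, ContMDiffAt 𝓘(ℝ, E) 𝓘(ℝ, E).tangent ∞
        (fun q => (⟨q, X i q⟩ : TangentBundle 𝓘(ℝ, E) Q)) q₀) ∧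
      ∀ᶠ q in 𝓝 q₀, LinearIndependent ℝ (fun i => X i q) ∧
        Submodule.span ℝ (Set.range fun i => X i q) = D q := by
  obtain ⟨k, X, U, hU, hX, h⟩ := hD q₀
  exact ⟨k, X, fun i => (hX i).contMDiffAt hU, Filter.mem_of_superset hU h⟩

/-- Two complementary distributions have a common local frame. -/
theorem exists_frame_isCompl (hD : IsRegularDistribution D) (hW : IsRegularDistribution W)
    (hDW : ∀ q, IsCompl (D q) (W q)) (q₀ : Q) :
    ∃ (a b : ℕ) (X : Fin a ⊕ Fin b → ∀ q : Q, TangentSpace 𝓘(ℝ, E) q),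
      (∀ i, ContMDiffAt 𝓘(ℝ, E) 𝓘(ℝ, E).tangent ∞
        (fun q => (⟨q, X i q⟩ : TangentBundle 𝓘(ℝ, E) Q)) q₀) ∧
      ∀ᶠ q in 𝓝 q₀, LinearIndependent ℝ (fun i => X i q) ∧
        Submodule.span ℝ (Set.range fun i => X (.inl i) q) = D q ∧
        Submodule.span ℝ (Set.range fun i => X (.inr i) q) = W q := by
  obtain ⟨a, d, hd, hd'⟩ := exists_frame hD q₀
  obtain ⟨b, w, hw, hw'⟩ := exists_frame hW q₀
  refine ⟨a, b, Sum.elim d w, ?_, ?_⟩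
  · rintro (i | i)
    exacts [hd i, hw i]
  · filter_upwards [hd', hw'] with q hq hq'
    refine ⟨?_, hq.2, hq'.2⟩
    have h := hq.1.sum_type hq'.1 (by rw [hq.2, hq'.2]; exact (hDW q).disjoint)
    have he : (fun i : Fin a ⊕ Fin b => Sum.elim d w i q) =
        Sum.elim (fun i => d i q) (fun i => w i q) := by
      funext i; rcases i with i | i <;> rfl
    rwa [he]

/-- Choose a local frame `X` adapted to `D ⊕ W` and a basis `B k` of `𝔤`. By freeness the fields `(B
k)_Q` are independent, and each frame field of `W` is a combination of them with smooth coefficients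
`c'`. If `c u` are the coefficients of `u` in the frame, then `A(u)` is the sum of `c u (inr j) * c'
k • B k` over `j` and `k`, with `c'` taken at the `j`-th frame field of `W`. -/
theorem contMDiff_connQ [T2Space Q] (hfree : ∀ (g : G) (q : Q), g • q = q → g = 1)
    (hD : IsRegularDistribution D) (hW : IsRegularDistribution W)
    (hDW : ∀ q, IsCompl (D q) (W q))
    (hWV : ∀ q : Q, W q ≤ LinearMap.range (genQ (EG := EG) G q)) :
    ContMDiff 𝓘(ℝ, E).tangent 𝓘(ℝ, EG) ∞ (oneFormMap (connQ EG G D W)) := by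
  intro v
  obtain ⟨a, b, X, hX, hXev⟩ := exists_frame_isCompl hD hW hDW v.proj
  obtain ⟨c, hc, hcev⟩ := exists_contMDiffAt_coeff (q₀ := v.proj) (X := X) hX hXev.self_of_nhds.1
  have : FiniteDimensional ℝ (GroupLieAlgebra 𝓘(ℝ, EG) G) := inferInstanceAs (FiniteDimensional ℝ EG)
  set B := Module.finBasis ℝ (GroupLieAlgebra 𝓘(ℝ, EG) G) with hB
  have hli : LinearIndependent ℝ (fun k => genQ (EG := EG) G v.proj (B k)) :=
    B.linearIndependent.map' _ (LinearMap.ker_eq_bot.2 (genQ_injective (EG := EG) (E := E) hfree v.proj))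
  obtain ⟨c', hc', hcev'⟩ := exists_contMDiffAt_coeff (q₀ := v.proj)
    (X := fun k q => genQ (EG := EG) G q (B k)) (fun k => (contMDiff_genQ (B k)).contMDiffAt) hli
  have hp : ContMDiffAt 𝓘(ℝ, E).tangent 𝓘(ℝ, E) ∞
    (fun v : TangentBundle 𝓘(ℝ, E) Q => v.proj) v := (Bundle.contMDiff_proj _).contMDiffAt
  have hs : ContMDiffAt 𝓘(ℝ, E).tangent 𝓘(ℝ, EG) ∞ (fun u : TangentBundle 𝓘(ℝ, E) Q =>
      ∑ j : Fin b, c u (.inr j) • familyMap (fun k => tangentEquiv 𝓘(ℝ, EG) (1 : G) (B k))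
        (c' ⟨u.proj, X (.inr j) u.proj⟩)) v := by
    refine ContMDiffAt.sum fun j _ => ?_
    refine contDiff_smul.contDiffAt.comp_contMDiffAt (f := fun u : TangentBundle 𝓘(ℝ, E) Q =>
      (c u (.inr j), familyMap (fun k => tangentEquiv 𝓘(ℝ, EG) (1 : G) (B k))
        (c' ⟨u.proj, X (.inr j) u.proj⟩))) (ContMDiffAt.prodMk_space ?_ ?_)
    · exact contMDiffAt_pi_space.1 (hc v rfl) _
    · refine (familyMap (fun k => tangentEquiv 𝓘(ℝ, EG) (1 : G) (B k))).contDiff.contDiffAt.comp_contMDiffAt ?_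
      have h1 := (hc' ⟨v.proj, X (.inr j) v.proj⟩ rfl).comp v.proj (hX (.inr j))
      exact h1.comp v hp
  refine hs.congr_of_eventuallyEq ?_
  have hev := hp.continuousAt.eventually (hXev.and (hcev.and hcev'))
  filter_upwards [hev] with u hu
  obtain ⟨⟨hu1, huD, huW⟩, hu2, hu3⟩ := hu
  obtain ⟨x, hx, y, hy, hxy⟩ := exists_add_of_isCompl (hDW u.proj) u.2
  rw [← huD, Submodule.mem_span_range_iff_exists_fun] at hx
  rw [← huW, Submodule.mem_span_range_iff_exists_fun] at hy
  obtain ⟨α, hα⟩ := hx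
  obtain ⟨β, hβ⟩ := hy
  have hcu : c u = Sum.elim α β := by
    rw [← hu2 (Sum.elim α β)]
    congr 1
    ext
    · rfl
    · simp [Fintype.sum_sum_type, hα, hβ, hxy]
  -- Verticality writes the frame field as `ξ_Q`; the coefficients `c'` recover the coordinates of
  -- `ξ`.
  have hgen : ∀ j, genQ (EG := EG) G u.proj (∑ k, c' ⟨u.proj, X (.inr j) u.proj⟩ k • B k) =
      X (.inr j) u.proj := by
    intro j
    obtain ⟨ξ, hξ⟩ := hWV u.proj (huW ▸ Submodule.subset_span ⟨j, rfl⟩ :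
      X (.inr j) u.proj ∈ W u.proj)
    have h4 := hu3 (B.repr ξ)
    have h5 : ∑ k, B.repr ξ k • genQ (EG := EG) G u.proj (B k) = X (.inr j) u.proj := by
      rw [← hξ]
      conv_rhs => rw [← B.sum_repr ξ, map_sum]
      simp only [map_smul]
    rw [h5] at h4
    rw [h4, B.sum_repr, hξ]
  set ζ := ∑ j, β j • ∑ k, c' ⟨u.proj, X (.inr j) u.proj⟩ k • B k with hζ
  have hζy : genQ (EG := EG) G u.proj ζ = y := by
    rw [hζ, map_sum, ← hβ]
    simp only [map_smul (genQ (EG := EG) G u.proj), hgen]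
  have hu' : oneFormMap (connQ EG G D W) u = tangentEquiv 𝓘(ℝ, EG) (1 : G) ζ := by
    show connQ EG G D W u.proj u.2 = _
    rw [← hxy, ← hζy]
    refine connQ_add hfree (hDW _) ?_ ?_
    · rw [← hα, ← huD]
      exact Submodule.mem_span_range_iff_exists_fun ℝ |>.2 ⟨α, rfl⟩
    · rw [hζy, ← hβ, ← huW]
      exact Submodule.mem_span_range_iff_exists_fun ℝ |>.2 ⟨β, rfl⟩
  rw [hu', hζ, hcu]
  simp only [map_sum, map_smul, familyMap_apply, Sum.elim_inr]

end Connection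

/-! ### Linear algebra of the bivector and its gauge transformation. -/

section Gauge

variable {T : Type*} [AddCommGroup T] [Module ℝ T] [FiniteDimensional ℝ T]
  {F : Submodule ℝ T} {Ω B : LinearMap.BilinForm ℝ T}

theorem nondegenerate_restrict (h : ∀ X ∈ F, (∀ Y ∈ F, Ω X Y = 0) → X = 0) :
    (Ω.restrict F).Nondegenerate := by
  refine (LinearMap.BilinForm.nondegenerate_iff_ker_eq_bot).2 ?_
  rw [LinearMap.ker_eq_bot']
  intro X hX
  exact Subtype.ext (h X X.2 fun Y hY => LinearMap.congr_fun hX ⟨Y, hY⟩)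

/-- `π♯ α = -X` iff `X ∈ F` and `Ω(X, ·) = α` on `F`. -/
theorem bivectorSharp_eq_neg_iff (h : (Ω.restrict F).Nondegenerate) {α : Module.Dual ℝ T} {X : T} :
    bivectorSharp F Ω α = -X ↔ X ∈ F ∧ ∀ Y ∈ F, Ω X Y = α Y := by
  have e : bivectorSharp F Ω α = -(((Ω.restrict F).toDual h).symm (F.subtype.dualMap α) : T) := by
    rw [bivectorSharp, dif_pos h]; rfl
  rw [e, neg_inj]
  constructor
  · rintro rfl
    refine ⟨Subtype.prop _, fun Y hY => ?_⟩
    have := LinearMap.BilinForm.apply_toDual_symm_apply (hB := h) (F.subtype.dualMap α) ⟨Y, hY⟩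
    exact this
  · rintro ⟨hX, hY⟩
    have : ((Ω.restrict F).toDual h).symm (F.subtype.dualMap α) = ⟨X, hX⟩ := by
      rw [LinearEquiv.symm_apply_eq]
      ext Y
      exact (hY Y Y.2).symm
    rw [this]

theorem gaugeEndo_apply (π : Module.Dual ℝ T →ₗ[ℝ] T) (α : Module.Dual ℝ T) :
    gaugeEndo π B α = α + B (π α) := rfl

/-- The gauge endomorphism is invertible if the two-form `Ω - B` is nondegenerate on `F` in the
sense that its left kernel is contained in the left kernel of `B`. -/
theorem isUnit_gaugeEndo (h : (Ω.restrict F).Nondegenerate)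
    (hB : ∀ X ∈ F, (∀ Y ∈ F, Ω X Y = B X Y) → B X = 0) :
    IsUnit (gaugeEndo (bivectorSharp F Ω) B) := by
  rw [LinearMap.isUnit_iff_ker_eq_bot, LinearMap.ker_eq_bot']
  intro α hα
  rw [gaugeEndo_apply] at hα
  -- If `π♯ α = -X`, then `α + B(π♯ α) = 0` says `α = B X`; so `Ω(X, ·) = B(X, ·)` on `F`, and the
  -- hypothesis gives `B X = 0`.
  obtain ⟨X, hX⟩ : ∃ X, bivectorSharp F Ω α = -X := ⟨_, (neg_neg _).symm⟩
  rw [hX, map_neg, ← sub_eq_add_neg, sub_eq_zero] at hα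
  obtain ⟨hXF, hXY⟩ := (bivectorSharp_eq_neg_iff h).1 hX
  rw [hα]
  exact hB X hXF fun Y hY => by rw [hXY Y hY, hα]

/-- Gauging by `B` replaces `Ω` by `Ω - B` on `F`. Indeed `π♯(α + B X) = -X`, hence `(Id + B♭π♯)(α +
B X) = α`, which identifies the inverse at `α`. -/
theorem gaugeTransform_bivectorSharp (h : (Ω.restrict F).Nondegenerate)
    (hu : IsUnit (gaugeEndo (bivectorSharp F Ω) B)) {α : Module.Dual ℝ T} {X : T} (hX : X ∈ F)
    (hXY : ∀ Y ∈ F, Ω X Y - B X Y = α Y) :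
    gaugeTransform (bivectorSharp F Ω) B α = -X := by
  have h1 : bivectorSharp F Ω (α + B X) = -X :=
    (bivectorSharp_eq_neg_iff h).2 ⟨hX, fun Y hY => by
      rw [LinearMap.add_apply, ← hXY Y hY, sub_add_cancel]⟩
  have h2 : gaugeEndo (bivectorSharp F Ω) B (α + B X) = α := by
    rw [gaugeEndo_apply, h1, map_neg, add_neg_cancel_right]
  have h3 : Ring.inverse (gaugeEndo (bivectorSharp F Ω) B) α = α + B X := by
    conv_lhs => rw [← h2]
    exact LinearMap.congr_fun (Ring.inverse_mul_cancel _ hu) _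
  rw [gaugeTransform, LinearMap.comp_apply, h3, h1]

end Gauge

/-! ### Local left inverses of immersions. -/

section Immersions

variable {E₁ : Type*} [NormedAddCommGroup E₁] [NormedSpace ℝ E₁]
  {E₂ : Type*} [NormedAddCommGroup E₂] [NormedSpace ℝ E₂]
  {H₂ : Type*} [TopologicalSpace H₂] {J : ModelWithCorners ℝ E₂ H₂}
  {M : Type*} [TopologicalSpace M] [ChartedSpace E₁ M] [IsManifold 𝓘(ℝ, E₁) ∞ M]
  {N : Type*} [TopologicalSpace N] [ChartedSpace H₂ N] [IsManifold J ∞ N]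

/-- An immersion has local smooth left inverses. -/
theorem exists_leftInverse_of_isImmersionAt {f : M → N} {x : M}
    (hf : Manifold.IsImmersionAt 𝓘(ℝ, E₁) J ∞ f x) :
    ∃ l : N → M, ContMDiffAt J 𝓘(ℝ, E₁) ∞ l (f x) ∧ l ∘ f =ᶠ[𝓝 x] id := by
  set φ := hf.domChart.extend 𝓘(ℝ, E₁) with hφ
  set ψ := hf.codChart.extend J with hψ
  have hsrc : φ.source = hf.domChart.source := by simp [hφ]
  -- In the immersion charts `f` is `z ↦ (z, 0)` up to a linear equivalence, so the first component
  -- recovers `z`.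
  have key : ∀ z ∈ φ.source, (hf.equiv.symm (ψ (f z))).1 = φ z := by
    intro z hz
    have h := hf.writtenInCharts (φ.map_source hz)
    simp only [Function.comp_apply] at h
    rw [← hφ, φ.left_inv hz, ← hψ] at h
    rw [h]; simp
  have hx : x ∈ φ.source := hsrc ▸ hf.mem_domChart_source
  refine ⟨fun y => φ.symm (hf.equiv.symm (ψ y)).1, ?_, ?_⟩
  · have h1 : ContMDiffAt J 𝓘(ℝ, E₂) ∞ ψ (f x) :=
      hf.codChart.contMDiffAt_extend hf.codChart_mem_maximalAtlas hf.mem_codChart_source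
    have h2 : ContDiff ℝ ∞ (fun y : E₂ => (hf.equiv.symm y).1) :=
      contDiff_fst.comp hf.equiv.symm.contDiff
    have h3 : ContMDiffAt J 𝓘(ℝ, E₁) ∞ (fun y => (hf.equiv.symm (ψ y)).1) (f x) :=
      h2.contDiffAt.comp_contMDiffAt h1
    have h4 : ContMDiffAt 𝓘(ℝ, E₁) 𝓘(ℝ, E₁) ∞ φ.symm (hf.equiv.symm (ψ (f x))).1 := by
      rw [key x hx]
      refine (contMDiffOn_extend_symm (n := ∞) hf.domChart_mem_maximalAtlas).contMDiffAt ?_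
      simp only [modelWithCornersSelf_coe, Set.image_id]
      exact hf.domChart.open_target.mem_nhds (hf.domChart.map_source hf.mem_domChart_source)
    exact h4.comp (f x) h3
  · filter_upwards [hf.domChart.open_source.mem_nhds hf.mem_domChart_source] with z hz
    rw [← hsrc] at hz
    simp only [Function.comp_apply, key z hz, φ.left_inv hz, id]

theorem mfderiv_injective_of_isImmersionAt {f : M → N} {x : M}
    (hf : Manifold.IsImmersionAt 𝓘(ℝ, E₁) J ∞ f x) :
    Function.Injective (mfderiv 𝓘(ℝ, E₁) J f x) := by
  obtain ⟨l, hl, hlf⟩ := exists_leftInverse_of_isImmersionAt hf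
  have h : ∀ X : TangentSpace 𝓘(ℝ, E₁) x, tangentMap J 𝓘(ℝ, E₁) l
      ⟨f x, mfderiv 𝓘(ℝ, E₁) J f x X⟩ = ⟨x, X⟩ := by
    intro X
    have h1 := tangentMap_comp_at (p := (⟨x, X⟩ : TangentBundle 𝓘(ℝ, E₁) M))
      (hl.mdifferentiableAt (by simp)) (hf.contMDiffAt.mdifferentiableAt (by simp))
    rw [tangentMap_congr (v := (⟨x, X⟩ : TangentBundle 𝓘(ℝ, E₁) M)) hlf, tangentMap_id] at h1
    exact h1.symm
  intro X Y hXY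
  exact Bundle.TotalSpace.mk_injective x ((h X).symm.trans ((congrArg (fun v =>
    tangentMap J 𝓘(ℝ, E₁) l ⟨f x, v⟩) hXY).trans (h Y)))

end Immersions

/-! ### Maps into an embedded submanifold of `T*Q` and its tangent vectors. -/

section Submanifold

variable {E : Type*} [NormedAddCommGroup E] [NormedSpace ℝ E] [FiniteDimensional ℝ E]
  {Q : Type*} [TopologicalSpace Q] [ChartedSpace E Q] [IsManifold 𝓘(ℝ, E) ∞ Q]
  {ES : Type*} [NormedAddCommGroup ES] [NormedSpace ℝ ES] [FiniteDimensional ℝ ES]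
  {S : Set (Cotangent E Q)} [ChartedSpace ES S] [IsManifold 𝓘(ℝ, ES) ∞ S]
  (hM : Manifold.IsSmoothEmbedding 𝓘(ℝ, ES) (cotModel E) ∞ (Subtype.val : S → Cotangent E Q))
  {EP : Type*} [NormedAddCommGroup EP] [NormedSpace ℝ EP]
  {HP : Type*} [TopologicalSpace HP] {J : ModelWithCorners ℝ EP HP}
  {P : Type*} [TopologicalSpace P] [ChartedSpace HP P]

/-- The embedding is inducing, which gives continuity; an immersion then reflects smoothness of
continuous maps. -/
theorem contMDiffAt_of_val
    (hM : Manifold.IsSmoothEmbedding 𝓘(ℝ, ES) (cotModel E) ∞ (Subtype.val : S → Cotangent E Q))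
    {f : P → S} {x : P}
    (hf : ContMDiffAt J (cotModel E) ∞ (fun y => (f y : Cotangent E Q)) x) :
    ContMDiffAt J 𝓘(ℝ, ES) ∞ f x :=
  (ContMDiffAt.iff_comp_isImmersionAt (hM.isImmersion.isImmersionAt (f x))).2
    ⟨hM.isEmbedding.isInducing.continuousAt_iff.2 hf.continuousAt, hf⟩

theorem contMDiff_tau
    (hM : Manifold.IsSmoothEmbedding 𝓘(ℝ, ES) (cotModel E) ∞ (Subtype.val : S → Cotangent E Q)) :
    ContMDiff 𝓘(ℝ, ES) 𝓘(ℝ, E) ∞ (tau : S → Q) :=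
  contMDiff_cotangent_proj.comp hM.contMDiff

theorem inclDeriv_injective
    (hM : Manifold.IsSmoothEmbedding 𝓘(ℝ, ES) (cotModel E) ∞ (Subtype.val : S → Cotangent E Q))
    (m : S) : Function.Injective (inclDeriv (ES := ES) m) :=
  mfderiv_injective_of_isImmersionAt (hM.isImmersion.isImmersionAt m)

theorem tauDeriv_apply
    (hM : Manifold.IsSmoothEmbedding 𝓘(ℝ, ES) (cotModel E) ∞ (Subtype.val : S → Cotangent E Q))
    (m : S) (X : TangentSpace 𝓘(ℝ, ES) m) :
    tauDeriv m X = mfderiv (cotModel E) 𝓘(ℝ, E) (fun x : Cotangent E Q => x.proj) m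
      (inclDeriv m X) := by
  have h := mfderiv_comp (I' := cotModel E) m
    (contMDiff_cotangent_proj.mdifferentiable (by simp) (m : Cotangent E Q))
    (hM.contMDiff.mdifferentiable (by simp) m)
  exact DFunLike.congr_fun h X

/-- Smooth maps into `T*Q` with values in `S` near a point give tangent vectors of `S`. -/
theorem exists_inclDeriv_eq
    (hM : Manifold.IsSmoothEmbedding 𝓘(ℝ, ES) (cotModel E) ∞ (Subtype.val : S → Cotangent E Q))
    {f : P → Cotangent E Q} {x : P} (hf : ContMDiffAt J (cotModel E) ∞ f x)
    (hS : ∀ᶠ y in 𝓝 x, f y ∈ S) {m : S} {v : TangentSpace J x}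
    {X : TangentSpace (cotModel E) (m : Cotangent E Q)}
    (h : tangentMap J (cotModel E) f ⟨x, v⟩ = ⟨m, X⟩) :
    ∃ Y : TangentSpace 𝓘(ℝ, ES) m, inclDeriv m Y = X := by
  classical
  -- The corestriction of `f` to `S`; the value `m` away from `S` is irrelevant because `f` lies in
  -- `S` near `x`.
  set g : P → S := fun y => if h : f y ∈ S then ⟨f y, h⟩ else m with hg
  have hgf : (fun y => (g y : Cotangent E Q)) =ᶠ[𝓝 x] f := by
    filter_upwards [hS] with y hy
    simp [hg, hy]
  have hgs : ContMDiffAt J 𝓘(ℝ, ES) ∞ g x :=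
    contMDiffAt_of_val hM (hf.congr_of_eventuallyEq hgf)
  have h1 := tangentMap_comp_at (p := (⟨x, v⟩ : TangentBundle J P))
    (hM.contMDiff.mdifferentiable (by simp) (g x)) (hgs.mdifferentiableAt (by simp))
  have h2 : tangentMap J (cotModel E) (Subtype.val ∘ g) ⟨x, v⟩ = ⟨m, X⟩ :=
    (tangentMap_congr (v := (⟨x, v⟩ : TangentBundle J P)) hgf).trans h
  rw [h2] at h1
  -- The definition of `g` mentions `m`, so it is forgotten before `m` is replaced by `g x`.
  clear_value g
  obtain rfl : m = g x := Subtype.ext (congrArg Bundle.TotalSpace.proj h1)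
  exact ⟨_, (Bundle.TotalSpace.mk_injective _ h1).symm⟩

end Submanifold

/-! ### The lifted action on the constraint submanifold and its generators. -/

section Constraint

variable {E : Type*} [NormedAddCommGroup E] [NormedSpace ℝ E] [FiniteDimensional ℝ E]
  {Q : Type*} [TopologicalSpace Q] [ChartedSpace E Q] [IsManifold 𝓘(ℝ, E) ∞ Q]
  {EG : Type*} [NormedAddCommGroup EG] [NormedSpace ℝ EG]
  {G : Type*} [Group G] [TopologicalSpace G]
  [ChartedSpace EG G] [LieGroup 𝓘(ℝ, EG) ∞ G]
  [MulAction G Q] [ContMDiffSMul 𝓘(ℝ, EG) 𝓘(ℝ, E) ∞ G Q]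
  {κ : Metric E Q} {D : ∀ q : Q, Submodule ℝ (TangentSpace 𝓘(ℝ, E) q)}

theorem mfderiv_smul_surjective
    (hG : ∀ g : G, ContMDiff 𝓘(ℝ, E) 𝓘(ℝ, E) ∞ (fun x : Q => g • x)) (g : G) (q : Q) :
    Function.Surjective (mfderiv 𝓘(ℝ, E) 𝓘(ℝ, E) (fun x : Q => g • x) q) :=
  have h : ∀ A : E →L[ℝ] E, Function.Injective A → Function.Surjective A :=
    fun A => (LinearMap.injective_iff_surjective (f := A.toLinearMap)).1
  h _ (Function.LeftInverse.injective (inverse_mfderiv_smul_apply hG g q))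

/-- By invariance of the metric the lift of `κ(v, ·)` is `κ(Tg v, ·)`; surjectivity of `Tg` lets it
be tested on vectors `Tg w`. -/
theorem cotangentLift_mem_constraintSet
    (hG : ∀ g : G, ContMDiff 𝓘(ℝ, E) 𝓘(ℝ, E) ∞ (fun x : Q => g • x))
    (hκ : IsInvariantMetric G κ) (hDG : IsInvariantDistribution G D) (g : G) {p : Cotangent E Q}
    (hp : p ∈ constraintSet κ D) : cotangentLift g p ∈ constraintSet κ D := by
  obtain ⟨v, hv, hpv⟩ := hp
  refine ⟨mfderiv 𝓘(ℝ, E) 𝓘(ℝ, E) (fun x : Q => g • x) p.proj v, hDG g _ v hv, ?_⟩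
  ext w
  obtain ⟨w, rfl⟩ := mfderiv_smul_surjective hG g p.proj w
  refine (cotangentLift_apply hG g p _).trans ?_
  rw [hpv]
  exact (hκ g p.proj v _).symm

variable {ES : Type*} [NormedAddCommGroup ES] [NormedSpace ℝ ES] [FiniteDimensional ℝ ES]
  {S : Set (Cotangent E Q)} [ChartedSpace ES S] [IsManifold 𝓘(ℝ, ES) ∞ S]

theorem restrictedAction_val {g : G} (hS : ∀ p ∈ S, cotangentLift g p ∈ S) (m : S) :
    (restrictedAction g m : Cotangent E Q) = cotangentLift g (m : Cotangent E Q) := by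
  rw [restrictedAction, dif_pos (hS _ m.2)]

theorem restrictedAction_one (m : S) : restrictedAction (1 : G) m = m := by
  unfold restrictedAction
  split_ifs with h
  · exact Subtype.ext (cotangentLift_one _)
  · rfl

theorem contMDiff_cotangentLift_orbit (p : Cotangent E Q) :
    ContMDiff 𝓘(ℝ, EG) (cotModel E) ∞ (fun g : G => cotangentLift g p) :=
  (contMDiff_cotangentLift E Q EG G).comp (contMDiff_id.prodMk contMDiff_const)

theorem contMDiff_restrictedAction_orbit
    (hM : Manifold.IsSmoothEmbedding 𝓘(ℝ, ES) (cotModel E) ∞ (Subtype.val : S → Cotangent E Q))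
    (hS : ∀ (g : G), ∀ p ∈ S, cotangentLift g p ∈ S) (m : S) :
    ContMDiff 𝓘(ℝ, EG) 𝓘(ℝ, ES) ∞ (fun g : G => restrictedAction g m) := fun g =>
  contMDiffAt_of_val hM
    ((contMDiff_cotangentLift_orbit (m : Cotangent E Q)).congr
      (fun g => restrictedAction_val (hS g) m) g)

theorem inclDeriv_genS
    (hM : Manifold.IsSmoothEmbedding 𝓘(ℝ, ES) (cotModel E) ∞ (Subtype.val : S → Cotangent E Q))
    (hS : ∀ (g : G), ∀ p ∈ S, cotangentLift g p ∈ S) (m : S) (ξ : GroupLieAlgebra 𝓘(ℝ, EG) G) :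
    inclDeriv m (genS (ES := ES) G m ξ) =
      infGen (cotModel E) (cotangentLift : G → Cotangent E Q → Cotangent E Q) m ξ :=
  mfderiv_infGen (restrictedAction_one m) (hM.contMDiff.mdifferentiable (by simp) m)
    ((contMDiff_restrictedAction_orbit hM hS m).mdifferentiable (by simp) 1)
    (fun g => restrictedAction_val (hS g) m) ξ

theorem mfderiv_proj_infGen (p : Cotangent E Q) (ξ : GroupLieAlgebra 𝓘(ℝ, EG) G) :
    mfderiv (cotModel E) 𝓘(ℝ, E) (fun x : Cotangent E Q => x.proj) p
      (infGen (cotModel E) (cotangentLift : G → Cotangent E Q → Cotangent E Q) p ξ) =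
      genQ G p.proj ξ :=
  mfderiv_infGen (act' := fun (g : G) (x : Q) => g • x) (cotangentLift_one p)
    (contMDiff_cotangent_proj.mdifferentiable (by simp) p)
    ((contMDiff_cotangentLift_orbit p).mdifferentiable (by simp) 1) (fun _ => rfl) ξ

/-- Equivariance of `τ`. This transfers every condition on generators in `𝓜` to `Q`. -/
theorem tauDeriv_genS
    (hM : Manifold.IsSmoothEmbedding 𝓘(ℝ, ES) (cotModel E) ∞ (Subtype.val : S → Cotangent E Q))
    (hS : ∀ (g : G), ∀ p ∈ S, cotangentLift g p ∈ S) (m : S) (ξ : GroupLieAlgebra 𝓘(ℝ, EG) G) :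
    tauDeriv m (genS (ES := ES) G m ξ) = genQ G (tau m) ξ := by
  rw [tauDeriv_apply hM, inclDeriv_genS hM hS]
  exact mfderiv_proj_infGen _ ξ

theorem canonicalMomentum_apply (p : Cotangent E Q) (ξ : GroupLieAlgebra 𝓘(ℝ, EG) G) :
    canonicalMomentum G p ξ = p.2 (genQ G p.proj ξ) :=
  congrArg p.2 (mfderiv_proj_infGen p ξ)

theorem thetaS_genS
    (hM : Manifold.IsSmoothEmbedding 𝓘(ℝ, ES) (cotModel E) ∞ (Subtype.val : S → Cotangent E Q))
    (hS : ∀ (g : G), ∀ p ∈ S, cotangentLift g p ∈ S) (m : S) (ξ : GroupLieAlgebra 𝓘(ℝ, EG) G) :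
    thetaS m (genS (ES := ES) G m ξ) = (m : Cotangent E Q).2 (genQ G (tau m) ξ) :=
  (congrArg (liouville (m : Cotangent E Q)) (inclDeriv_genS hM hS m ξ)).trans
    (canonicalMomentum_apply _ ξ)

theorem genS_injective [T2Space Q] [FiniteDimensional ℝ EG]
    (hfree : ∀ (g : G) (q : Q), g • q = q → g = 1)
    (hM : Manifold.IsSmoothEmbedding 𝓘(ℝ, ES) (cotModel E) ∞ (Subtype.val : S → Cotangent E Q))
    (hS : ∀ (g : G), ∀ p ∈ S, cotangentLift g p ∈ S) (m : S) :
    Function.Injective (genS (EG := EG) (ES := ES) G m) := by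
  intro ξ η h
  apply genQ_injective (E := E) hfree (tau m)
  rw [← tauDeriv_genS (ES := ES) hM hS, ← tauDeriv_genS (ES := ES) hM hS, h]

end Constraint

/-! ### Tangent spaces of `κ♯(D)`. -/

section ConstraintGeometry

variable {E : Type*} [NormedAddCommGroup E] [NormedSpace ℝ E]
  {Q : Type*} [TopologicalSpace Q] [ChartedSpace E Q] [IsManifold 𝓘(ℝ, E) ∞ Q]

/-- The fibre coordinate of a covector in the trivialization of `T*Q` at `q₀`. -/
def fibreCoord (q₀ : Q) (p : Cotangent E Q) : E →L[ℝ] ℝ :=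
  (trivializationAt (E →L[ℝ] ℝ) (fun q : Q => TangentSpace 𝓘(ℝ, E) q →L[ℝ] ℝ) q₀ p).2

theorem fibreCoord_self (p : Cotangent E Q) (a : TangentSpace 𝓘(ℝ, E) p.proj →L[ℝ] ℝ) :
    fibreCoord p.proj ⟨p.proj, a⟩ = a := by
  have h := congrArg Prod.snd (extChartAt_cotangent_fibre p a)
  rw [FiberBundle.extChartAt] at h
  exact h

theorem contMDiffAt_fibreCoord (p : Cotangent E Q) :
    ContMDiffAt (cotModel E) 𝓘(ℝ, E →L[ℝ] ℝ) ∞ (fibreCoord p.proj) p :=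
  (Bundle.contMDiffAt_totalSpace.1 (contMDiffAt_id (x := p))).2

theorem fibreCoord_sum (q₀ : Q) {q : Q}
    (hq : q ∈ (trivializationAt (E →L[ℝ] ℝ)
      (fun q : Q => TangentSpace 𝓘(ℝ, E) q →L[ℝ] ℝ) q₀).baseSet) {ι : Type*} [Fintype ι]
    (b : ι → TangentSpace 𝓘(ℝ, E) q →L[ℝ] ℝ) (a : ι → ℝ) :
    fibreCoord q₀ ⟨q, ∑ i, a i • b i⟩ = familyMap (fun i => fibreCoord q₀ ⟨q, b i⟩) a := by
  have h1 : ∀ v : TangentSpace 𝓘(ℝ, E) q →L[ℝ] ℝ, fibreCoord q₀ ⟨q, v⟩ =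
      (trivializationAt (E →L[ℝ] ℝ)
        (fun q : Q => TangentSpace 𝓘(ℝ, E) q →L[ℝ] ℝ) q₀).linearMapAt ℝ q v := fun v => by
    rw [Bundle.Trivialization.coe_linearMapAt_of_mem _ hq]; rfl
  simp only [h1, familyMap_apply, map_sum, map_smul]

theorem fibreCoord_injective (q₀ : Q) {q : Q}
    (hq : q ∈ (trivializationAt (E →L[ℝ] ℝ)
      (fun q : Q => TangentSpace 𝓘(ℝ, E) q →L[ℝ] ℝ) q₀).baseSet)
    {a b : TangentSpace 𝓘(ℝ, E) q →L[ℝ] ℝ} (h : fibreCoord q₀ ⟨q, a⟩ = fibreCoord q₀ ⟨q, b⟩) :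
    a = b := by
  set e := trivializationAt (E →L[ℝ] ℝ) (fun q : Q => TangentSpace 𝓘(ℝ, E) q →L[ℝ] ℝ) q₀ with he
  have h3 : e ⟨q, a⟩ = e ⟨q, b⟩ := Prod.ext ((e.coe_fst' hq).trans (e.coe_fst' hq).symm) h
  exact Bundle.TotalSpace.mk_injective q (e.injOn (e.mem_source.2 hq) (e.mem_source.2 hq) h3)

variable [FiniteDimensional ℝ E]

theorem metric_injective (κ : Metric E Q) (q : Q) : Function.Injective (κ.inner q) := by
  intro v w h
  by_contra hne
  have h1 := κ.pos q (v - w) (sub_ne_zero.2 hne)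
  have h2 : κ.inner q (v - w) = 0 := by rw [map_sub, h, sub_self]
  rw [h2] at h1
  exact lt_irrefl _ h1

theorem eq_zero_of_metric_self {κ : Metric E Q} {q : Q} {v : TangentSpace 𝓘(ℝ, E) q}
    (h : κ.inner q v v = 0) : v = 0 := by
  by_contra hne
  exact (κ.pos q v hne).ne' h

variable {κ : Metric E Q} {D : ∀ q : Q, Submodule ℝ (TangentSpace 𝓘(ℝ, E) q)}
  {ES : Type*} [NormedAddCommGroup ES] [NormedSpace ℝ ES] [FiniteDimensional ℝ ES]
  [ChartedSpace ES (constraintSet κ D)] [IsManifold 𝓘(ℝ, ES) ∞ (constraintSet κ D)]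

theorem exists_eq_metric (m : constraintSet κ D) :
    ∃ v ∈ D (tau m), (m : Cotangent E Q).2 = κ.inner (tau m) v := m.2

/-- The fibres of `κ♯(D)` are linear, so the line `m + s κ(w, ·)` stays in it. -/
theorem exists_inclDeriv_eq_vertLift
    (hM : Manifold.IsSmoothEmbedding 𝓘(ℝ, ES) (cotModel E) ∞
      (Subtype.val : constraintSet κ D → Cotangent E Q))
    (m : constraintSet κ D) {w : TangentSpace 𝓘(ℝ, E) (tau m)} (hw : w ∈ D (tau m)) :
    ∃ Y : TangentSpace 𝓘(ℝ, ES) m, inclDeriv m Y =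
      vertLift (m : Cotangent E Q) (κ.inner (tau m) w) := by
  obtain ⟨hc, hc'⟩ := vertLift_curve (m : Cotangent E Q) (κ.inner (tau m) w)
  refine exists_inclDeriv_eq hM hc (Filter.Eventually.of_forall fun s => ?_) hc'
  obtain ⟨v, hv, hmv⟩ := exists_eq_metric m
  refine ⟨v + s • w, (D _).add_mem hv ((D _).smul_mem s hw), ?_⟩
  refine (congrArg (· + s • κ.inner (tau m) w) hmv).trans ?_
  exact ((κ.inner (tau m)).map_add v (s • w)).trans
    (congrArg _ ((κ.inner (tau m)).map_smul s w)) |>.symm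

/-- Keeping the coefficients of `v` in a local frame of `D` constant gives a local section `σ` of
`𝓜` through `m`; `Tσ(d)` is a tangent vector of `𝓜` over `d`. -/
theorem tauDeriv_surjective (hD : IsRegularDistribution D)
    (hM : Manifold.IsSmoothEmbedding 𝓘(ℝ, ES) (cotModel E) ∞
      (Subtype.val : constraintSet κ D → Cotangent E Q))
    (m : constraintSet κ D) : Function.Surjective (tauDeriv (ES := ES) m) := by
  intro d
  obtain ⟨k, X, hX, hXev⟩ := exists_frame hD (tau m)
  obtain ⟨v, hv, hmv⟩ := exists_eq_metric m
  obtain ⟨a, ha⟩ : ∃ a : Fin k → ℝ, ∑ i, a i • X i (tau m) = v := by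
    rw [← Submodule.mem_span_range_iff_exists_fun, hXev.self_of_nhds.2]; exact hv
  have hs : ContMDiffAt 𝓘(ℝ, E) 𝓘(ℝ, E).tangent ∞
      (fun q => (⟨q, ∑ i, a i • X i q⟩ : TangentBundle 𝓘(ℝ, E) Q)) (tau m) :=
    ContMDiffAt.sum_section fun i _ => ContMDiffAt.const_smul_section (hX i)
  set σ : Q → Cotangent E Q := fun q => ⟨q, κ.inner q (∑ i, a i • X i q)⟩ with hσ
  have hσs : ContMDiffAt 𝓘(ℝ, E) (cotModel E) ∞ σ (tau m) := contMDiffAt_metric κ hs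
  have hσm : σ (tau m) = m := by
    refine congrArg (Bundle.TotalSpace.mk (tau m)) (Eq.trans ?_ hmv.symm)
    exact congrArg _ ha
  have hproj := tangentMap_comp_at (p := (⟨tau m, d⟩ : TangentBundle 𝓘(ℝ, E) Q))
    (contMDiff_cotangent_proj.mdifferentiable (by simp) _) (hσs.mdifferentiableAt (by simp))
  have hid : (fun x : Cotangent E Q => x.proj) ∘ σ = id := rfl
  rw [hid, tangentMap_id] at hproj
  obtain ⟨Z, hZ⟩ : ∃ Z : TangentSpace (cotModel E) (m : Cotangent E Q),
      tangentMap 𝓘(ℝ, E) (cotModel E) σ ⟨tau m, d⟩ = ⟨m, Z⟩ := by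
    rw [← hσm]; exact ⟨_, rfl⟩
  have hev : ∀ᶠ q in 𝓝 (tau m), σ q ∈ constraintSet κ D := by
    filter_upwards [hXev] with q hq
    refine ⟨_, ?_, rfl⟩
    show ∑ i, a i • X i q ∈ D q
    rw [← hq.2]
    exact (Submodule.mem_span_range_iff_exists_fun ℝ).2 ⟨a, rfl⟩
  obtain ⟨Y, hY⟩ := exists_inclDeriv_eq hM hσs hev hZ
  refine ⟨Y, ?_⟩
  rw [tauDeriv_apply hM, hY]
  rw [hZ] at hproj
  exact (Bundle.TotalSpace.mk_injective _ hproj).symm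

theorem inclDeriv_of_tauDeriv_eq_zero
    (hM : Manifold.IsSmoothEmbedding 𝓘(ℝ, ES) (cotModel E) ∞
      (Subtype.val : constraintSet κ D → Cotangent E Q))
    {m : constraintSet κ D} {X : TangentSpace 𝓘(ℝ, ES) m} (hX : tauDeriv m X = 0) :
    ∃ β : TangentSpace 𝓘(ℝ, E) (tau m) →L[ℝ] ℝ, inclDeriv m X = vertLift (m : Cotangent E Q) β := by
  rw [tauDeriv_apply hM] at hX
  have h := tangentMap_cotangent_proj (m : Cotangent E Q) (inclDeriv m X)
  have h1 := (Bundle.TotalSpace.mk_injective _ h).symm.trans hX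
  exact ⟨(tangentEquiv (cotModel E) (m : Cotangent E Q) (inclDeriv m X)).2,
    Prod.ext h1 rfl⟩

/-- The vertical tangent vectors of `κ♯(D)` are the vertical lifts of the elements of `κ♯(D)`. -/
theorem exists_eq_metric_of_inclDeriv_eq_vertLift (hD : IsRegularDistribution D)
    (hM : Manifold.IsSmoothEmbedding 𝓘(ℝ, ES) (cotModel E) ∞
      (Subtype.val : constraintSet κ D → Cotangent E Q))
    {m : constraintSet κ D} {X : TangentSpace 𝓘(ℝ, ES) m}
    {β : TangentSpace 𝓘(ℝ, E) (m : Cotangent E Q).proj →L[ℝ] ℝ}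
    (hX : inclDeriv m X = vertLift (m : Cotangent E Q) β) :
    ∃ u ∈ D (tau m), β = κ.inner (tau m) u := by
  obtain ⟨k, X', hX', hXev⟩ := exists_frame hD (tau m)
  have hs : ∀ i, ContMDiffAt 𝓘(ℝ, E) 𝓘(ℝ, E →L[ℝ] ℝ) ∞
      (fun q => fibreCoord (tau m) ⟨q, κ.inner q (X' i q)⟩) (tau m) := fun i =>
    (Bundle.contMDiffAt_totalSpace.1 (contMDiffAt_metric κ (hX' i))).2
  set L : Q → (Fin k → ℝ) →L[ℝ] (E →L[ℝ] ℝ) := fun q =>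
    familyMap fun i => fibreCoord (tau m) ⟨q, κ.inner q (X' i q)⟩ with hL
  have hLs : ContMDiffAt 𝓘(ℝ, E) 𝓘(ℝ, (Fin k → ℝ) →L[ℝ] (E →L[ℝ] ℝ)) ∞ L (tau m) :=
    (contDiff_familyMap (E := E →L[ℝ] ℝ) (ι := Fin k)).contDiffAt.comp_contMDiffAt
      (f := fun q i => fibreCoord (tau m) ⟨q, κ.inner q (X' i q)⟩) (contMDiffAt_pi_space.2 hs)
  have hbase := FiberBundle.mem_baseSet_trivializationAt' (F := E →L[ℝ] ℝ)
    (E := fun q : Q => TangentSpace 𝓘(ℝ, E) q →L[ℝ] ℝ) (tau m)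
  have hLa : ∀ q ∈ (trivializationAt (E →L[ℝ] ℝ)
      (fun q : Q => TangentSpace 𝓘(ℝ, E) q →L[ℝ] ℝ) (tau m)).baseSet, ∀ a : Fin k → ℝ,
      fibreCoord (tau m) ⟨q, κ.inner q (∑ i, a i • X' i q)⟩ = L q a := by
    intro q hq a
    rw [hL, ← fibreCoord_sum (tau m) hq, map_sum]
    simp only [map_smul]
  have hinj : Function.Injective (L (tau m)) := by
    intro a b hab
    rw [← hLa _ hbase, ← hLa _ hbase] at hab
    have h1 := metric_injective κ _ (fibreCoord_injective _ hbase hab)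
    have h4 := Fintype.linearIndependent_iff.1 hXev.self_of_nhds.1 (fun i => a i - b i)
      (by simp only [sub_smul, Finset.sum_sub_distrib, h1, sub_self])
    exact funext fun i => sub_eq_zero.1 (h4 i)
  obtain ⟨l, hl, hlev⟩ := exists_contMDiffAt_leftInverse hLs hinj
  -- Near `τ m` the map `L ∘ l` is a fibrewise projection onto `κ♯(D)` in coordinates, so `h` is a
  -- local equation of `𝓜` and its derivative kills tangent vectors of `𝓜`.
  set h : Cotangent E Q → (E →L[ℝ] ℝ) := fun p =>
    fibreCoord (tau m) p - L p.proj (l p.proj (fibreCoord (tau m) p)) with hh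
  have hpr : ContMDiffAt (cotModel E) 𝓘(ℝ, E) ∞ (fun p : Cotangent E Q => p.proj) m :=
    contMDiff_cotangent_proj.contMDiffAt
  have hF : ContMDiffAt (cotModel E) 𝓘(ℝ, E →L[ℝ] ℝ) ∞ (fibreCoord (tau m)) (m : Cotangent E Q) :=
    contMDiffAt_fibreCoord (m : Cotangent E Q)
  have hhs : ContMDiffAt (cotModel E) 𝓘(ℝ, E →L[ℝ] ℝ) ∞ h m :=
    hF.sub ((hLs.comp (m : Cotangent E Q) hpr).clm_apply
      ((hl.comp (m : Cotangent E Q) hpr).clm_apply hF))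
  have hmd := hhs.mdifferentiableAt (by simp)
  -- `h` vanishes on the constraint set
  have hzero : h ∘ (Subtype.val : constraintSet κ D → Cotangent E Q) =ᶠ[𝓝 m] fun _ => 0 := by
    have hev : ∀ᶠ q in 𝓝 (tau m), q ∈ (trivializationAt (E →L[ℝ] ℝ)
      (fun q : Q => TangentSpace 𝓘(ℝ, E) q →L[ℝ] ℝ) (tau m)).baseSet :=
      (trivializationAt _ _ _).open_baseSet.mem_nhds hbase
    have hc : ContinuousAt (tau : constraintSet κ D → Q) m :=
      (contMDiff_tau hM).continuous.continuousAt
    filter_upwards [hc.eventually (hev.and (hlev.and hXev))] with x hx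
    obtain ⟨hx1, hx2, -, hx3⟩ := hx
    obtain ⟨v, hv, hxv⟩ := exists_eq_metric x
    obtain ⟨a, ha⟩ : ∃ a : Fin k → ℝ, ∑ i, a i • X' i (tau x) = v := by
      rw [← Submodule.mem_span_range_iff_exists_fun, hx3]; exact hv
    have hFx : fibreCoord (tau m) (x : Cotangent E Q) = L (tau x) a := by
      rw [← hLa _ hx1, ha]
      exact congrArg (fun β => fibreCoord (tau m) (Bundle.TotalSpace.mk (tau x) β)) hxv
    show fibreCoord (tau m) (x : Cotangent E Q) -
      L (tau x) (l (tau x) (fibreCoord (tau m) (x : Cotangent E Q))) = 0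
    rw [hFx, hx2, sub_self]
  have h1 := tangentMap_comp_at (p := (⟨m, X⟩ : TangentBundle 𝓘(ℝ, ES) (constraintSet κ D)))
    hmd (hM.contMDiff.mdifferentiable (by simp) m)
  rw [tangentMap_congr (v := (⟨m, X⟩ : TangentBundle 𝓘(ℝ, ES) (constraintSet κ D))) hzero] at h1
  obtain ⟨hc, hc'⟩ := vertLift_curve (m : Cotangent E Q) β
  have hc0 : (⟨(m : Cotangent E Q).proj, (m : Cotangent E Q).2 + (0 : ℝ) • β⟩ : Cotangent E Q) =
      m := congrArg (Bundle.TotalSpace.mk (m : Cotangent E Q).proj)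
        (by rw [zero_smul]; exact add_zero _)
  have h2 := tangentMap_comp_at (vecAt (0 : ℝ) (1 : ℝ)) (f := fun s : ℝ =>
    (⟨(m : Cotangent E Q).proj, (m : Cotangent E Q).2 + s • β⟩ : Cotangent E Q)) (g := h)
    (I'' := 𝓘(ℝ, E →L[ℝ] ℝ)) (by rw [← hc0] at hmd; exact hmd) (hc.mdifferentiableAt (by simp))
  have h3 : tangentMap 𝓘(ℝ, ES) (cotModel E)
      (Subtype.val : constraintSet κ D → Cotangent E Q) ⟨m, X⟩ =
      ⟨m, vertLift (m : Cotangent E Q) β⟩ :=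
    congrArg (Bundle.TotalSpace.mk (m : Cotangent E Q)) hX
  rw [h3, ← hc', ← h2] at h1
  set B : E →L[ℝ] ℝ := β with hB
  set A : E →L[ℝ] ℝ := (m : Cotangent E Q).2 with hA
  -- On the fibre over `τ m` the function `h` is linear, so its derivative along the curve `m + sβ`
  -- is `β - L(l β)`. Its vanishing exhibits `β` in the image of `L`, with frame coefficients `l β`.
  have hcurve : ∀ s : ℝ, h ⟨(m : Cotangent E Q).proj, (m : Cotangent E Q).2 + s • β⟩ =
      (A - L (tau m) (l (tau m) A)) + s • (B - L (tau m) (l (tau m) B)) := by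
    intro s
    have e1 : fibreCoord (tau m)
        ⟨(m : Cotangent E Q).proj, (m : Cotangent E Q).2 + s • β⟩ = A + s • B :=
      fibreCoord_self (m : Cotangent E Q) _
    show fibreCoord (tau m) ⟨(m : Cotangent E Q).proj, (m : Cotangent E Q).2 + s • β⟩ -
      L (tau m) (l (tau m) (fibreCoord (tau m)
        ⟨(m : Cotangent E Q).proj, (m : Cotangent E Q).2 + s • β⟩)) = _
    rw [e1]
    simp only [map_add, map_smul, smul_sub]
    abel
  have h4 : deriv (fun s : ℝ => (A - L (tau m) (l (tau m) A)) +
      s • (B - L (tau m) (l (tau m) B))) 0 = 0 := by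
    have e1 := congrArg (fun v : TangentBundle 𝓘(ℝ, E →L[ℝ] ℝ) (E →L[ℝ] ℝ) =>
      tangentEquiv 𝓘(ℝ, E →L[ℝ] ℝ) v.1 v.2) h1
    have e2 : mfderiv 𝓘(ℝ, ES) 𝓘(ℝ, E →L[ℝ] ℝ)
        (fun _ : constraintSet κ D => (0 : E →L[ℝ] ℝ)) m X = 0 := by
      rw [mfderiv_const]; rfl
    have e3 := e1.symm.trans e2
    rw [← funext hcurve]
    refine Eq.trans ?_ e3
    exact (congrArg (fun A : ℝ →L[ℝ] (E →L[ℝ] ℝ) => A 1)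
      (mfderiv_eq_fderiv (f := fun s : ℝ =>
        h ⟨(m : Cotangent E Q).proj, (m : Cotangent E Q).2 + s • β⟩) (x := (0 : ℝ)))).symm
  have h5 : B = L (tau m) (l (tau m) B) := by
    have h6 : HasDerivAt (fun s : ℝ => (A - L (tau m) (l (tau m) A)) +
      s • (B - L (tau m) (l (tau m) B))) ((1 : ℝ) • (B - L (tau m) (l (tau m) B))) 0 :=
      ((hasDerivAt_id (0 : ℝ)).smul_const _).const_add _
    rw [h6.deriv, one_smul, sub_eq_zero] at h4
    exact h4
  refine ⟨∑ i, l (tau m) B i • X' i (tau m), ?_, ?_⟩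
  · rw [← hXev.self_of_nhds.2]
    exact (Submodule.mem_span_range_iff_exists_fun ℝ).2 ⟨_, rfl⟩
  · apply fibreCoord_injective _ hbase
    rw [hLa _ hbase, ← h5]
    exact fibreCoord_self (m : Cotangent E Q) _

end ConstraintGeometry

/-! ### Splittings, curvature, nondegeneracy and invertibility for the symmetric system. -/

section System

variable {E : Type*} [NormedAddCommGroup E] [NormedSpace ℝ E] [FiniteDimensional ℝ E]
  {Q : Type*} [TopologicalSpace Q] [T2Space Q] [ChartedSpace E Q] [IsManifold 𝓘(ℝ, E) ∞ Q]
  {EG : Type*} [NormedAddCommGroup EG] [NormedSpace ℝ EG] [FiniteDimensional ℝ EG]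
  {G : Type*} [Group G] [TopologicalSpace G]
  [ChartedSpace EG G] [LieGroup 𝓘(ℝ, EG) ∞ G]
  [MulAction G Q] [ContMDiffSMul 𝓘(ℝ, EG) 𝓘(ℝ, E) ∞ G Q]
  {κ : Metric E Q} {D W : ∀ q : Q, Submodule ℝ (TangentSpace 𝓘(ℝ, E) q)}
  {ES : Type*} [NormedAddCommGroup ES] [NormedSpace ℝ ES] [FiniteDimensional ℝ ES]
  [ChartedSpace ES (constraintSet κ D)] [IsManifold 𝓘(ℝ, ES) ∞ (constraintSet κ D)]

/-- A nonholonomic system with a free symmetry group and a vertical complement of the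
constraints. -/
structure IsSymmetricSystem (EG : Type*) [NormedAddCommGroup EG] [NormedSpace ℝ EG]
    (G : Type*) [Group G] [TopologicalSpace G] [ChartedSpace EG G] [MulAction G Q]
    (κ : Metric E Q) (D W : ∀ q : Q, Submodule ℝ (TangentSpace 𝓘(ℝ, E) q))
    (ES : Type*) [NormedAddCommGroup ES] [NormedSpace ℝ ES] [ChartedSpace ES (constraintSet κ D)] :
    Prop where
  free : ∀ (g : G) (q : Q), g • q = q → g = 1
  metric : IsInvariantMetric G κ
  regular : IsRegularDistribution D
  invariant : IsInvariantDistribution G D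
  regular_compl : IsRegularDistribution W
  isCompl : ∀ q : Q, IsCompl (D q) (W q)
  vertical : ∀ q : Q, W q ≤ LinearMap.range (genQ (EG := EG) G q)
  embedding : Manifold.IsSmoothEmbedding 𝓘(ℝ, ES) (cotModel E) ∞
    (Subtype.val : constraintSet κ D → Cotangent E Q)

namespace IsSymmetricSystem

theorem lift_mem (h : IsSymmetricSystem EG G κ D W ES) (g : G) :
    ∀ p ∈ constraintSet κ D, cotangentLift g p ∈ constraintSet κ D := fun _ hp =>
  cotangentLift_mem_constraintSet (contMDiff_smul_left EG) h.metric h.invariant g hp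

theorem tauDeriv_genS (h : IsSymmetricSystem EG G κ D W ES) (m : constraintSet κ D)
    (ξ : GroupLieAlgebra 𝓘(ℝ, EG) G) :
    tauDeriv m (genS (ES := ES) G m ξ) = genQ G (tau m) ξ :=
  Nonholonomic.tauDeriv_genS h.embedding h.lift_mem m ξ

theorem thetaS_genS (h : IsSymmetricSystem EG G κ D W ES) (m : constraintSet κ D)
    (ξ : GroupLieAlgebra 𝓘(ℝ, EG) G) :
    thetaS m (genS (ES := ES) G m ξ) = (m : Cotangent E Q).2 (genQ G (tau m) ξ) :=
  Nonholonomic.thetaS_genS h.embedding h.lift_mem m ξ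

theorem genQ_injective (h : IsSymmetricSystem EG G κ D W ES) (q : Q) :
    Function.Injective (genQ (EG := EG) (E := E) G q) :=
  Nonholonomic.genQ_injective h.free q

theorem genS_injective (h : IsSymmetricSystem EG G κ D W ES) (m : constraintSet κ D) :
    Function.Injective (genS (EG := EG) (ES := ES) G m) :=
  Nonholonomic.genS_injective h.free h.embedding h.lift_mem m

theorem genS_mem_distC (h : IsSymmetricSystem EG G κ D W ES) {m : constraintSet κ D}
    {ξ : GroupLieAlgebra 𝓘(ℝ, EG) G} :
    genS (ES := ES) G m ξ ∈ distC D m ↔ genQ G (tau m) ξ ∈ D (tau m) := by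
  rw [← h.tauDeriv_genS]; rfl

theorem genS_mem_distW (h : IsSymmetricSystem EG G κ D W ES) {m : constraintSet κ D}
    {ξ : GroupLieAlgebra 𝓘(ℝ, EG) G} :
    genS (ES := ES) G m ξ ∈ distW EG G W m ↔ genQ G (tau m) ξ ∈ W (tau m) := by
  rw [← h.tauDeriv_genS]
  exact and_iff_right (LinearMap.mem_range_self _ ξ)

theorem mem_algS (h : IsSymmetricSystem EG G κ D W ES) {m : constraintSet κ D}
    {ξ : GroupLieAlgebra 𝓘(ℝ, EG) G} :
    ξ ∈ algS (ES := ES) EG G D m ↔ genQ G (tau m) ξ ∈ D (tau m) := by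
  rw [← h.genS_mem_distC]
  exact and_iff_right (LinearMap.mem_range_self _ ξ)

theorem mem_algW (h : IsSymmetricSystem EG G κ D W ES) {m : constraintSet κ D}
    {ξ : GroupLieAlgebra 𝓘(ℝ, EG) G} :
    ξ ∈ algW (ES := ES) EG G W m ↔ genQ G (tau m) ξ ∈ W (tau m) := by
  rw [← h.genS_mem_distW]; rfl

theorem eq_zero_of_genQ_mem (h : IsSymmetricSystem EG G κ D W ES) {q : Q}
    {ξ : GroupLieAlgebra 𝓘(ℝ, EG) G} (hD : genQ G q ξ ∈ D q) (hW : genQ G q ξ ∈ W q) : ξ = 0 := by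
  apply h.genQ_injective q
  rw [map_zero]
  exact Submodule.disjoint_def.1 (h.isCompl q).disjoint _ hD hW

theorem exists_add_genQ (h : IsSymmetricSystem EG G κ D W ES) {q : Q}
    (v : TangentSpace 𝓘(ℝ, E) q) :
    ∃ (d : TangentSpace 𝓘(ℝ, E) q) (ξ : GroupLieAlgebra 𝓘(ℝ, EG) G),
      d ∈ D q ∧ genQ G q ξ ∈ W q ∧ d + genQ G q ξ = v := by
  obtain ⟨d, hd, w, hw, hdw⟩ := exists_add_of_isCompl (h.isCompl q) v
  obtain ⟨ξ, rfl⟩ := h.vertical q hw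
  exact ⟨d, ξ, hd, hw, hdw⟩

theorem exists_add_genS (h : IsSymmetricSystem EG G κ D W ES) {m : constraintSet κ D}
    (X : TangentSpace 𝓘(ℝ, ES) m) :
    ∃ (Y : TangentSpace 𝓘(ℝ, ES) m) (ξ : GroupLieAlgebra 𝓘(ℝ, EG) G),
      Y ∈ distC D m ∧ genQ G (tau m) ξ ∈ W (tau m) ∧ Y + genS G m ξ = X := by
  obtain ⟨d, ξ, hd, hξ, hX⟩ := h.exists_add_genQ (tauDeriv m X)
  refine ⟨X - genS G m ξ, ξ, ?_, hξ, sub_add_cancel _ _⟩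
  show tauDeriv m (X - genS G m ξ) ∈ D (tau m)
  rw [map_sub, h.tauDeriv_genS, ← hX, add_sub_cancel_right]
  exact hd

theorem isCompl_distC_distW (h : IsSymmetricSystem EG G κ D W ES) (m : constraintSet κ D) :
    IsCompl (distC (ES := ES) D m) (distW EG G W m) := by
  refine ⟨Submodule.disjoint_def.2 ?_, codisjoint_iff.2 (eq_top_iff.2 fun X _ => ?_)⟩
  · rintro X hX hX'
    obtain ⟨ξ, rfl⟩ := hX'.1
    rw [h.eq_zero_of_genQ_mem (h.genS_mem_distC.1 hX) (h.genS_mem_distW.1 hX'), map_zero]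
  · obtain ⟨Y, ξ, hY, hξ, hX⟩ := h.exists_add_genS X
    exact Submodule.mem_sup.2 ⟨Y, hY, _, h.genS_mem_distW.2 hξ, hX⟩

theorem isCompl_algS_algW (h : IsSymmetricSystem EG G κ D W ES) (m : constraintSet κ D) :
    IsCompl (algS (ES := ES) EG G D m) (algW (ES := ES) EG G W m) := by
  refine ⟨Submodule.disjoint_def.2 ?_, codisjoint_iff.2 (eq_top_iff.2 fun η _ => ?_)⟩
  · intro ξ hξ hξ'
    exact h.eq_zero_of_genQ_mem (h.mem_algS.1 hξ) (h.mem_algW.1 hξ')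
  · obtain ⟨d, ξ, hd, hξ, hη⟩ := h.exists_add_genQ (genQ G (tau m) η)
    refine Submodule.mem_sup.2 ⟨η - ξ, h.mem_algS.2 ?_, ξ, h.mem_algW.2 hξ, sub_add_cancel _ _⟩
    rw [map_sub, ← hη, add_sub_cancel_right]
    exact hd

/-- `𝒜_𝒲 = τ*A`: both forms vanish on `𝒞` and give `ξ` on generators `ξ_𝓜 ∈ 𝒲`. Smoothness and
exterior derivative are thereby inherited from `Q`. -/
theorem formA_apply (h : IsSymmetricSystem EG G κ D W ES) (m : constraintSet κ D)
    (X : TangentSpace 𝓘(ℝ, ES) m) :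
    formA EG G D W m X = connQ EG G D W (tau m) (tauDeriv m X) := by
  obtain ⟨Y, ξ, hY, hξ, rfl⟩ := h.exists_add_genS X
  rw [map_add (tauDeriv m), h.tauDeriv_genS, connQ_add h.free (h.isCompl _) hY hξ]
  exact congrArg (tangentEquiv 𝓘(ℝ, EG) (1 : G)) (leftInverse_projOnto (h.genS_injective m)
    (h.isCompl_distC_distW m) hY (h.genS_mem_distW.2 hξ))

theorem contMDiff_connQ (h : IsSymmetricSystem EG G κ D W ES) :
    ContMDiff 𝓘(ℝ, E).tangent 𝓘(ℝ, EG) ∞ (oneFormMap (connQ EG G D W)) :=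
  Nonholonomic.contMDiff_connQ h.free h.regular h.regular_compl h.isCompl h.vertical

theorem extDerivOne_formA (h : IsSymmetricSystem EG G κ D W ES) (m : constraintSet κ D)
    (X Y : TangentSpace 𝓘(ℝ, ES) m) :
    extDerivOne 𝓘(ℝ, ES) (fun x : constraintSet κ D => formA EG G D W x) m X Y =
      extDerivOne 𝓘(ℝ, E) (connQ EG G D W) (tau m) (tauDeriv m X) (tauDeriv m Y) :=
  extDerivOne_pullback (connQ EG G D W) h.contMDiff_connQ
    (fun x : constraintSet κ D => formA EG G D W x) (contMDiff_tau h.embedding)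
    (fun v => h.formA_apply v.1 v.2) m X Y

theorem projC_of_mem (h : IsSymmetricSystem EG G κ D W ES) {m : constraintSet κ D}
    {X : TangentSpace 𝓘(ℝ, ES) m} (hX : X ∈ distC D m) : projC EG G D W m X = X :=
  congrArg Subtype.val (projOnto_of_mem_left (h.isCompl_distC_distW m) hX)

/-- The curvature of the complement, evaluated on the momentum map. -/
theorem formJK_apply (h : IsSymmetricSystem EG G κ D W ES) (m : constraintSet κ D)
    (X Y : TangentSpace 𝓘(ℝ, ES) m) :
    formJK EG G D W m X Y = (m : Cotangent E Q).2 (genQ G (tau m)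
      ((tangentEquiv 𝓘(ℝ, EG) (1 : G)).symm (extDerivOne 𝓘(ℝ, E) (connQ EG G D W) (tau m)
        (tauDeriv m (projC EG G D W m X)) (tauDeriv m (projC EG G D W m Y))))) := by
  rw [← h.extDerivOne_formA, ← h.thetaS_genS]
  rfl

/-- The `𝔤_𝒲`-component of `η` is `A(η_Q)`. This expresses a projection onto a varying subspace by a
smooth `𝔤`-valued function on `Q`. -/
theorem projAlgS_apply (h : IsSymmetricSystem EG G κ D W ES) (m : constraintSet κ D)
    (η : GroupLieAlgebra 𝓘(ℝ, EG) G) :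
    (projAlgS ES EG G D W m η : GroupLieAlgebra 𝓘(ℝ, EG) G) =
      η - (tangentEquiv 𝓘(ℝ, EG) (1 : G)).symm (connQ EG G D W (tau m) (genQ G (tau m) η)) := by
  obtain ⟨ζ, hζ, ν, hν, rfl⟩ := exists_add_of_isCompl (h.isCompl_algS_algW m) η
  rw [map_add (genQ G (tau m)), connQ_add h.free (h.isCompl _) (h.mem_algS.1 hζ) (h.mem_algW.1 hν),
    LinearEquiv.symm_apply_apply, add_sub_cancel_right]
  exact congrArg Subtype.val (projOnto_add (h.isCompl_algS_algW m) hζ hν)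

theorem omegaS_skew (m : constraintSet κ D) (X Y : TangentSpace 𝓘(ℝ, ES) m) :
    omegaS m X Y = -omegaS m Y X := by
  have hs : ∀ (p : Cotangent E Q) (X Y : TangentSpace (cotModel E) p),
      canonicalForm p X Y = -canonicalForm p Y X := by
    intro p X Y
    have : ∀ a b : ℝ, -(a - b) = - -(b - a) := fun a b => by ring
    exact this _ _
  exact hs _ _ _

theorem omegaS_eq_of_vertLift (h : IsSymmetricSystem EG G κ D W ES) {m : constraintSet κ D}
    {Y : TangentSpace 𝓘(ℝ, ES) m} {β : TangentSpace 𝓘(ℝ, E) (m : Cotangent E Q).proj →L[ℝ] ℝ}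
    (hY : inclDeriv m Y = vertLift (m : Cotangent E Q) β) (X : TangentSpace 𝓘(ℝ, ES) m) :
    omegaS m X Y = β (tauDeriv m X) := by
  rw [tauDeriv_apply h.embedding]
  exact (congrArg (canonicalForm (m : Cotangent E Q) (inclDeriv m X)) hY).trans
    (canonicalForm_vertLift _ _ _)

theorem tauDeriv_eq_zero_of_vertLift (h : IsSymmetricSystem EG G κ D W ES) {m : constraintSet κ D}
    {Y : TangentSpace 𝓘(ℝ, ES) m} {β : TangentSpace 𝓘(ℝ, E) (m : Cotangent E Q).proj →L[ℝ] ℝ}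
    (hY : inclDeriv m Y = vertLift (m : Cotangent E Q) β) : tauDeriv m Y = 0 := by
  rw [tauDeriv_apply h.embedding, hY]
  exact Bundle.TotalSpace.mk_injective _ (tangentMap_cotangent_proj (m : Cotangent E Q) _)

theorem mem_distC_of_tauDeriv_eq_zero {m : constraintSet κ D} {Y : TangentSpace 𝓘(ℝ, ES) m}
    (hY : tauDeriv m Y = 0) : Y ∈ distC D m := by
  show tauDeriv m Y ∈ D (tau m)
  rw [hY]; exact zero_mem _

/-- A vector of `𝒞` which is `Ω`-orthogonal to the vertical vectors is vertical. -/
theorem tauDeriv_eq_zero (h : IsSymmetricSystem EG G κ D W ES) {m : constraintSet κ D}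
    {X : TangentSpace 𝓘(ℝ, ES) m} (hX : X ∈ distC D m)
    (hXY : ∀ Y : TangentSpace 𝓘(ℝ, ES) m, tauDeriv m Y = 0 → omegaS m X Y = 0) :
    tauDeriv m X = 0 := by
  obtain ⟨Y, hY⟩ := exists_inclDeriv_eq_vertLift h.embedding m hX
  have h1 := hXY Y (h.tauDeriv_eq_zero_of_vertLift hY)
  rw [h.omegaS_eq_of_vertLift hY] at h1
  exact eq_zero_of_metric_self h1

/-- Vertical test vectors force `Tτ X = 0`; then `X` is the lift of `κ(u, ·)` with `u ∈ D`, and a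
test vector over `u` gives `κ(u, u) = 0`. -/
theorem nondegenerate (h : IsSymmetricSystem EG G κ D W ES) (m : constraintSet κ D) :
    ((omegaS (ES := ES) m).restrict (distC D m)).Nondegenerate := by
  refine nondegenerate_restrict fun X hX hXY => ?_
  have h1 : tauDeriv m X = 0 := h.tauDeriv_eq_zero hX fun Y hY =>
    hXY Y (mem_distC_of_tauDeriv_eq_zero hY)
  obtain ⟨β, hβ⟩ := inclDeriv_of_tauDeriv_eq_zero h.embedding h1
  obtain ⟨u, hu, hβu⟩ := exists_eq_metric_of_inclDeriv_eq_vertLift h.regular h.embedding hβ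
  obtain ⟨Y, hY⟩ := tauDeriv_surjective h.regular h.embedding m u
  have hYC : Y ∈ distC D m := by show tauDeriv m Y ∈ D (tau m); rwa [hY]
  have h2 := hXY Y hYC
  rw [omegaS_skew, h.omegaS_eq_of_vertLift hβ, hβu, hY, neg_eq_zero] at h2
  apply inclDeriv_injective h.embedding m
  have hβ0 : β = 0 := by
    rw [hβu, eq_zero_of_metric_self h2]; exact map_zero (κ.inner (tau m))
  rw [hβ, hβ0, map_zero]
  rfl

/-- The curvature term depends on the `τ`-projections of vectors of `𝒞` only, so it vanishes against
vertical `Y`. If `Ω(X, ·) = B(X, ·)` on `𝒞`, the vertical test therefore still yields `Tτ X = 0`,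
whence `B X = 0`. -/
theorem isUnit_gaugeEndo (h : IsSymmetricSystem EG G κ D W ES) (m : constraintSet κ D) :
    IsUnit (gaugeEndo (sharpNh (ES := ES) D m) (-formJK EG G D W m)) := by
  refine Nonholonomic.isUnit_gaugeEndo (h.nondegenerate m) fun X hX hXY => ?_
  have h1 : tauDeriv m X = 0 := h.tauDeriv_eq_zero hX fun Y hY => by
    rw [hXY Y (mem_distC_of_tauDeriv_eq_zero hY), LinearMap.neg_apply, LinearMap.neg_apply,
      h.formJK_apply, h.projC_of_mem (mem_distC_of_tauDeriv_eq_zero hY), hY]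
    simp only [map_zero, neg_eq_zero]
    exact map_zero _
  ext Y
  rw [LinearMap.neg_apply, LinearMap.neg_apply, h.formJK_apply, h.projC_of_mem hX, h1]
  simp only [map_zero, LinearMap.zero_apply, neg_eq_zero]
  exact map_zero _

end IsSymmetricSystem
end System

/-! ### Contracting `dα` with a generator. -/

section InvariantForms

variable {E : Type*} [NormedAddCommGroup E] [NormedSpace ℝ E] [FiniteDimensional ℝ E]
  {H : Type*} [TopologicalSpace H] {I : ModelWithCorners ℝ E H} [I.Boundaryless]
  {N : Type*} [TopologicalSpace N] [ChartedSpace H N] [IsManifold I ∞ N]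
  {F : Type*} [NormedAddCommGroup F] [NormedSpace ℝ F]
  {EG : Type*} [NormedAddCommGroup EG] [NormedSpace ℝ EG]
  {G : Type*} [Group G] [TopologicalSpace G] [ChartedSpace EG G] [IsManifold 𝓘(ℝ, EG) ∞ G]

theorem tangentMap_prodMk_left (s : ℝ) :
    tangentMap 𝓘(ℝ, ℝ) 𝓘(ℝ, ℝ × ℝ) (fun t : ℝ => ((t, s) : ℝ × ℝ)) (vecAt 0 1) =
      vecAt (0, s) (1, 0) := by
  have h : HasFDerivAt (fun t : ℝ => ((t, s) : ℝ × ℝ)) _ 0 :=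
    (hasFDerivAt_id (𝕜 := ℝ) (0 : ℝ)).prodMk (hasFDerivAt_const (𝕜 := ℝ) s (0 : ℝ))
  rw [tangentMap_vecAt, mfderiv_eq_fderiv, h.fderiv]
  rfl

theorem tangentMap_prodMk_right (t : ℝ) :
    tangentMap 𝓘(ℝ, ℝ) 𝓘(ℝ, ℝ × ℝ) (fun s : ℝ => ((t, s) : ℝ × ℝ)) (vecAt 0 1) =
      vecAt (t, 0) (0, 1) := by
  have h : HasFDerivAt (fun s : ℝ => ((t, s) : ℝ × ℝ)) _ 0 :=
    (hasFDerivAt_const (𝕜 := ℝ) t (0 : ℝ)).prodMk (hasFDerivAt_id (𝕜 := ℝ) (0 : ℝ))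
  rw [tangentMap_vecAt, mfderiv_eq_fderiv, h.fderiv]
  rfl

/-- Cartan's formula `i_ξ dα = - d(i_ξ α)` on a vector `Y` along whose orbit `α` is constant. -/
theorem extDerivOne_infGen {act : G → N → N}
    (hact : ContMDiff (𝓘(ℝ, EG).prod I) I ∞ (fun z : G × N => act z.1 z.2))
    (h1 : ∀ x, act 1 x = x) (α : ∀ x : N, TangentSpace I x →ₗ[ℝ] F)
    (hα : ContMDiff I.tangent 𝓘(ℝ, F) ∞ (oneFormMap α)) {x : N}
    (ξ : GroupLieAlgebra 𝓘(ℝ, EG) G) {Y : TangentSpace I x} {c : ℝ → N}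
    (hc : ContMDiffAt 𝓘(ℝ, ℝ) I ∞ c 0) (hcY : tangentMap 𝓘(ℝ, ℝ) I c (vecAt 0 1) = ⟨x, Y⟩)
    {a : F} (ha : ∀ g, oneFormMap α (tangentMap I I (act g) ⟨x, Y⟩) = a) :
    extDerivOne I α x (infGen I act x ξ) Y =
      -deriv (fun s => oneFormMap α ⟨c s, infGen I act (c s) ξ⟩) 0 := by
  obtain ⟨γ, hγ, hγξ⟩ := exists_curve (⟨1, ξ⟩ : TangentBundle 𝓘(ℝ, EG) G)
  have hγ0 : γ 0 = 1 := congrArg Bundle.TotalSpace.proj hγξ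
  have hc0 : c 0 = x := congrArg Bundle.TotalSpace.proj hcY
  have horb : ∀ y, ContMDiff 𝓘(ℝ, EG) I ∞ (fun g => act g y) := fun y =>
    hact.comp (contMDiff_id.prodMk contMDiff_const)
  have hmul : ∀ g, ContMDiff I I ∞ (act g) := fun g =>
    hact.comp (contMDiff_const.prodMk contMDiff_id)
  -- For `f(t, s) = γ(t) · c(s)` the `t`-velocity at `(0, s)` is the generator at `c s`, and the
  -- `s`-velocity at `(t, 0)` is the translate of `Y` by `γ(t)`, on which `α` has the constant value
  -- `a`. One of the two mixed derivatives vanishes.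
  set f : ℝ × ℝ → N := fun z => act (γ z.1) (c z.2) with hf
  have hfs : ContMDiffAt 𝓘(ℝ, ℝ × ℝ) I ∞ f 0 := by
    have e1 : ContMDiffAt 𝓘(ℝ, ℝ × ℝ) 𝓘(ℝ, EG) ∞ (fun z : ℝ × ℝ => γ z.1) 0 :=
      ContMDiffAt.comp (0 : ℝ × ℝ) (g := γ) hγ contDiff_fst.contMDiff.contMDiffAt
    have e2 : ContMDiffAt 𝓘(ℝ, ℝ × ℝ) I ∞ (fun z : ℝ × ℝ => c z.2) 0 :=
      ContMDiffAt.comp (0 : ℝ × ℝ) (g := c) hc contDiff_snd.contMDiff.contMDiffAt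
    exact hact.contMDiffAt.comp (0 : ℝ × ℝ) (e1.prodMk e2)
  have hfm : ∀ᶠ z in 𝓝 (0 : ℝ × ℝ), MDifferentiableAt 𝓘(ℝ, ℝ × ℝ) I f z := by
    filter_upwards [(contMDiffAt_iff_contMDiffAt_nhds (by decide)).1
      (hfs.of_le (m := 1) ENat.LEInfty.out)] with z hz using hz.mdifferentiableAt (by simp)
  have t1 : Filter.Tendsto (fun t : ℝ => ((t, 0) : ℝ × ℝ)) (𝓝 0) (𝓝 0) :=
    (Continuous.prodMk continuous_id continuous_const).tendsto' _ _ rfl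
  have t2 : Filter.Tendsto (fun t : ℝ => ((0, t) : ℝ × ℝ)) (𝓝 0) (𝓝 0) :=
    (Continuous.prodMk continuous_const continuous_id).tendsto' _ _ rfl
  have h2 : ∀ᶠ s in 𝓝 (0 : ℝ), tangentMap 𝓘(ℝ, ℝ × ℝ) I f (vecAt (0, s) (1, 0)) =
      ⟨c s, infGen I act (c s) ξ⟩ := by
    filter_upwards [t2.eventually hfm] with s hs
    have e1 := tangentMap_comp_at (vecAt (0 : ℝ) (1 : ℝ)) (f := fun t : ℝ => ((t, s) : ℝ × ℝ)) (g := f)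
      (I' := 𝓘(ℝ, ℝ × ℝ)) hs
      (((contDiff_id.prodMk contDiff_const).contMDiff (n := ∞)).mdifferentiable (by simp) _)
    have e2 := tangentMap_comp_at (vecAt (0 : ℝ) (1 : ℝ)) (f := γ) (g := fun g => act g (c s))
      ((horb (c s)).mdifferentiable (by simp) _) (hγ.mdifferentiableAt (by simp))
    rw [hγξ, ← mk_infGen (h1 _)] at e2
    rw [tangentMap_prodMk_left] at e1
    exact e1.symm.trans e2
  have h3 : ∀ᶠ t in 𝓝 (0 : ℝ), tangentMap 𝓘(ℝ, ℝ × ℝ) I f (vecAt (t, 0) (0, 1)) =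
      tangentMap I I (act (γ t)) ⟨x, Y⟩ := by
    filter_upwards [t1.eventually hfm] with t ht
    have e1 := tangentMap_comp_at (vecAt (0 : ℝ) (1 : ℝ)) (f := fun s : ℝ => ((t, s) : ℝ × ℝ)) (g := f)
      (I' := 𝓘(ℝ, ℝ × ℝ)) ht
      (((contDiff_const.prodMk contDiff_id).contMDiff (n := ∞)).mdifferentiable (by simp) _)
    have e2 := tangentMap_comp_at (vecAt (0 : ℝ) (1 : ℝ)) (f := c) (g := act (γ t))
      ((hmul (γ t)).mdifferentiable (by simp) _) (hc.mdifferentiableAt (by simp))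
    rw [hcY] at e2
    rw [tangentMap_prodMk_right] at e1
    exact e1.symm.trans e2
  have hX : tangentMap 𝓘(ℝ, ℝ × ℝ) I f (vecAt 0 (1, 0)) = ⟨x, infGen I act x ξ⟩ := by
    refine h2.self_of_nhds.trans ?_
    rw [hc0]
  have hY : tangentMap 𝓘(ℝ, ℝ × ℝ) I f (vecAt 0 (0, 1)) = ⟨x, Y⟩ := by
    refine h3.self_of_nhds.trans ?_
    rw [hγ0, show act 1 = id from funext h1, tangentMap_id, id]
  have h4 : (fun t : ℝ => oneFormMap α (tangentMap 𝓘(ℝ, ℝ × ℝ) I f (vecAt (t, 0) (0, 1))))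
      =ᶠ[𝓝 0] fun _ => a := h3.mono fun t ht => (congrArg _ ht).trans (ha _)
  have h5 : (fun s : ℝ => oneFormMap α (tangentMap 𝓘(ℝ, ℝ × ℝ) I f (vecAt (0, s) (1, 0))))
      =ᶠ[𝓝 0] fun s => oneFormMap α ⟨c s, infGen I act (c s) ξ⟩ :=
    h2.mono fun s hs => congrArg _ hs
  rw [extDerivOne_eq_deriv_sub_deriv α hα hfs hX hY, h4.deriv_eq, h5.deriv_eq, deriv_const,
    zero_sub]

/-- Derivative of the value of a family of functionals on a family of vectors which vanishes at
the point. -/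
theorem hasDerivAt_dual_apply {V : Type*} [NormedAddCommGroup V] [NormedSpace ℝ V]
    [FiniteDimensional ℝ V] {φ : ℝ → Module.Dual ℝ V} {u : ℝ → V} {u' : V}
    (hφ : ∀ v, DifferentiableAt ℝ (fun s => φ s v) 0) (hu : HasDerivAt u u' 0) (hu0 : u 0 = 0) :
    HasDerivAt (fun s => φ s (u s)) (φ 0 u') 0 := by
  set b := Module.finBasis ℝ V with hb
  have e : ∀ s v, φ s v = ∑ k, b.repr v k * φ s (b k) := by
    intro s v
    conv_lhs => rw [← b.sum_repr v, map_sum]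
    simp
  have h1 : ∀ k, HasDerivAt (fun s => b.repr (u s) k) (b.repr u' k) 0 := fun k =>
    ((LinearMap.toContinuousLinearMap (b.coord k)).hasFDerivAt (x := u 0)).comp_hasDerivAt 0 hu
  have h2 : HasDerivAt (fun s => ∑ k, b.repr (u s) k * φ s (b k))
      (∑ k, (b.repr u' k * φ 0 (b k) + b.repr (u 0) k * deriv (fun s => φ s (b k)) 0)) 0 :=
    HasDerivAt.fun_sum fun k _ => (h1 k).mul (hφ (b k)).hasDerivAt
  -- The terms containing derivatives of `φ` carry the factor `u 0 = 0`.
  simp only [hu0, map_zero, Finsupp.coe_zero, Pi.zero_apply, zero_mul, add_zero] at h2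
  rw [← e] at h2
  exact h2.congr_of_eventuallyEq (Filter.Eventually.of_forall fun s => e s (u s))

end InvariantForms

/-! ### The momentum maps: statements (i) and (ii). -/

section Momentum

variable {E : Type*} [NormedAddCommGroup E] [NormedSpace ℝ E] [FiniteDimensional ℝ E]
  {Q : Type*} [TopologicalSpace Q] [T2Space Q] [ChartedSpace E Q] [IsManifold 𝓘(ℝ, E) ∞ Q]
  {EG : Type*} [NormedAddCommGroup EG] [NormedSpace ℝ EG] [FiniteDimensional ℝ EG]
  {G : Type*} [Group G] [TopologicalSpace G]
  [ChartedSpace EG G] [LieGroup 𝓘(ℝ, EG) ∞ G]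
  [MulAction G Q] [ContMDiffSMul 𝓘(ℝ, EG) 𝓘(ℝ, E) ∞ G Q]
  {κ : Metric E Q} {D W : ∀ q : Q, Submodule ℝ (TangentSpace 𝓘(ℝ, E) q)}
  {ES : Type*} [NormedAddCommGroup ES] [NormedSpace ℝ ES] [FiniteDimensional ℝ ES]
  [ChartedSpace ES (constraintSet κ D)] [IsManifold 𝓘(ℝ, ES) ∞ (constraintSet κ D)]

theorem contMDiff_genQ_comp {a : Q → EG} (ha : ContMDiff 𝓘(ℝ, E) 𝓘(ℝ, EG) ∞ a) :
    ContMDiff 𝓘(ℝ, E) 𝓘(ℝ, E).tangent ∞ (fun q : Q => (⟨q, genQ G q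
      ((tangentEquiv 𝓘(ℝ, EG) (1 : G)).symm (a q))⟩ : TangentBundle 𝓘(ℝ, E) Q)) := by
  intro q₀
  set b := Module.finBasis ℝ EG with hb
  have hk : ∀ k, ContMDiffAt 𝓘(ℝ, E) 𝓘(ℝ, ℝ) ∞ (fun q => b.repr (a q) k) q₀ := fun k =>
    (LinearMap.toContinuousLinearMap (b.coord k)).contDiff.contDiffAt.comp_contMDiffAt
      ha.contMDiffAt
  have hs : ContMDiffAt 𝓘(ℝ, E) 𝓘(ℝ, E).tangent ∞ (fun q : Q => (⟨q, ∑ k, b.repr (a q) k •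
      genQ G q ((tangentEquiv 𝓘(ℝ, EG) (1 : G)).symm (b k))⟩ : TangentBundle 𝓘(ℝ, E) Q)) q₀ :=
    ContMDiffAt.sum_section fun k _ => ContMDiffAt.smul_section (hk k)
      (contMDiff_genQ ((tangentEquiv 𝓘(ℝ, EG) (1 : G)).symm (b k))).contMDiffAt
  refine hs.congr_of_eventuallyEq (Filter.Eventually.of_forall fun q => ?_)
  refine congrArg (Bundle.TotalSpace.mk q) ?_
  conv_lhs => rw [← b.sum_repr (a q), map_sum, map_sum]
  simp only [map_smul]

theorem hasDerivAt_comp_curve {E₁ : Type*} [NormedAddCommGroup E₁] [NormedSpace ℝ E₁]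
    {H₁ : Type*} [TopologicalSpace H₁] {I : ModelWithCorners ℝ E₁ H₁}
    {N : Type*} [TopologicalSpace N] [ChartedSpace H₁ N] {f : N → ℝ} {c : ℝ → N} {x : N}
    {Y : TangentSpace I x} (hf : MDifferentiableAt I 𝓘(ℝ, ℝ) f x)
    (hc : MDifferentiableAt 𝓘(ℝ, ℝ) I c 0)
    (hcY : tangentMap 𝓘(ℝ, ℝ) I c (vecAt 0 1) = ⟨x, Y⟩) :
    HasDerivAt (fun s => f (c s)) (mfderiv I 𝓘(ℝ, ℝ) f x Y) 0 := by
  obtain rfl : c 0 = x := congrArg Bundle.TotalSpace.proj hcY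
  obtain rfl := Bundle.TotalSpace.mk_injective (c 0) hcY
  have h : ∀ (g : ℝ → ℝ) (L : ℝ →L[ℝ] ℝ), HasMFDerivAt 𝓘(ℝ, ℝ) 𝓘(ℝ, ℝ) g 0 L →
      HasDerivAt g (L 1) 0 := fun g L h =>
    have h' : HasFDerivAt g L 0 := hasMFDerivAt_iff_hasFDerivAt.1 h
    h'.hasDerivAt
  exact h _ _ (hf.hasMFDerivAt.comp (0 : ℝ) hc.hasMFDerivAt)

namespace IsSymmetricSystem

/-- `Ψ(m) = m ∘ P_D`: with `m = κ(v, ·)` and `v ∈ D`, the `W`-part of `κ₀(v, ·)` vanishes because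
`P_W v = 0`. -/
theorem Psi_apply (h : IsSymmetricSystem EG G κ D W ES) (m : constraintSet κ D)
    (x : TangentSpace 𝓘(ℝ, E) (tau m)) :
    (Psi κ D W m).2 x = (m : Cotangent E Q).2 (projOnto (D (tau m)) (W (tau m)) x :
      TangentSpace 𝓘(ℝ, E) (tau m)) := by
  obtain ⟨v, hv, hmv⟩ := exists_eq_metric m
  have h1 : Function.invFun (fun v => κ.inner (tau m) v) (m : Cotangent E Q).2 = v := by
    rw [hmv]
    exact Function.leftInverse_invFun (metric_injective κ (tau m)) v
  have h2 : (Psi κ D W m).2 x = splitMetric κ D W (tau m) v x :=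
    congrArg (fun u => splitMetric κ D W (tau m) u x) h1
  rw [h2, hmv]
  show κ.inner (tau m) (projOnto (D (tau m)) (W (tau m)) v : TangentSpace 𝓘(ℝ, E) (tau m))
      (projOnto (D (tau m)) (W (tau m)) x : TangentSpace 𝓘(ℝ, E) (tau m)) +
    κ.inner (tau m) (projOnto (W (tau m)) (D (tau m)) v : TangentSpace 𝓘(ℝ, E) (tau m))
      (projOnto (W (tau m)) (D (tau m)) x : TangentSpace 𝓘(ℝ, E) (tau m)) = _
  rw [projOnto_of_mem_left (h.isCompl _) hv, projOnto_of_mem_right (h.isCompl _).symm hv]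
  simp only [ZeroMemClass.coe_zero, map_zero, zero_apply, add_zero]
  rfl

theorem Psi_mem_annihilator (h : IsSymmetricSystem EG G κ D W ES) (m : constraintSet κ D) :
    Psi κ D W m ∈ annihilator W := fun w hw => by
  refine (h.Psi_apply m w).trans ?_
  have : projOnto (D (tau m)) (W (tau m)) w = 0 := projOnto_of_mem_right (h.isCompl (tau m)) hw
  rw [this]
  exact map_zero _

/-- `ξ ↦ ξ_Q` carries the splitting `𝔤_𝒮 ⊕ 𝔤_𝒲` into `D ⊕ W`, hence intertwines the projections. -/
theorem projOnto_genQ (h : IsSymmetricSystem EG G κ D W ES) (m : constraintSet κ D)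
    (η : GroupLieAlgebra 𝓘(ℝ, EG) G) :
    (projOnto (D (tau m)) (W (tau m)) (genQ G (tau m) η) : TangentSpace 𝓘(ℝ, E) (tau m)) =
      genQ G (tau m) (projAlgS ES EG G D W m η : GroupLieAlgebra 𝓘(ℝ, EG) G) := by
  obtain ⟨ζ, hζ, ν, hν, rfl⟩ := exists_add_of_isCompl (h.isCompl_algS_algW m) η
  rw [map_add (genQ G (tau m)), projOnto_add (h.isCompl _) (h.mem_algS.1 hζ) (h.mem_algW.1 hν),
    projAlgS, projOnto_add (h.isCompl_algS_algW m) hζ hν]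

theorem momentumNhFun_apply (h : IsSymmetricSystem EG G κ D W ES) (m : constraintSet κ D)
    (η : GroupLieAlgebra 𝓘(ℝ, EG) G) :
    momentumNhFun ES EG G D W η m = (m : Cotangent E Q).2 (genQ G (tau m)
      (projAlgS ES EG G D W m η : GroupLieAlgebra 𝓘(ℝ, EG) G)) :=
  h.thetaS_genS m _

theorem canonicalMomentum_Psi (h : IsSymmetricSystem EG G κ D W ES) (m : constraintSet κ D) :
    canonicalMomentum (EG := EG) G (Psi κ D W m) =
      momentumNh ES EG G D m ∘ₗ projAlgS ES EG G D W m := by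
  ext η
  refine (canonicalMomentum_apply _ _).trans ((h.Psi_apply m _).trans ?_)
  exact (congrArg (m : Cotangent E Q).2 (h.projOnto_genQ m η)).trans
    (h.momentumNhFun_apply m η).symm

/-- The `W`-component of `η_Q`, as a `𝔤`-valued function, is smooth. -/
theorem contMDiff_connQ_genQ (h : IsSymmetricSystem EG G κ D W ES)
    (η : GroupLieAlgebra 𝓘(ℝ, EG) G) :
    ContMDiff 𝓘(ℝ, E) 𝓘(ℝ, EG) ∞ (fun q => connQ EG G D W q (genQ G q η)) := by
  have h1 : ContMDiff 𝓘(ℝ, E) 𝓘(ℝ, EG) ∞ (fun q : Q =>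
      oneFormMap (connQ EG G D W) (⟨q, genQ G q η⟩ : TangentBundle 𝓘(ℝ, E) Q)) :=
    h.contMDiff_connQ.comp (contMDiff_genQ η)
  exact h1

theorem contMDiff_momentumNhFun (h : IsSymmetricSystem EG G κ D W ES)
    (η : GroupLieAlgebra 𝓘(ℝ, EG) G) :
    ContMDiff 𝓘(ℝ, ES) 𝓘(ℝ, ℝ) ∞
      (fun m : constraintSet κ D => momentumNhFun ES EG G D W η m) := by
  intro m
  have ha : ContMDiff 𝓘(ℝ, E) 𝓘(ℝ, EG) ∞ (fun q : Q => tangentEquiv 𝓘(ℝ, EG) (1 : G) η -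
      connQ EG G D W q (genQ G q η)) := contMDiff_const.sub (h.contMDiff_connQ_genQ η)
  have h1 : ContMDiffAt 𝓘(ℝ, ES) 𝓘(ℝ, ℝ) ∞ (fun x : constraintSet κ D =>
      (x : Cotangent E Q).2 (genQ G (tau x) ((tangentEquiv 𝓘(ℝ, EG) (1 : G)).symm
        (tangentEquiv 𝓘(ℝ, EG) (1 : G) η - connQ EG G D W (tau x) (genQ G (tau x) η))))) m :=
    contMDiffAt_pairing h.embedding.contMDiff.contMDiffAt
      ((contMDiff_genQ_comp ha).comp (contMDiff_tau h.embedding)).contMDiffAt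
  refine h1.congr_of_eventuallyEq (Filter.Eventually.of_forall fun x => ?_)
  refine (h.momentumNhFun_apply x η).trans ?_
  rw [h.projAlgS_apply]
  rfl

/-- The Hamilton equation `i_ξ Ω = d⟨J, ξ⟩`, along a curve. -/
theorem omegaS_genS (h : IsSymmetricSystem EG G κ D W ES) {m : constraintSet κ D}
    (ζ : GroupLieAlgebra 𝓘(ℝ, EG) G) {Y : TangentSpace 𝓘(ℝ, ES) m} {c : ℝ → constraintSet κ D}
    (hc : ContMDiffAt 𝓘(ℝ, ℝ) 𝓘(ℝ, ES) ∞ c 0)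
    (hcY : tangentMap 𝓘(ℝ, ℝ) 𝓘(ℝ, ES) c (vecAt 0 1) = ⟨m, Y⟩) :
    omegaS m (genS G m ζ) Y =
      deriv (fun s => (c s : Cotangent E Q).2 (genQ G (tau (c s)) ζ)) 0 := by
  have : IsManifold 𝓘(ℝ, EG) ∞ G := LieGroup.toContMDiffMul.toIsManifold
  have hval := h.embedding.contMDiff
  have h1 := tangentMap_comp_at (vecAt (0 : ℝ) (1 : ℝ)) (hval.mdifferentiable (by simp) _)
    (hc.mdifferentiableAt (by simp))
  rw [hcY] at h1
  have h2 := extDerivOne_infGen (contMDiff_cotangentLift E Q EG G) cotangentLift_one liouville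
    contMDiff_liouville (x := (m : Cotangent E Q)) (Y := inclDeriv m Y) ζ
    (hval.contMDiffAt.comp (0 : ℝ) hc) h1
    (fun g => liouville_cotangentLift (contMDiff_smul_left EG) g
      (((contMDiff_cotangentLift E Q EG G).comp
        (contMDiff_const.prodMk contMDiff_id)).mdifferentiable (by simp)) _)
  have h3 : omegaS m (genS G m ζ) Y = -extDerivOne (cotModel E) liouville (m : Cotangent E Q)
      (infGen (cotModel E) (cotangentLift : G → Cotangent E Q → Cotangent E Q) m ζ)
      (inclDeriv m Y) := by
    rw [← inclDeriv_genS h.embedding h.lift_mem]; rfl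
  rw [h3, h2, neg_neg]
  refine congrArg (fun f : ℝ → ℝ => deriv f 0) (funext fun s => ?_)
  exact canonicalMomentum_apply (c s : Cotangent E Q) ζ

/-- `D` is invariant and `A` vanishes on `D`, so `A` is constantly `0` on the translates of `Y ∈ D`.
-/
theorem extDerivOne_connQ_genQ (h : IsSymmetricSystem EG G κ D W ES) {q : Q}
    (η : GroupLieAlgebra 𝓘(ℝ, EG) G) {Y : TangentSpace 𝓘(ℝ, E) q} (hY : Y ∈ D q) {c : ℝ → Q}
    (hc : ContMDiffAt 𝓘(ℝ, ℝ) 𝓘(ℝ, E) ∞ c 0)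
    (hcY : tangentMap 𝓘(ℝ, ℝ) 𝓘(ℝ, E) c (vecAt 0 1) = ⟨q, Y⟩) :
    extDerivOne 𝓘(ℝ, E) (connQ EG G D W) q (genQ G q η) Y =
      -deriv (fun s => connQ EG G D W (c s) (genQ G (c s) η)) 0 := by
  have : IsManifold 𝓘(ℝ, EG) ∞ G := LieGroup.toContMDiffMul.toIsManifold
  exact extDerivOne_infGen (contMDiff_smul (I := 𝓘(ℝ, EG)) (G := G)) (one_smul G) _
    h.contMDiff_connQ η hc hcY (fun g => connQ_of_mem h.isCompl (h.invariant g q Y hY))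

theorem tau_surjective : Function.Surjective (tau : constraintSet κ D → Q) := fun q =>
  ⟨⟨⟨q, κ.inner q 0⟩, 0, zero_mem _, rfl⟩, rfl⟩

/-- Under the vertical symmetry condition, the connection is constant on the generators of the
elements of `𝔤` which are in `𝔤_𝒲` at one point. -/
theorem connQ_genQ_of_verticalSymmetry (h : IsSymmetricSystem EG G κ D W ES)
    (hV : VerticalSymmetry ES (constraintSet κ D) EG G W) {m : constraintSet κ D}
    {ν : GroupLieAlgebra 𝓘(ℝ, EG) G} (hν : genQ G (tau m) ν ∈ W (tau m)) (q : Q) :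
    connQ EG G D W q (genQ G q ν) = tangentEquiv 𝓘(ℝ, EG) (1 : G) ν := by
  obtain ⟨𝔥, -, h𝔥⟩ := hV
  obtain ⟨x, rfl⟩ := tau_surjective (κ := κ) (D := D) q
  have h1 : genS G m ν ∈ 𝔥.map (genS (ES := ES) G m) := h𝔥 m ▸ h.genS_mem_distW.2 hν
  -- Injectivity of the generators puts `ν` itself in `𝔥`, and then `ν_𝓜` lies in `𝒲` at every
  -- point.
  obtain ⟨ν', hν', e⟩ := h1
  obtain rfl : ν' = ν := h.genS_injective m e
  have h2 : genS G x ν' ∈ distW (ES := ES) EG G W x := by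
    rw [h𝔥 x]; exact Submodule.mem_map_of_mem hν'
  have h3 := connQ_add h.free (h.isCompl (tau x)) (zero_mem _) (h.genS_mem_distW.1 h2)
  rwa [zero_add] at h3

/-- It suffices to check `(Ω_𝓜 + ⟨𝒥, 𝒦_𝒲⟩)(ζ_𝓜, Y) = df(Y)` for `Y ∈ 𝒞`, where `ζ` is the value of
`P_{𝔤_𝒮} η` at `m`; both sides are computed along a curve `c` with velocity `Y`. -/
theorem sharpJK_mfderiv_momentumNhFun (h : IsSymmetricSystem EG G κ D W ES)
    (hV : VerticalSymmetry ES (constraintSet κ D) EG G W) (η : GroupLieAlgebra 𝓘(ℝ, EG) G)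
    (m : constraintSet κ D) :
    sharpJK EG G D W m (mfderiv 𝓘(ℝ, ES) 𝓘(ℝ, ℝ)
        (fun x : constraintSet κ D => momentumNhFun ES EG G D W η x) m).toLinearMap =
      -genS G m (projAlgS ES EG G D W m η : GroupLieAlgebra 𝓘(ℝ, EG) G) := by
  obtain ⟨ζ, hζ, ν, hν, hη⟩ := exists_add_of_isCompl (h.isCompl_algS_algW m) η
  have hproj : (projAlgS ES EG G D W m η : GroupLieAlgebra 𝓘(ℝ, EG) G) = ζ := by
    rw [← hη]; exact congrArg Subtype.val (projOnto_add (h.isCompl_algS_algW m) hζ hν)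
  rw [hproj]
  have hζD : genQ G (tau m) ζ ∈ D (tau m) := h.mem_algS.1 hζ
  have hζC : genS G m ζ ∈ distC (ES := ES) D m := h.genS_mem_distC.2 hζD
  have hνW : genQ G (tau m) ν ∈ W (tau m) := h.mem_algW.1 hν
  set e := tangentEquiv 𝓘(ℝ, EG) (1 : G) with he
  refine gaugeTransform_bivectorSharp (h.nondegenerate m) (h.isUnit_gaugeEndo m) hζC
    fun Y hY => ?_
  obtain ⟨c, hc, hcY⟩ := exists_curve (⟨m, Y⟩ : TangentBundle 𝓘(ℝ, ES) (constraintSet κ D))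
  have hc0 : c 0 = m := congrArg Bundle.TotalSpace.proj hcY
  have hτ := contMDiff_tau h.embedding
  have hτc := hτ.contMDiffAt.comp (0 : ℝ) hc
  have hτcY : tangentMap 𝓘(ℝ, ℝ) 𝓘(ℝ, E) ((tau : constraintSet κ D → Q) ∘ c) (vecAt 0 1) =
      ⟨tau m, tauDeriv m Y⟩ := by
    rw [tangentMap_comp_at (vecAt (0 : ℝ) (1 : ℝ)) (hτ.mdifferentiable (by simp) _)
      (hc.mdifferentiableAt (by simp)), hcY]
    rfl
  -- `P_{𝔤_𝒮} η = η - A(η_Q) = ζ + (ν - A(η_Q))`, so `u` is the deviation of the projection along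
  -- `c` from its value `ζ` at `m`.
  set u : ℝ → EG := fun s => e ν - connQ EG G D W (tau (c s)) (genQ G (tau (c s)) η) with hu
  have hud : HasDerivAt u
      (extDerivOne 𝓘(ℝ, E) (connQ EG G D W) (tau m) (genQ G (tau m) ζ) (tauDeriv m Y)) 0 := by
    have h1 := h.extDerivOne_connQ_genQ η hY hτc hτcY
    have h2 := h.extDerivOne_connQ_genQ ν hY hτc hτcY
    -- Vertical symmetry enters here: `A(ν_Q)` is constant, so `dA(ν_Q, Y) = 0` and `dA(η_Q, Y) =
    -- dA(ζ_Q, Y)`.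
    simp only [h.connQ_genQ_of_verticalSymmetry hV hνW, deriv_const, neg_zero] at h2
    rw [← hη, map_add (genQ G (tau m)), map_add, LinearMap.add_apply, h2, add_zero, hη] at h1
    rw [h1, ← zero_sub]
    have h3 : DifferentiableAt ℝ (fun s => connQ EG G D W (tau (c s)) (genQ G (tau (c s)) η)) 0 :=
      (((h.contMDiff_connQ_genQ η).contMDiffAt.comp (0 : ℝ) hτc).mdifferentiableAt
        (by simp)).differentiableAt
    exact (hasDerivAt_const (0 : ℝ) (e ν)).sub h3.hasDerivAt
  have hu0 : u 0 = 0 := by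
    rw [hu]
    show e ν - connQ EG G D W (tau (c 0)) (genQ G (tau (c 0)) η) = 0
    rw [hc0, ← hη, map_add (genQ G (tau m)), connQ_add h.free (h.isCompl _) hζD hνW, sub_self]
  have hJ : ∀ v : EG, DifferentiableAt ℝ
      (fun s => (c s : Cotangent E Q).2 (genQ G (tau (c s)) (e.symm v))) 0 := by
    intro v
    have h1 : ContMDiffAt 𝓘(ℝ, ES) 𝓘(ℝ, ℝ) ∞ (fun x : constraintSet κ D =>
        (x : Cotangent E Q).2 (genQ G (tau x) (e.symm v))) (c 0) :=
      contMDiffAt_pairing h.embedding.contMDiff.contMDiffAt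
        ((contMDiff_genQ (e.symm v)).comp hτ).contMDiffAt
    exact ((h1.comp (0 : ℝ) hc).mdifferentiableAt (by simp)).differentiableAt
  -- Since `u 0 = 0`, only the momentum at `m` applied to `u' = dA(ζ_Q, Tτ Y)` survives; this is the
  -- curvature term.
  have hJu := hasDerivAt_dual_apply (φ := fun s => (c s : Cotangent E Q).2.toLinearMap ∘ₗ
    genQ G (tau (c s)) ∘ₗ e.symm.toLinearMap) hJ hud hu0
  have hJζ := (hJ (e ζ)).hasDerivAt.add hJu
  have hf := hasDerivAt_comp_curve ((h.contMDiff_momentumNhFun η).mdifferentiable (by simp) m)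
    (hc.mdifferentiableAt (by simp)) hcY
  have hsum : ∀ s, momentumNhFun ES EG G D W η (c s) =
      (c s : Cotangent E Q).2 (genQ G (tau (c s)) (e.symm (e ζ))) +
      (c s : Cotangent E Q).2 (genQ G (tau (c s)) (e.symm (u s))) := by
    intro s
    refine (h.momentumNhFun_apply (c s) η).trans ?_
    have e1 : (projAlgS ES EG G D W (c s) η : GroupLieAlgebra 𝓘(ℝ, EG) G) =
        e.symm (e ζ) + e.symm (u s) := by
      rw [h.projAlgS_apply, hu]
      simp only [map_sub, LinearEquiv.symm_apply_apply]
      rw [← add_sub_assoc, hη]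
    exact (congrArg (c s : Cotangent E Q).2 ((congrArg (genQ G (tau (c s))) e1).trans
      (map_add (genQ G (tau (c s))) _ _))).trans (map_add (c s : Cotangent E Q).2 _ _)
  have hd := hf.unique (hJζ.congr_of_eventuallyEq (Filter.Eventually.of_forall hsum))
  refine Eq.trans ?_ hd.symm
  rw [h.omegaS_genS ζ hc hcY, LinearMap.neg_apply, LinearMap.neg_apply, sub_neg_eq_add,
    h.formJK_apply, h.projC_of_mem hζC, h.projC_of_mem hY, h.tauDeriv_genS]
  refine congrArg₂ (· + ·) ?_ ?_
  · rw [LinearEquiv.symm_apply_apply]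
  · rw [hc0]; rfl

end IsSymmetricSystem
end Momentum

end Nonholonomic

end

open Nonholonomic in
theorem mainTheorem10
    {E : Type*} [NormedAddCommGroup E] [NormedSpace ℝ E] [FiniteDimensional ℝ E]
    {Q : Type*} [TopologicalSpace Q] [T2Space Q] [SecondCountableTopology Q]
    [ChartedSpace E Q] [IsManifold 𝓘(ℝ, E) ∞ Q]
    {EG : Type*} [NormedAddCommGroup EG] [NormedSpace ℝ EG] [FiniteDimensional ℝ EG]
    (G : Type*) [Group G] [TopologicalSpace G] [T2Space G] [SecondCountableTopology G]
    [ChartedSpace EG G] [LieGroup 𝓘(ℝ, EG) ∞ G]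
    -- a free and proper smooth action of the Lie group `G` on `Q`
    [MulAction G Q] [ContMDiffSMul 𝓘(ℝ, EG) 𝓘(ℝ, E) ∞ G Q] [ProperSMul G Q]
    (hfree : ∀ (g : G) (q : Q), g • q = q → g = 1)
    -- an invariant kinetic energy metric and an invariant constraint distribution
    (κ : Metric E Q) (hκ : IsInvariantMetric G κ)
    (D : ∀ q : Q, Submodule ℝ (TangentSpace 𝓘(ℝ, E) q))
    (hD : IsRegularDistribution D) (hDG : IsInvariantDistribution G D)
    -- an invariant vertical complement `W` of `D`
    (W : ∀ q : Q, Submodule ℝ (TangentSpace 𝓘(ℝ, E) q))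
    (hW : IsRegularDistribution W) (hWG : IsInvariantDistribution G W)
    (hDW : ∀ q : Q, IsCompl (D q) (W q))
    (hWV : ∀ q : Q, W q ≤ LinearMap.range
      (infGen (EG := EG) 𝓘(ℝ, E) (fun (g : G) (x : Q) => g • x) q))
    -- the structure of smooth submanifold of `T*Q` on the set `𝓜 = κ♯(D)`
    {EM : Type*} [NormedAddCommGroup EM] [NormedSpace ℝ EM] [FiniteDimensional ℝ EM]
    [ChartedSpace EM (constraintSet κ D)] [IsManifold 𝓘(ℝ, EM) ∞ (constraintSet κ D)]
    (hM : Manifold.IsSmoothEmbedding 𝓘(ℝ, EM) (cotModel E) ∞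
      (Subtype.val : constraintSet κ D → Cotangent E Q)) :
    -- the bivectors `π_nh` and `π_JK` and the projection `P_{𝔤_𝒮}` are well defined
    (∀ m : constraintSet κ D,
      ((omegaS (ES := EM) m).restrict (distC D m)).Nondegenerate ∧
      IsUnit (gaugeEndo (sharpNh (ES := EM) D m) (-formJK EG G D W m)) ∧
      IsCompl (algS (ES := EM) EG G D m) (algW (ES := EM) EG G W m)) ∧
    -- (i)
    (∀ m : constraintSet κ D, Psi κ D W m ∈ annihilator W ∧
      canonicalMomentum (EG := EG) G (Psi κ D W m) =
        momentumNh EM EG G D m ∘ₗ projAlgS EM EG G D W m) ∧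
    -- (ii)
    (VerticalSymmetry EM (constraintSet κ D) EG G W →
      ∀ η : GroupLieAlgebra 𝓘(ℝ, EG) G,
        ContMDiff 𝓘(ℝ, EM) 𝓘(ℝ, ℝ) ∞
          (fun m : constraintSet κ D => momentumNhFun EM EG G D W η m) ∧
        ∀ m : constraintSet κ D,
          sharpJK EG G D W m
            (mfderiv 𝓘(ℝ, EM) 𝓘(ℝ, ℝ)
              (fun x : constraintSet κ D => momentumNhFun EM EG G D W η x) m).toLinearMap =
            -genS G m (projAlgS EM EG G D W m η : GroupLieAlgebra 𝓘(ℝ, EG) G)) := by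
  have h : IsSymmetricSystem EG G κ D W EM := ⟨hfree, hκ, hD, hDG, hW, hDW, hWV, hM⟩
  exact ⟨fun m => ⟨h.nondegenerate m, h.isUnit_gaugeEndo m, h.isCompl_algS_algW m⟩,
    fun m => ⟨h.Psi_mem_annihilator m, h.canonicalMomentum_Psi m⟩,
    fun hV η => ⟨h.contMDiff_momentumNhFun η, h.sharpJK_mfderiv_momentumNhFun hV η⟩⟩
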